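/- Let $d\in\{2,3\}$ and let $\mathcal O\subset\mathbb R^d$ be open and satisfy the Poincaré inequality $\lambda_1\int_{\mathcal O}|\psi|^2\le\int_{\mathcal O}|\nabla\psi|^2$ for all $\psi\in H^1_0(\mathcal O;\mathbb R^d)$, with some $\lambda_1>0$. Let $\mu,\alpha,\beta>0$, and let $d=2$ and $r\ge 1$, or $d=3$ and $r>3$, or $d=r=3$ and $2\beta\mu\ge1$. Notation. $\mathcal V$ is the set of divergence-free fields in $C_0^\infty(\mathcal O;\mathbb R^d)$; $\mathbb H$, $\mathbb V$, $\widetilde{\mathbb L}^{p}$ are its closures in $L^2$, $H^1_0$, $L^p(\mathcal O;\mathbb R^d)$. The Stokes operator $\mathrm A$ is the self-adjoint operator in $\mathbb H$ given by $\langle \mathrm A u,\psi\rangle=(\nabla u,\nabla\psi)$ for $u,\psi\in\mathbb V$; further $\langle \mathrm B(u),\psi\rangle=-\sum_{i,j}\int_{\mathcal O}u_i\,\partial_i\psi_j\,u_j\,dx$ and $\langle\mathcal C(u),\psi\rangle=\int_{\mathcal O}|u|^{r-1}u\cdot\psi\,dx$. Put $p=4$ if $r<3$ and $p=r+1$ if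 $r\ge3$, and $\mathrm X=\mathbb H\cap\widetilde{\mathbb L}^p$ with the norm $\|\cdot\|_{L^2}+\|\cdot\|_{L^p}$. Let $0<\delta<\xi<\tfrac12$, and let $\mathrm E$ be the completion of $\{x\in \mathrm X:\mathrm A^{-\delta}x\in \mathrm X\}$ (which is $\mathrm X$ on domains with uniformly $C^3$ boundary) in the norm $\|\mathrm A^{-\delta}x\|_{\mathrm X}$. Let $\omega\in C^\xi_{1/2}(\mathbb R,\mathrm E)$, that is, $\omega:\mathbb R\to\mathrm E$ is continuous, $\omega(0)=0$ and $\sup_{t\ne s}\frac{\|\omega(t)-\omega(s)\|_{\mathrm E}}{|t-s|^\xi(1+|t|+|s|)^{1/2}}<\infty$. For $\chi\ge0$ let $$\Upsilon_\chi(\omega)(t)=\int_{-\infty}^t(\mu\mathrm A+\chi I)^{1+\delta}e^{-(t-\tau)(\mu\mathrm A+\chi I)}\big[(\mu\mathrm A+\chi I)^{-\delta}\omega(t)-(\mu\mathrm A+\chi I)^{-\delta}\omega(\tau)\big]\,d\tau,\qquad t\in\mathbb R.$$ Let $f\in\mathbb V'$ and $x\in\mathbb H$. Given a path $\Upsilon\in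 L^2_{loc}([0,\infty);\mathbb H)\cap L^p_{loc}([0,\infty);\widetilde{\mathbb L}^p)$ (a driving path), a weak solution of $$\frac{dv}{dt}=-\mu\mathrm Av-\mathrm B(v+\Upsilon)-\alpha v-\beta\,\mathcal C(v+\Upsilon)+(\chi-\alpha)\Upsilon+f,\qquad v(0)=x-\Upsilon(0),\tag{1}$$ is a function $v\in C([0,\infty);\mathbb H)\cap L^2_{loc}([0,\infty);\mathbb V)\cap L^{r+1}_{loc}([0,\infty);\widetilde{\mathbb L}^{r+1})$ whose weak derivative is in $L^{(r+1)/r}_{loc}([0,\infty);(\mathbb V\cap\widetilde{\mathbb L}^{r+1})')$, which satisfies (1), tested with every $\psi\in\mathbb V\cap\widetilde{\mathbb L}^{r+1}$, for a.e. $t\ge 0$, and which satisfies for all $t\ge0$ the energy equality $$\|v(t)\|^2_{\mathbb H}+2\mu\int_0^t\|\nabla v\|_{L^2}^2\,ds+2\alpha\int_0^t\|v\|^2_{\mathbb H}\,ds=\|x-\Upsilon(0)\|^2_{\mathbb H}-2\int_0^t\langle \mathrm B(v+\Upsilon),v\rangle ds-2\beta\int_0^t\langle\mathcal C(v+\Upsilon),v\rangle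 ds+2\int_0^t\langle f,v\rangle ds+2(\chi-\alpha)\int_0^t(\Upsilon,v)\,ds .$$ Let $\varphi_\chi(t,\omega,x)=v^\chi(t)+\Upsilon_\chi(\omega)(t)$, $t\ge0$, where $v^\chi$ is a weak solution of (1) with $\Upsilon=\Upsilon_\chi(\omega)$. Then $\varphi_{\chi_1}=\varphi_{\chi_2}$ for all $\chi_1,\chi_2\ge0$. More precisely, for all $\mathcal O,\omega,x,f$ as above: 1. If $v^{\chi_1}$ and $v^{\chi_2}$ are weak solutions of (1) for $(\chi_1,\Upsilon_{\chi_1}(\omega))$ and $(\chi_2,\Upsilon_{\chi_2}(\omega))$, then $v^{\chi_1}(t)+\Upsilon_{\chi_1}(\omega)(t)=v^{\chi_2}(t)+\Upsilon_{\chi_2}(\omega)(t)$ for all $t\ge0$. 2. If $v^{\chi_1}$ is a weak solution of (1) for $(\chi_1,\Upsilon_{\chi_1}(\omega))$ and $\Upsilon_{\chi_2}(\omega)$ is a driving path, then $u=v^{\chi_1}+\Upsilon_{\chi_1}(\omega)$ is also of the form $u=v^{\chi_2}+\Upsilon_{\chi_2}(\omega)$ on $[0,\infty)$ with a weak solution $v^{\chi_2}$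 of (1) for $(\chi_2,\Upsilon_{\chi_2}(\omega))$. -/

import Mathlib

open MeasureTheory Set Filter Topology
open scoped ENNReal NNReal

namespace SCBF

noncomputable section

/-! ### Function spaces -/

/-- The Euclidean space `ℝᵈ`. -/
abbrev Ed (d : ℕ) := EuclideanSpace ℝ (Fin d)

/-- Values of gradients of vector fields, with the Hilbert-Schmidt norm: the `i`-th entry of
`∇u` is the vector `∂ᵢu`. -/
abbrev GradVal (d : ℕ) := PiLp 2 (fun _ : Fin d => Ed d)

/-- The classical gradient of a vector field. -/
def gradField {d : ℕ} (φ : Ed d → Ed d) (x : Ed d) : GradVal d :=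
  WithLp.toLp 2 (fun i => fderiv ℝ φ x (EuclideanSpace.single i 1))

/-- The classical divergence of a vector field. -/
def divField {d : ℕ} (φ : Ed d → Ed d) (x : Ed d) : ℝ :=
  ∑ i : Fin d, gradField φ x i i

/-- `φ ∈ C₀^∞(O; ℝᵈ)`. -/
structure IsSmoothCompact {d : ℕ} (O : Set (Ed d)) (φ : Ed d → Ed d) : Prop where
  smooth : ContDiff ℝ ((⊤ : ℕ∞) : WithTop ℕ∞) φ
  compact : HasCompactSupport φ
  support : tsupport φ ⊆ O

/-- The class `𝒱` of divergence free fields in `C₀^∞(O; ℝᵈ)`. -/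
structure IsTestField {d : ℕ} (O : Set (Ed d)) (φ : Ed d → Ed d) : Prop
    extends IsSmoothCompact O φ where
  div_free : ∀ x, divField φ x = 0

/-- The Poincaré inequality on `H₀¹(O; ℝᵈ)`, written on its dense subspace `C₀^∞(O; ℝᵈ)`. -/
def PoincareDomain {d : ℕ} (O : Set (Ed d)) : Prop :=
  ∃ lam : ℝ, 0 < lam ∧ ∀ φ : Ed d → Ed d, IsSmoothCompact O φ →
    lam * ∫ x in O, ‖φ x‖ ^ 2 ≤ ∫ x in O, ‖gradField φ x‖ ^ 2

/-- `Lᵖ(O; ℝᵈ)`. -/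
abbrev LpField {d : ℕ} (O : Set (Ed d)) (p : ℝ≥0∞) := Lp (Ed d) p (volume.restrict O)

/-- `L²(O; ℝ^{d × d})`, where the gradients live. -/
abbrev L2Grad {d : ℕ} (O : Set (Ed d)) := Lp (GradVal d) 2 (volume.restrict O)

/-- `L̃ᵖ`: the closure of `𝒱` in `Lᵖ(O; ℝᵈ)`. -/
def Ltilde {d : ℕ} (O : Set (Ed d)) (p : ℝ≥0∞) [Fact (1 ≤ p)] : Submodule ℝ (LpField O p) :=
  (Submodule.span ℝ {u : LpField O p | ∃ φ : Ed d → Ed d, IsTestField O φ ∧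
    u =ᵐ[volume.restrict O] φ}).topologicalClosure

/-- `ℍ`: the closure of `𝒱` in `L²(O; ℝᵈ)`. -/
abbrev HSpace {d : ℕ} (O : Set (Ed d)) : Submodule ℝ (LpField O 2) := Ltilde O 2

/-- `𝕍`: the closure of `𝒱` in `H₀¹(O; ℝᵈ)`. An element is stored as the pair `(u, ∇u)`; the norm
inherited from the product is equivalent to `‖∇u‖` on a Poincaré domain. -/
def VSpace {d : ℕ} (O : Set (Ed d)) : Submodule ℝ (LpField O 2 × L2Grad O) :=
  (Submodule.span ℝ {w : LpField O 2 × L2Grad O | ∃ φ : Ed d → Ed d, IsTestField O φ ∧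
    w.1 =ᵐ[volume.restrict O] φ ∧ w.2 =ᵐ[volume.restrict O] gradField φ}).topologicalClosure

/-- The underlying field of an element of `𝕍`. -/
def vField {d : ℕ} {O : Set (Ed d)} (u : VSpace O) : LpField O 2 := u.1.1

/-- The (weak) gradient of an element of `𝕍`. -/
def vGrad {d : ℕ} {O : Set (Ed d)} (u : VSpace O) : L2Grad O := u.1.2

/-- The exponent `r + 1` (for `r ≥ 0`), as an extended nonnegative number. -/
def dampExp (r : ℝ) : ℝ≥0∞ := 1 + ENNReal.ofReal r

instance (r : ℝ) : Fact (1 ≤ dampExp r) := ⟨le_self_add⟩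

/-- The integrability exponent of the noise: `4` if `r < 3`, and `r + 1` if `r ≥ 3`. -/
def noiseExp (r : ℝ) : ℝ≥0∞ := if r < 3 then 4 else dampExp r

instance (r : ℝ) : Fact (1 ≤ noiseExp r) := ⟨by
  unfold noiseExp
  split_ifs
  · norm_num
  · exact le_self_add⟩

/-- The space `𝕍 ∩ L̃^{r+1}`: pairs of an element of `𝕍` and an element of `L̃^{r+1}` which are the
same field. The product norm `max(‖·‖, ‖·‖)` is equivalent to the sum of the two norms. -/
def WSpace {d : ℕ} (O : Set (Ed d)) (r : ℝ) :
    Submodule ℝ ((LpField O 2 × L2Grad O) × LpField O (dampExp r)) where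
  carrier := {w | w.1 ∈ VSpace O ∧ w.2 ∈ Ltilde O (dampExp r) ∧
    (w.1.1 : Ed d → Ed d) =ᵐ[volume.restrict O] (w.2 : Ed d → Ed d)}
  zero_mem' := ⟨zero_mem _, zero_mem _,
    (Lp.coeFn_zero (Ed d) 2 _).trans (Lp.coeFn_zero (Ed d) (dampExp r) _).symm⟩
  add_mem' := by
    rintro a b ⟨ha₁, ha₂, ha⟩ ⟨hb₁, hb₂, hb⟩
    exact ⟨add_mem ha₁ hb₁, add_mem ha₂ hb₂, (Lp.coeFn_add a.1.1 b.1.1).trans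
      ((ha.add hb).trans (Lp.coeFn_add a.2 b.2).symm)⟩
  smul_mem' := by
    rintro c a ⟨ha₁, ha₂, ha⟩
    exact ⟨Submodule.smul_mem _ c ha₁, Submodule.smul_mem _ c ha₂,
      (Lp.coeFn_smul c a.1.1).trans ((ha.const_smul c).trans (Lp.coeFn_smul c a.2).symm)⟩

/-- The inclusion `𝕍 ∩ L̃^{r+1} → 𝕍`. -/
def wToV {d : ℕ} {O : Set (Ed d)} {r : ℝ} (w : WSpace O r) : VSpace O := ⟨w.1.1, w.2.1⟩

/-- The space `X = ℍ ∩ L̃ᵖ` with the norm `‖u‖_{L²} + ‖u‖_{Lᵖ}`. -/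
def XSpace {d : ℕ} (O : Set (Ed d)) (p : ℝ≥0∞) [Fact (1 ≤ p)] :
    Submodule ℝ (WithLp 1 (LpField O 2 × LpField O p)) where
  carrier := {w | w.fst ∈ HSpace O ∧ w.snd ∈ Ltilde O p ∧
    (w.fst : Ed d → Ed d) =ᵐ[volume.restrict O] (w.snd : Ed d → Ed d)}
  zero_mem' := ⟨zero_mem (HSpace O), zero_mem (Ltilde O p),
    (Lp.coeFn_zero (Ed d) 2 _).trans (Lp.coeFn_zero (Ed d) p _).symm⟩
  add_mem' := by
    rintro a b ⟨ha₁, ha₂, ha⟩ ⟨hb₁, hb₂, hb⟩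
    exact ⟨add_mem ha₁ hb₁, add_mem ha₂ hb₂, (Lp.coeFn_add a.fst b.fst).trans
      ((ha.add hb).trans (Lp.coeFn_add a.snd b.snd).symm)⟩
  smul_mem' := by
    rintro c a ⟨ha₁, ha₂, ha⟩
    exact ⟨Submodule.smul_mem _ c ha₁, Submodule.smul_mem _ c ha₂,
      (Lp.coeFn_smul c a.fst).trans ((ha.const_smul c).trans (Lp.coeFn_smul c a.snd).symm)⟩

/-- The inclusion `X → ℍ`. -/
def xToH {d : ℕ} (O : Set (Ed d)) (p : ℝ≥0∞) [Fact (1 ≤ p)] : XSpace O p →ₗ[ℝ] HSpace O where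
  toFun x := ⟨x.1.fst, x.2.1⟩
  map_add' _ _ := rfl
  map_smul' _ _ := rfl

/-! ### The Stokes operator and its functional calculus -/

/-- `T = (μ A + χ I)⁻¹`, where `A` is the Stokes operator, given by `⟨A u, ψ⟩ = (∇u, ∇ψ)`:
for `h ∈ ℍ`, `T h` is in `𝕍` and `μ (∇ T h, ∇ψ) + χ (T h, ψ) = (h, ψ)` for all `ψ ∈ 𝕍`. -/
def IsInvStokes {d : ℕ} (O : Set (Ed d)) (μ χ : ℝ) (T : HSpace O →L[ℝ] HSpace O) : Prop :=
  ∀ h : HSpace O, ∃ u : VSpace O, vField u = (T h : LpField O 2) ∧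
    ∀ ψ : VSpace O, μ * inner ℝ (vGrad u) (vGrad ψ) + χ * inner ℝ (vField u) (vField ψ)
      = inner ℝ (h : LpField O 2) (vField ψ)

open Classical in
/-- The operator `(μ A + χ I)⁻¹` on `ℍ`. -/
def invStokes {d : ℕ} (O : Set (Ed d)) (μ χ : ℝ) : HSpace O →L[ℝ] HSpace O :=
  if h : ∃ T, IsInvStokes O μ χ T then h.choose else 0

/-- `S = f(T)` for a bounded nonnegative self-adjoint operator `T` and a function `f` continuous on
`[0, ‖T‖]`: polynomials `p` uniformly close to `f` on `[0, ‖T‖]` give `p(T)` close to `S`. -/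
def IsFunctionOf {H : Type*} [NormedAddCommGroup H] [InnerProductSpace ℝ H]
    (T : H →L[ℝ] H) (f : ℝ → ℝ) (S : H →L[ℝ] H) : Prop :=
  ∀ ε : ℝ, 0 < ε → ∃ p : Polynomial ℝ,
    (∀ x ∈ Icc (0 : ℝ) ‖T‖, |p.eval x - f x| ≤ ε) ∧ ‖Polynomial.aeval T p - S‖ ≤ ε

open Classical in
/-- The continuous functional calculus `f(T)` of a bounded nonnegative self-adjoint operator on a
real Hilbert space. -/
def functionOf {H : Type*} [NormedAddCommGroup H] [InnerProductSpace ℝ H]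
    (T : H →L[ℝ] H) (f : ℝ → ℝ) : H →L[ℝ] H :=
  if h : ∃ S, IsFunctionOf T f S then h.choose else 0

/-- The fractional power `(μ A + χ I)^{-δ}`, that is `T^δ` for `T = (μ A + χ I)⁻¹`. -/
def negPow {d : ℕ} (O : Set (Ed d)) (μ χ δ : ℝ) : HSpace O →L[ℝ] HSpace O :=
  functionOf (invStokes O μ χ) (fun x => x ^ δ)

/-- The operator `(μ A + χ I)^{1+δ} e^{-s (μ A + χ I)}`, for `s > 0`: in terms of
`T = (μ A + χ I)⁻¹` it is `f(T)` with `f(x) = x^{-(1+δ)} e^{-s/x}` and `f(0) = 0`. -/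
def powExp {d : ℕ} (O : Set (Ed d)) (μ χ δ s : ℝ) : HSpace O →L[ℝ] HSpace O :=
  functionOf (invStokes O μ χ) (fun x => x ^ (-(1 + δ)) * Real.exp (-s / x))

/-! ### The noise space and the Ornstein-Uhlenbeck process -/

/-- The pairs `(x, A^{-δ} x)` with both entries in `X = ℍ ∩ L̃ᵖ`: the pairs `(x, y)` of elements
of `X` with `y - A^{-δ} x = 0` in `ℍ`. -/
def noiseGraph {d : ℕ} (O : Set (Ed d)) (p : ℝ≥0∞) [Fact (1 ≤ p)] (δ : ℝ) :
    Submodule ℝ (XSpace O p × XSpace O p) :=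
  LinearMap.ker (xToH O p ∘ₗ LinearMap.snd ℝ (XSpace O p) (XSpace O p)
    - (negPow O 1 0 δ).toLinearMap ∘ₗ xToH O p ∘ₗ LinearMap.fst ℝ (XSpace O p) (XSpace O p))

/-- The space of those `x ∈ X` with `A^{-δ} x ∈ X`, with the norm `x ↦ ‖A^{-δ} x‖_X`. On domains
with a uniformly `C³` boundary `A^{-δ}` maps `X` to itself, so that this is all of `X`. -/
def PreNoise {d : ℕ} (O : Set (Ed d)) (p : ℝ≥0∞) [Fact (1 ≤ p)] (δ : ℝ) : Type :=
  noiseGraph O p δ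

instance {d : ℕ} (O : Set (Ed d)) (p : ℝ≥0∞) [Fact (1 ≤ p)] (δ : ℝ) :
    AddCommGroup (PreNoise O p δ) :=
  inferInstanceAs (AddCommGroup (noiseGraph O p δ))

/-- The isometry `x ↦ A^{-δ} x` from `PreNoise` to `X`. -/
def preSmoothed {d : ℕ} (O : Set (Ed d)) (p : ℝ≥0∞) [Fact (1 ≤ p)] (δ : ℝ) :
    PreNoise O p δ →+ XSpace O p :=
  (AddMonoidHom.snd (XSpace O p) (XSpace O p)).comp (noiseGraph O p δ).subtype.toAddMonoidHom

/-- The element `x` of `ℍ` underlying an element of `PreNoise`. -/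
def preToH {d : ℕ} {O : Set (Ed d)} {p : ℝ≥0∞} [Fact (1 ≤ p)] {δ : ℝ}
    (z : PreNoise O p δ) : HSpace O :=
  xToH O p (z : noiseGraph O p δ).1.1

instance {d : ℕ} (O : Set (Ed d)) (p : ℝ≥0∞) [Fact (1 ≤ p)] (δ : ℝ) :
    SeminormedAddCommGroup (PreNoise O p δ) :=
  SeminormedAddCommGroup.induced _ _ (preSmoothed O p δ)

/-- The space `E`: the completion of `X` in the norm `‖A^{-δ} x‖_X`. -/
abbrev NoiseSpace {d : ℕ} (O : Set (Ed d)) (p : ℝ≥0∞) [Fact (1 ≤ p)] (δ : ℝ) : Type :=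
  UniformSpace.Completion (PreNoise O p δ)

/-- The operator `(μ A + χ I)^{-δ}`, extended by continuity from `X` to `E`. -/
def negPowE {d : ℕ} (O : Set (Ed d)) (p : ℝ≥0∞) [Fact (1 ≤ p)] (μ χ δ : ℝ) :
    NoiseSpace O p δ → HSpace O :=
  UniformSpace.Completion.extension (fun z : PreNoise O p δ => negPow O μ χ δ (preToH z))

/-- `ω ∈ C^ξ_{1/2}(ℝ, Y)`. -/
structure IsHolderPath {Y : Type*} [NormedAddCommGroup Y] (ξ : ℝ) (ω : ℝ → Y) : Prop where
  continuous : Continuous ω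
  zero : ω 0 = 0
  bound : ∃ C : ℝ, ∀ t s : ℝ,
    ‖ω t - ω s‖ ≤ C * (|t - s| ^ ξ * (1 + |t| + |s|) ^ (1 / 2 : ℝ))

/-- The Ornstein-Uhlenbeck path
`Υ_χ(ω)(t) = ∫_{-∞}^t (μA+χI)^{1+δ} e^{-(t-τ)(μA+χI)} [(μA+χI)^{-δ}ω(t) - (μA+χI)^{-δ}ω(τ)] dτ`. -/
def ouPath {d : ℕ} (O : Set (Ed d)) (p : ℝ≥0∞) [Fact (1 ≤ p)] (μ χ δ : ℝ)
    (ω : ℝ → NoiseSpace O p δ) (t : ℝ) : HSpace O :=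
  ∫ τ in Iic t, powExp O μ χ δ (t - τ) (negPowE O p μ χ δ (ω t) - negPowE O p μ χ δ (ω τ))

/-! ### The nonlinear operators and weak solutions -/

/-- `b(u, ψ, w) = ∑_{i,j} ∫_O u_i ∂_iψ_j w_j dx`, where `G = ∇ψ`. -/
def triForm {d : ℕ} (O : Set (Ed d)) (u : Ed d → Ed d) (G : Ed d → GradVal d)
    (w : Ed d → Ed d) : ℝ :=
  ∫ x in O, ∑ i : Fin d, ∑ j : Fin d, u x i * G x i j * w x j

/-- `⟨B(u), ψ⟩ = b(u, u, ψ) = - b(u, ψ, u)`; the last expression makes sense for all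
`u ∈ ℍ ∩ L̃⁴` and `ψ ∈ 𝕍`. -/
def convForm {d : ℕ} (O : Set (Ed d)) (u : HSpace O) (ψ : VSpace O) : ℝ :=
  -triForm O (u : LpField O 2) (vGrad ψ) (u : LpField O 2)

/-- The damping term `⟨C(u), ψ⟩ = ∫_O |u|^{r-1} u · ψ dx`. -/
def dampForm {d : ℕ} (O : Set (Ed d)) (r : ℝ) (u : HSpace O) (ψ : LpField O 2) : ℝ :=
  ∫ x in O, ‖(u : LpField O 2) x‖ ^ (r - 1) * inner ℝ ((u : LpField O 2) x) (ψ x)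

/-- `g ∈ L^q_loc([0, ∞); Y)`. -/
def MemLocLp {Y : Type*} [NormedAddCommGroup Y] (q : ℝ≥0∞) (g : ℝ → Y) : Prop :=
  ∀ T : ℝ, 0 < T → MemLp g q (volume.restrict (Icc 0 T))

/-- `u ∈ L²_loc([0, ∞); 𝕍)`, witnessed by the `𝕍`-valued function `uV`. -/
def InL2V {d : ℕ} {O : Set (Ed d)} (u : ℝ → HSpace O) (uV : ℝ → VSpace O) : Prop :=
  MemLocLp 2 uV ∧ ∀ᵐ t ∂volume.restrict (Ici (0 : ℝ)), vField (uV t) = (u t : LpField O 2)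

/-- `u ∈ L^p_loc([0, ∞); L̃^p)`. -/
def InLpLtilde {d : ℕ} {O : Set (Ed d)} (p : ℝ≥0∞) [Fact (1 ≤ p)] (u : ℝ → HSpace O) : Prop :=
  ∃ uL : ℝ → Ltilde O p, MemLocLp p uL ∧ ∀ᵐ t ∂volume.restrict (Ici (0 : ℝ)),
    ((uL t : LpField O p) : Ed d → Ed d) =ᵐ[volume.restrict O] ((u t : LpField O 2) : Ed d → Ed d)

/-- The class of driving paths `Υ` for which the transformed system is posed:
`L²_loc([0,∞); ℍ) ∩ L⁴_loc([0,∞); L̃⁴)` if `r < 3`, and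
`L²_loc([0,∞); ℍ) ∩ L^{r+1}_loc([0,∞); L̃^{r+1})` if `r ≥ 3`. -/
def IsDrivingPath {d : ℕ} {O : Set (Ed d)} (r : ℝ) (Υ : ℝ → HSpace O) : Prop :=
  MemLocLp 2 Υ ∧ InLpLtilde (noiseExp r) Υ

/-- `g` is the weak time derivative of the continuous function `v : [0, ∞) → ℍ`, as a function
with values in the dual `𝕍' + L̃^{(r+1)/r}` of `𝕍 ∩ L̃^{r+1}`. -/
def IsTimeDeriv {d : ℕ} {O : Set (Ed d)} {r : ℝ} (v : ℝ → HSpace O)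
    (g : ℝ → StrongDual ℝ (WSpace O r)) : Prop :=
  ∀ ψ : WSpace O r, ∀ t : ℝ, 0 ≤ t →
    inner ℝ (v t : LpField O 2) (vField (wToV ψ))
      = inner ℝ (v 0 : LpField O 2) (vField (wToV ψ)) + ∫ s in (0 : ℝ)..t, g s ψ

/-- `v` is a weak solution on `[0, ∞)` of the transformed system
`dv/dt = -μ A v - B(v + Υ) - α v - β C(v + Υ) + (χ - α) Υ + f`, `v(0) = x - Υ(0)`. -/
def IsWeakSolution {d : ℕ} (O : Set (Ed d)) (μ α β r χ : ℝ) (f : StrongDual ℝ (VSpace O))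
    (x : HSpace O) (Υ v : ℝ → HSpace O) : Prop :=
  IsDrivingPath r Υ ∧
  ContinuousOn v (Ici 0) ∧
  InLpLtilde (dampExp r) v ∧
  ∃ (vV : ℝ → VSpace O) (g : ℝ → StrongDual ℝ (WSpace O r)),
    InL2V v vV ∧
    MemLocLp (ENNReal.ofReal ((r + 1) / r)) g ∧
    IsTimeDeriv v g ∧
    -- the equation
    (∀ ψ : WSpace O r, ∀ᵐ t ∂volume.restrict (Ici (0 : ℝ)),
      g t ψ = -μ * inner ℝ (vGrad (vV t)) (vGrad (wToV ψ))
        - α * inner ℝ (v t : LpField O 2) (vField (wToV ψ))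
        - convForm O (v t + Υ t) (wToV ψ)
        - β * dampForm O r (v t + Υ t) (vField (wToV ψ))
        + (χ - α) * inner ℝ (Υ t : LpField O 2) (vField (wToV ψ))
        + f (wToV ψ)) ∧
    -- the initial condition
    v 0 = x - Υ 0 ∧
    -- the energy equality
    (∀ t : ℝ, 0 ≤ t →
      ‖v t‖ ^ 2 + 2 * μ * (∫ s in (0 : ℝ)..t, ‖vGrad (vV s)‖ ^ 2)
          + 2 * α * (∫ s in (0 : ℝ)..t, ‖v s‖ ^ 2)
        = ‖x - Υ 0‖ ^ 2 - 2 * (∫ s in (0 : ℝ)..t, convForm O (v s + Υ s) (vV s))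
          - 2 * β * (∫ s in (0 : ℝ)..t, dampForm O r (v s + Υ s) (v s : LpField O 2))
          + 2 * (∫ s in (0 : ℝ)..t, f (vV s))
          + 2 * (χ - α) * (∫ s in (0 : ℝ)..t, inner ℝ (Υ s) (v s)))

/-- `u = φ_χ(·, ω, x)` on `[0, ∞)`: `u(t) = v^χ(t) + Υ_χ(ω)(t)`, where `v^χ` is a weak solution of
the system driven by the Ornstein-Uhlenbeck path `Υ_χ(ω)`, with `v^χ(0) = x - Υ_χ(ω)(0)`. -/
def IsPhiTrajectory {d : ℕ} (O : Set (Ed d)) (μ α β r δ χ : ℝ) (f : StrongDual ℝ (VSpace O))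
    (ω : ℝ → NoiseSpace O (noiseExp r) δ) (x : HSpace O) (u : ℝ → HSpace O) : Prop :=
  ∃ v : ℝ → HSpace O,
    IsWeakSolution O μ α β r χ f x (ouPath O (noiseExp r) μ χ δ ω) v ∧
    ∀ t : ℝ, 0 ≤ t → u t = v t + ouPath O (noiseExp r) μ χ δ ω t

end

end SCBF

/-! Write `u = v + Υ_χ`. Formally `Υ_χ` solves `dΥ + (μA + χ)Υ dt = dω`, so the shift `χ` enters the
equation of `v` only to compensate the drift of `Υ_χ`, and the equation for `u` contains no `χ`. The
proof makes this rigorous on the level of `v`. The function `D = Υ_{χ₁} - Υ_{χ₂}` takes values in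
the domain of `A` and satisfies `D' = χ₂Υ_{χ₂} - χ₁Υ_{χ₁} - μAD`, with no noise left. Hence `v^{χ₁}
+ D` solves the system for `(χ₂, Υ_{χ₂})` with initial value `x - Υ_{χ₂}(0)`. This gives the second
claim, and the first follows from uniqueness of weak solutions.

The linear part is written in terms of the bounded injective operator `K = A⁻¹` on `ℍ`. All of `(μA
+ χ)^{-δ}`, `e^{-s(μA + χ)}` and the kernels of the paths are functions of this single `K`, and the
noise enters only through `η = A^{-δ}ω`, which is a Hölder path in `ℍ`. With the convolution `y(t) =
∫ e^{-(t-τ)(μA+χ)} η(τ) dτ` one has `A^{-δ}Υ = η - (μA+χ)y = y'`. Eliminating `y` gives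
`ouConv_equation`, whose right-hand side does not depend on `χ`; subtraction and injectivity give
`exists_ouConv_sub`. The operator calculus rests on `norm_aeval_le`, the bound of a polynomial of a
symmetric nonnegative operator by its supremum on `[0, ‖T‖]`.

The nonlinear part is an energy method. `energy_identity` treats `w' = N` with `N` in `L²(V') +
L^{q'}(L')` and `w` in the dual class. It shows that the energy equality follows from the equation
(`IsPreSolution.energy`), so that it survives the change of `χ`, and it applies to the difference of
two solutions. There `b(u₁, w, w) = 0`, the remaining term `b(w, w, u₂)` is absorbed by viscosity
and Ladyzhenskaya's inequality if `d = 2`, and by viscosity and damping if `r > 3` or `r = 3` and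
`2βμ ≥ 1` (`exists_integral_triVal_le`). Gronwall's inequality concludes in
`IsPreSolution.eq_of_eq_zero`, and `IsPreSolution.shift` carries out the change of driving path. -/

namespace SCBF

/-! ### Functional calculus of a bounded nonnegative symmetric operator. -/

section FunctionalCalculus

variable {H : Type*} [NormedAddCommGroup H] [InnerProductSpace ℝ H]

/-- A bounded operator which is symmetric and nonnegative. -/
structure IsNonnegOp (T : H →L[ℝ] H) : Prop where
  symm : ∀ x y, inner ℝ (T x) y = inner ℝ x (T y)
  nonneg : ∀ x, 0 ≤ inner ℝ (T x) x

/-- An operator which is bounded below. -/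
def IsBoundedBelow (T : H →L[ℝ] H) : Prop := ∃ c : ℝ, 0 < c ∧ ∀ x, c * ‖x‖ ≤ ‖T x‖

theorem IsBoundedBelow.mul {S T : H →L[ℝ] H} (hS : IsBoundedBelow S) (hT : IsBoundedBelow T) :
    IsBoundedBelow (S * T) := by
  obtain ⟨c, hc, h⟩ := hS
  obtain ⟨k, hk, h'⟩ := hT
  refine ⟨c * k, by positivity, fun x => ?_⟩
  calc c * k * ‖x‖ = c * (k * ‖x‖) := by ring
    _ ≤ c * ‖T x‖ := by gcongr; exact h' x
    _ ≤ ‖S (T x)‖ := h _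

theorem isBoundedBelow_of_inner {T : H →L[ℝ] H} {c : ℝ} (hc : 0 < c)
    (h : ∀ x, c * ‖x‖ ^ 2 ≤ inner ℝ (T x) x) : IsBoundedBelow T := by
  refine ⟨c, hc, fun x => ?_⟩
  rcases eq_or_ne x 0 with rfl | hx
  · simp
  have hx' : 0 < ‖x‖ := norm_pos_iff.2 hx
  have := (h x).trans (real_inner_le_norm (T x) x)
  nlinarith

/-- Induction on the degree, splitting off real linear factors and quadratic factors with a pair of
complex roots. For a linear factor `X - a` the root lies outside `[0, ‖T‖]`: nonnegativity of `T`
handles `a < 0`, and `‖T x‖ ≤ ‖T‖ ‖x‖` handles `a > ‖T‖`. This takes the place of invertibility off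
the spectrum, without complexifying or assuming completeness. -/
theorem isBoundedBelow_aeval {T : H →L[ℝ] H} (hT : IsNonnegOp T) (n : ℕ) :
    ∀ p : Polynomial ℝ, p.natDegree ≤ n → (∀ x ∈ Icc (0 : ℝ) ‖T‖, p.eval x ≠ 0) →
      IsBoundedBelow (Polynomial.aeval T p) := by
  have hconst : ∀ p : Polynomial ℝ, p.natDegree = 0 → (∀ x ∈ Icc (0 : ℝ) ‖T‖, p.eval x ≠ 0) →
      IsBoundedBelow (Polynomial.aeval T p) := by
    intro p hp h0
    rw [Polynomial.eq_C_of_natDegree_eq_zero hp] at h0 ⊢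
    have h1 := h0 0 ⟨le_rfl, norm_nonneg _⟩
    rw [Polynomial.eval_C] at h1
    refine ⟨|p.coeff 0|, abs_pos.2 h1, fun x => le_of_eq ?_⟩
    rw [Polynomial.aeval_C, Algebra.algebraMap_eq_smul_one]
    simp [norm_smul]
  induction n with
  | zero => exact fun p hp h0 => hconst p (by omega) h0
  | succ n ih =>
    intro p hp h0
    by_cases hd : p.natDegree = 0
    · exact hconst p hd h0
    have hp0 : p ≠ 0 := by rintro rfl; simp at hd
    have hdeg : p.degree ≠ 0 := fun h => hd (Polynomial.natDegree_eq_of_degree_eq_some h)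
    obtain ⟨z, hz⟩ := IsAlgClosed.exists_aeval_eq_zero ℂ p hdeg
    by_cases him : z.im = 0
    · have hz' : z = ((z.re : ℝ) : ℂ) := by
        exact Complex.ext rfl (by rw [him]; rfl)
      have hroot : p.eval z.re = 0 := by
        rw [hz'] at hz
        have h2 : Polynomial.aeval ((z.re : ℝ) : ℂ) p = ((p.eval z.re : ℝ) : ℂ) :=
          Polynomial.aeval_algebraMap_apply_eq_algebraMap_eval z.re p
        rw [h2] at hz
        exact_mod_cast hz
      obtain ⟨q, hq⟩ := Polynomial.dvd_iff_isRoot.2 hroot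
      have hq0 : q ≠ 0 := by rintro rfl; simp at hq; exact hp0 hq
      have hqd : q.natDegree ≤ n := by
        rw [hq, Polynomial.natDegree_mul (Polynomial.X_sub_C_ne_zero _) hq0,
          Polynomial.natDegree_X_sub_C] at hp
        omega
      rw [hq, map_mul]
      refine IsBoundedBelow.mul ?_ (ih q hqd fun x hx h => h0 x hx (by rw [hq]; simp [h]))
      have ha : z.re ∉ Icc (0 : ℝ) ‖T‖ := fun h => h0 _ h hroot
      generalize z.re = a at ha
      rw [mem_Icc, not_and_or, not_le, not_le] at ha
      have hval : ∀ x, Polynomial.aeval T (Polynomial.X - Polynomial.C a) x = T x - a • x := by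
        intro x; simp [Algebra.algebraMap_eq_smul_one]
      rcases ha with ha | ha
      · refine isBoundedBelow_of_inner (neg_pos.2 ha) fun x => ?_
        rw [hval, inner_sub_left, real_inner_smul_left, real_inner_self_eq_norm_sq]
        have := hT.nonneg x
        linarith
      · refine ⟨a - ‖T‖, sub_pos.2 ha, fun x => ?_⟩
        rw [hval]
        have h1 := norm_sub_norm_le (a • x) (T x)
        have h2 := T.le_opNorm x
        rw [norm_smul, Real.norm_eq_abs, norm_sub_rev] at h1
        have h3 : a ≤ |a| := le_abs_self a
        have h4 := norm_nonneg x
        nlinarith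
    · obtain ⟨q, hq⟩ := p.quadratic_dvd_of_aeval_eq_zero_im_ne_zero hz him
      set Q : Polynomial ℝ := Polynomial.X ^ 2 - Polynomial.C (2 * z.re) * Polynomial.X +
        Polynomial.C (‖z‖ ^ 2) with hQ
      have hQd : Q.natDegree = 2 := by rw [hQ]; compute_degree!
      have hQ0 : Q ≠ 0 := by rintro h; rw [h] at hQd; simp at hQd
      have hq0 : q ≠ 0 := by rintro rfl; simp at hq; exact hp0 hq
      have hqd : q.natDegree ≤ n := by
        rw [hq, Polynomial.natDegree_mul hQ0 hq0, hQd] at hp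
        omega
      rw [hq, map_mul]
      refine IsBoundedBelow.mul ?_ (ih q hqd fun x hx h => h0 x hx (by rw [hq]; simp [h]))
      -- The quadratic factor is `(T - re z)² + (im z)²`, and the square of a symmetric operator is
      -- nonnegative.
      refine isBoundedBelow_of_inner (c := z.im ^ 2) (by positivity) fun x => ?_
      have hval : Polynomial.aeval T Q x = T (T x) - (2 * z.re) • T x + (‖z‖ ^ 2) • x := by
        rw [hQ]
        simp only [map_add, map_sub, map_mul, Polynomial.aeval_X, Polynomial.aeval_C,
          Algebra.algebraMap_eq_smul_one, pow_two, smul_mul_assoc, one_mul, mul_smul]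
        rfl
      have hz2 : ‖z‖ ^ 2 = z.re ^ 2 + z.im ^ 2 := by
        rw [Complex.sq_norm, Complex.normSq_apply]; ring
      rw [hval, inner_add_left, inner_sub_left, real_inner_smul_left, real_inner_smul_left,
        hT.symm, real_inner_self_eq_norm_sq, real_inner_self_eq_norm_sq, hz2]
      have h1 := norm_sub_sq_real (T x) (z.re • x)
      rw [norm_smul, real_inner_smul_right, Real.norm_eq_abs, mul_pow, sq_abs] at h1
      nlinarith [sq_nonneg ‖T x - z.re • x‖]

theorem aeval_symm {T : H →L[ℝ] H} (hT : IsNonnegOp T) (p : Polynomial ℝ) (x y : H) :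
    inner ℝ (Polynomial.aeval T p x) y = inner ℝ x (Polynomial.aeval T p y) := by
  induction p using Polynomial.induction_on' with
  | add p q hp hq => simp only [map_add, _root_.add_apply, inner_add_left,
      inner_add_right, hp, hq]
  | monomial n a =>
    have hpow : ∀ n : ℕ, ∀ x y, inner ℝ ((T ^ n) x) y = inner ℝ x ((T ^ n) y) := by
      intro n
      induction n with
      | zero => intro x y; simp
      | succ n ih =>
        intro x y
        rw [pow_succ]
        change inner ℝ ((T ^ n) (T x)) y = inner ℝ x ((T ^ n) (T y))
        rw [ih, hT.symm]
        have : T ((T ^ n) y) = (T ^ n) (T y) := by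
          have := (Commute.self_pow T n).eq
          exact congrArg (fun S : H →L[ℝ] H => S y) this
        rw [this]
    simp only [Polynomial.aeval_monomial, Algebra.algebraMap_eq_smul_one, smul_mul_assoc, one_mul,
      _root_.smul_apply, real_inner_smul_left, real_inner_smul_right, hpow]

/-- If `S = p(T)` had norm greater than `ε`, then `‖S‖² - p²` would have no zero on `[0, ‖T‖]`, so
`‖S‖² - S²` would be bounded below by some `k > 0`. Expanding the square of its norm for symmetric
`S` gives `‖S x‖² ≤ (‖S‖² - k²/‖S‖²) ‖x‖²`, which contradicts the definition of `‖S‖`. -/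
theorem norm_aeval_le {T : H →L[ℝ] H} (hT : IsNonnegOp T) (p : Polynomial ℝ) {ε : ℝ}
    (h : ∀ x ∈ Icc (0 : ℝ) ‖T‖, |p.eval x| ≤ ε) : ‖Polynomial.aeval T p‖ ≤ ε := by
  by_contra! hlt
  have hε : 0 ≤ ε := (abs_nonneg _).trans (h 0 ⟨le_rfl, norm_nonneg _⟩)
  set S := Polynomial.aeval T p with hS
  have hc : 0 < ‖S‖ := hε.trans_lt hlt
  obtain ⟨k, hk, hb⟩ := isBoundedBelow_aeval hT _ (Polynomial.C (‖S‖ ^ 2) - p ^ 2) le_rfl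
    (fun x hx h0 => by
      have h1 := h x hx
      simp only [Polynomial.eval_sub, Polynomial.eval_C, Polynomial.eval_pow] at h0
      have h2 : (p.eval x) ^ 2 ≤ ε ^ 2 := sq_le_sq' (by linarith [(abs_le.1 h1).1]) (abs_le.1 h1).2
      nlinarith)
  have key : ∀ x, ‖S x‖ ^ 2 ≤ (‖S‖ ^ 2 - k ^ 2 / ‖S‖ ^ 2) * ‖x‖ ^ 2 := by
    intro x
    have h1 := hb x
    have hval : Polynomial.aeval T (Polynomial.C (‖S‖ ^ 2) - p ^ 2) x
        = (‖S‖ ^ 2) • x - S (S x) := by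
      rw [_root_.map_sub, _root_.map_pow _ p, ← hS, Polynomial.aeval_C,
        Algebra.algebraMap_eq_smul_one, pow_two S]
      rfl
    rw [hval] at h1
    have h2 := norm_sub_sq_real ((‖S‖ ^ 2) • x) (S (S x))
    rw [norm_smul, real_inner_smul_left, ← aeval_symm hT, ← hS,
      real_inner_self_eq_norm_sq, norm_pow, norm_norm] at h2
    have h3 := S.le_opNorm (S x)
    have h4 : ‖S (S x)‖ ^ 2 ≤ ‖S‖ ^ 2 * ‖S x‖ ^ 2 := by rw [← mul_pow]; gcongr
    have h5 : k ^ 2 * ‖x‖ ^ 2 ≤ ‖‖S‖ ^ 2 • x - S (S x)‖ ^ 2 := by rw [← mul_pow]; gcongr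
    have h6 : k ^ 2 * ‖x‖ ^ 2 ≤ ‖S‖ ^ 2 * (‖S‖ ^ 2 * ‖x‖ ^ 2 - ‖S x‖ ^ 2) := by nlinarith
    have h7 : k ^ 2 * ‖x‖ ^ 2 / ‖S‖ ^ 2 ≤ ‖S‖ ^ 2 * ‖x‖ ^ 2 - ‖S x‖ ^ 2 := by
      rw [div_le_iff₀ (by positivity)]; linarith
    rw [sub_mul, div_mul_eq_mul_div]; linarith
  have h8 : ‖S‖ ≤ Real.sqrt (max (‖S‖ ^ 2 - k ^ 2 / ‖S‖ ^ 2) 0) := by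
    refine S.opNorm_le_bound (Real.sqrt_nonneg _) fun x => ?_
    rw [← abs_of_nonneg (norm_nonneg (S x)), ← abs_of_nonneg (norm_nonneg x), ← Real.sqrt_sq_eq_abs,
      ← Real.sqrt_sq_eq_abs, ← Real.sqrt_mul (le_max_right _ _)]
    refine Real.sqrt_le_sqrt ((key x).trans ?_)
    gcongr
    exact le_max_left _ _
  have h9 : ‖S‖ ^ 2 ≤ max (‖S‖ ^ 2 - k ^ 2 / ‖S‖ ^ 2) 0 := by
    have := (Real.le_sqrt' hc).1 h8
    exact this
  have h10 : 0 < k ^ 2 / ‖S‖ ^ 2 := by positivity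
  rcases le_max_iff.1 h9 with h | h
  · linarith
  · have : 0 < ‖S‖ ^ 2 := by positivity
    linarith

theorem IsFunctionOf.norm_le {T S : H →L[ℝ] H} (hT : IsNonnegOp T) {f : ℝ → ℝ}
    (hS : IsFunctionOf T f S) {c : ℝ} (hf : ∀ x ∈ Icc (0 : ℝ) ‖T‖, |f x| ≤ c) : ‖S‖ ≤ c := by
  refine le_of_forall_pos_le_add fun ε hε => ?_
  obtain ⟨p, hp, hpS⟩ := hS (ε / 2) (by positivity)
  have h1 : ‖Polynomial.aeval T p‖ ≤ c + ε / 2 := norm_aeval_le hT p fun x hx => by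
    have := abs_sub_abs_le_abs_sub (p.eval x) (f x)
    linarith [hp x hx, hf x hx]
  have h2 := norm_sub_norm_le S (Polynomial.aeval T p)
  rw [norm_sub_rev] at h2
  linarith

theorem IsFunctionOf.congr {T S : H →L[ℝ] H} {f g : ℝ → ℝ}
    (hS : IsFunctionOf T f S) (hfg : ∀ x ∈ Icc (0 : ℝ) ‖T‖, f x = g x) : IsFunctionOf T g S := by
  intro ε hε
  obtain ⟨p, hp, h⟩ := hS ε hε
  exact ⟨p, fun x hx => by rw [← hfg x hx]; exact hp x hx, h⟩

theorem IsFunctionOf.add {T S R : H →L[ℝ] H} {f g : ℝ → ℝ} (hS : IsFunctionOf T f S)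
    (hR : IsFunctionOf T g R) : IsFunctionOf T (fun x => f x + g x) (S + R) := by
  intro ε hε
  obtain ⟨p, hp, h⟩ := hS (ε / 2) (by positivity)
  obtain ⟨q, hq, h'⟩ := hR (ε / 2) (by positivity)
  refine ⟨p + q, fun x hx => ?_, ?_⟩
  · rw [Polynomial.eval_add, add_sub_add_comm]
    refine (abs_add_le _ _).trans ?_
    linarith [hp x hx, hq x hx]
  · rw [map_add, add_sub_add_comm]
    refine (norm_add_le _ _).trans ?_
    linarith

theorem isFunctionOf_aeval (T : H →L[ℝ] H) (p : Polynomial ℝ) :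
    IsFunctionOf T (fun x => p.eval x) (Polynomial.aeval T p) := by
  intro ε hε
  exact ⟨p, fun x _ => by simpa using hε.le, by simpa using hε.le⟩

theorem isFunctionOf_const (T : H →L[ℝ] H) (c : ℝ) :
    IsFunctionOf T (fun _ => c) (c • (1 : H →L[ℝ] H)) := by
  simpa [Algebra.algebraMap_eq_smul_one] using isFunctionOf_aeval T (Polynomial.C c)

theorem isFunctionOf_id (T : H →L[ℝ] H) : IsFunctionOf T (fun x => x) T := by
  simpa using isFunctionOf_aeval T Polynomial.X

theorem IsFunctionOf.mul {T S R : H →L[ℝ] H} (hT : IsNonnegOp T) {f g : ℝ → ℝ}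
    (hS : IsFunctionOf T f S) (hR : IsFunctionOf T g R) {A B : ℝ}
    (hf : ∀ x ∈ Icc (0 : ℝ) ‖T‖, |f x| ≤ A) (hg : ∀ x ∈ Icc (0 : ℝ) ‖T‖, |g x| ≤ B) :
    IsFunctionOf T (fun x => f x * g x) (S * R) := by
  intro ε hε
  have hA : 0 ≤ A := (abs_nonneg _).trans (hf 0 ⟨le_rfl, norm_nonneg _⟩)
  have hB : 0 ≤ B := (abs_nonneg _).trans (hg 0 ⟨le_rfl, norm_nonneg _⟩)
  -- The part `ε' ≤ 1` keeps the approximating polynomial of `f` below `A + 1`; the other part makes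
  -- the total error `(A + 1) ε' + ε' B` at most `ε`.
  set ε' : ℝ := min 1 (ε / (A + B + 1)) with hε'
  have h0 : 0 < ε' := by positivity
  have h1 : ε' ≤ 1 := min_le_left _ _
  have h2 : (A + 1) * ε' + ε' * B ≤ ε := by
    have : ε' ≤ ε / (A + B + 1) := min_le_right _ _
    rw [le_div_iff₀ (by positivity)] at this
    linarith
  obtain ⟨p, hp, h⟩ := hS ε' h0
  obtain ⟨q, hq, h'⟩ := hR ε' h0
  have hpb : ∀ x ∈ Icc (0 : ℝ) ‖T‖, |p.eval x| ≤ A + 1 := fun x hx => by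
    have := abs_sub_abs_le_abs_sub (p.eval x) (f x)
    linarith [hp x hx, hf x hx]
  refine ⟨p * q, fun x hx => ?_, ?_⟩
  · have e : (p * q).eval x - f x * g x
        = p.eval x * (q.eval x - g x) + (p.eval x - f x) * g x := by
      rw [Polynomial.eval_mul]; ring
    rw [e]
    refine (abs_add_le _ _).trans (le_trans ?_ h2)
    rw [abs_mul, abs_mul]
    gcongr
    exacts [hpb x hx, hq x hx, hp x hx, hg x hx]
  · have e : Polynomial.aeval T (p * q) - S * R = Polynomial.aeval T p * (Polynomial.aeval T q - R)
        + (Polynomial.aeval T p - S) * R := by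
      rw [map_mul]; noncomm_ring
    rw [e]
    refine (norm_add_le _ _).trans (le_trans ?_ h2)
    refine add_le_add ((norm_mul_le _ _).trans ?_) ((norm_mul_le _ _).trans ?_)
    · gcongr; exact norm_aeval_le hT p hpb
    · gcongr; exact hR.norm_le hT hg

/-- The difference of two candidates represents the zero function and so has norm at most `0`. Hence
the choice made in `functionOf` is harmless. -/
theorem IsFunctionOf.unique {T S R : H →L[ℝ] H} (hT : IsNonnegOp T) {f : ℝ → ℝ}
    (hS : IsFunctionOf T f S) (hR : IsFunctionOf T f R) : S = R := by
  have h0 : IsFunctionOf T (fun x => f x + -f x) (S + (-R)) := by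
    refine hS.add fun ε hε => ?_
    obtain ⟨p, hp, h⟩ := hR ε hε
    refine ⟨-p, fun x hx => ?_, ?_⟩
    · rw [Polynomial.eval_neg, ← abs_neg]
      simpa [add_comm, sub_eq_add_neg] using hp x hx
    · rw [map_neg, ← norm_neg]
      simpa [add_comm, sub_eq_add_neg] using h
  have := h0.norm_le hT (c := 0) (fun x _ => by simp)
  rw [norm_le_zero_iff] at this
  rwa [← sub_eq_add_neg, sub_eq_zero] at this

theorem functionOf_eq {T S : H →L[ℝ] H} (hT : IsNonnegOp T) {f : ℝ → ℝ}
    (hS : IsFunctionOf T f S) : functionOf T f = S := by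
  have h : ∃ S, IsFunctionOf T f S := ⟨S, hS⟩
  rw [functionOf, dif_pos h]
  exact h.choose_spec.unique hT hS

/-- Weierstrass approximants of `f` give a Cauchy sequence of operators, by `norm_aeval_le`. -/
theorem exists_isFunctionOf [CompleteSpace H] {T : H →L[ℝ] H} (hT : IsNonnegOp T) {f : ℝ → ℝ}
    (hf : ContinuousOn f (Icc 0 ‖T‖)) : ∃ S, IsFunctionOf T f S := by
  choose p hp using fun n : ℕ => exists_polynomial_near_of_continuousOn 0 ‖T‖ f hf
    (1 / ((n : ℝ) + 1)) (by positivity)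
  have hdist : ∀ n m : ℕ, ‖Polynomial.aeval T (p n) - Polynomial.aeval T (p m)‖
      ≤ 1 / ((n : ℝ) + 1) + 1 / ((m : ℝ) + 1) := fun n m => by
    rw [← map_sub]
    refine norm_aeval_le hT _ fun x hx => ?_
    have e : (p n - p m).eval x = ((p n).eval x - f x) - ((p m).eval x - f x) := by
      rw [Polynomial.eval_sub]; ring
    rw [e]
    exact (abs_sub _ _).trans (add_le_add (hp n x hx).le (hp m x hx).le)
  have hlim : Tendsto (fun n : ℕ => 1 / ((n : ℝ) + 1)) atTop (𝓝 0) :=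
    tendsto_one_div_add_atTop_nhds_zero_nat
  have hc : CauchySeq fun n => Polynomial.aeval T (p n) := by
    refine cauchySeq_of_le_tendsto_0 (fun N : ℕ => 1 / ((N : ℝ) + 1) + 1 / ((N : ℝ) + 1))
      (fun n m N hn hm => ?_) (by simpa using hlim.add hlim)
    rw [dist_eq_norm]
    refine (hdist n m).trans ?_
    gcongr
  obtain ⟨S, hS⟩ := cauchySeq_tendsto_of_complete hc
  refine ⟨S, fun ε hε => ?_⟩
  have h1 : ∀ᶠ n : ℕ in atTop, 1 / ((n : ℝ) + 1) < ε := hlim.eventually_lt_const hε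
  have h2 : ∀ᶠ n : ℕ in atTop, ‖Polynomial.aeval T (p n) - S‖ < ε := by
    have := (tendsto_iff_norm_sub_tendsto_zero.1 hS)
    exact this.eventually_lt_const hε
  obtain ⟨n, h1, h2⟩ := (h1.and h2).exists
  exact ⟨p n, fun x hx => ((hp n x hx).trans h1).le, h2.le⟩

theorem isFunctionOf_functionOf [CompleteSpace H] {T : H →L[ℝ] H} (hT : IsNonnegOp T) {f : ℝ → ℝ}
    (hf : ContinuousOn f (Icc 0 ‖T‖)) : IsFunctionOf T f (functionOf T f) := by
  obtain ⟨S, hS⟩ := exists_isFunctionOf hT hf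
  rwa [functionOf_eq hT hS]

theorem exists_abs_le_of_continuousOn {f : ℝ → ℝ} {M : ℝ} (hf : ContinuousOn f (Icc 0 M)) :
    ∃ A, ∀ x ∈ Icc (0 : ℝ) M, |f x| ≤ A := by
  obtain ⟨A, hA⟩ := isCompact_Icc.exists_bound_of_continuousOn hf
  exact ⟨A, hA⟩

section Rules

variable [CompleteSpace H] {T : H →L[ℝ] H} (hT : IsNonnegOp T) {f g : ℝ → ℝ}
include hT

theorem norm_functionOf_le (hf : ContinuousOn f (Icc 0 ‖T‖)) {c : ℝ}
    (h : ∀ x ∈ Icc (0 : ℝ) ‖T‖, |f x| ≤ c) : ‖functionOf T f‖ ≤ c :=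
  (isFunctionOf_functionOf hT hf).norm_le hT h

theorem functionOf_add (hf : ContinuousOn f (Icc 0 ‖T‖)) (hg : ContinuousOn g (Icc 0 ‖T‖)) :
    functionOf T (fun x => f x + g x) = functionOf T f + functionOf T g :=
  functionOf_eq hT ((isFunctionOf_functionOf hT hf).add (isFunctionOf_functionOf hT hg))

theorem functionOf_mul (hf : ContinuousOn f (Icc 0 ‖T‖)) (hg : ContinuousOn g (Icc 0 ‖T‖)) :
    functionOf T (fun x => f x * g x) = functionOf T f * functionOf T g := by
  obtain ⟨A, hA⟩ := exists_abs_le_of_continuousOn hf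
  obtain ⟨B, hB⟩ := exists_abs_le_of_continuousOn hg
  exact functionOf_eq hT
    ((isFunctionOf_functionOf hT hf).mul hT (isFunctionOf_functionOf hT hg) hA hB)

theorem functionOf_const (c : ℝ) : functionOf T (fun _ => c) = c • (1 : H →L[ℝ] H) :=
  functionOf_eq hT (isFunctionOf_const T c)

theorem functionOf_id : functionOf T (fun x => x) = T :=
  functionOf_eq hT (isFunctionOf_id T)

theorem functionOf_const_mul (c : ℝ) (hf : ContinuousOn f (Icc 0 ‖T‖)) :
    functionOf T (fun x => c * f x) = c • functionOf T f := by
  rw [functionOf_mul hT continuousOn_const hf, functionOf_const hT]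
  simp

theorem functionOf_congr (hf : ContinuousOn f (Icc 0 ‖T‖))
    (hfg : ∀ x ∈ Icc (0 : ℝ) ‖T‖, f x = g x) : functionOf T f = functionOf T g :=
  (functionOf_eq hT ((isFunctionOf_functionOf hT hf).congr hfg)).symm

theorem IsFunctionOf.aeval_comp {R : H →L[ℝ] H} {m : ℝ → ℝ} (hm : ContinuousOn m (Icc 0 ‖T‖))
    (hR : IsFunctionOf T m R) (p : Polynomial ℝ) :
    IsFunctionOf T (fun x => p.eval (m x)) (Polynomial.aeval R p) := by
  have hpc : ∀ p : Polynomial ℝ, ContinuousOn (fun x => p.eval (m x)) (Icc 0 ‖T‖) :=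
    fun p => p.continuous.comp_continuousOn hm
  obtain ⟨A, hA⟩ := exists_abs_le_of_continuousOn hm
  induction p using Polynomial.induction_on with
  | C a => simpa [Algebra.algebraMap_eq_smul_one] using isFunctionOf_const T a
  | add p q hp hq => simpa using hp.add hq
  | monomial n a ih =>
    obtain ⟨B, hB⟩ := exists_abs_le_of_continuousOn (hpc (Polynomial.C a * Polynomial.X ^ n))
    have := ih.mul hT hR hB hA
    rw [pow_succ, ← mul_assoc, map_mul, Polynomial.aeval_X]
    simpa only [Polynomial.eval_mul, Polynomial.eval_X] using this

/-- Composition rule of the functional calculus. -/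
theorem functionOf_comp {R : H →L[ℝ] H} (hR : IsNonnegOp R) {m : ℝ → ℝ}
    (hm : ContinuousOn m (Icc 0 ‖T‖)) (hm0 : ∀ x ∈ Icc (0 : ℝ) ‖T‖, 0 ≤ m x)
    (hRm : IsFunctionOf T m R) (hf : ContinuousOn f (Ici 0)) :
    functionOf R f = functionOf T (fun x => f (m x)) := by
  symm
  apply functionOf_eq hT
  obtain ⟨A, hA⟩ := exists_abs_le_of_continuousOn hm
  intro ε hε
  -- The interval has to contain both `[0, ‖R‖]`, for the calculus of `R`, and the values of `m`.
  obtain ⟨p, hp⟩ := exists_polynomial_near_of_continuousOn 0 (max ‖R‖ A) f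
    (hf.mono fun x hx => hx.1) (ε / 2) (by positivity)
  obtain ⟨q, hq, hq'⟩ := hRm.aeval_comp hT hm p (ε / 2) (by positivity)
  have hfR : ContinuousOn f (Icc 0 ‖R‖) := hf.mono fun x hx => hx.1
  refine ⟨q, fun x hx => ?_, ?_⟩
  · have h1 := hq x hx
    have h2 := (hp (m x) ⟨hm0 x hx, (le_abs_self _).trans ((hA x hx).trans (le_max_right _ _))⟩).le
    have := abs_sub_le (q.eval x) (p.eval (m x)) (f (m x))
    linarith
  · have h3 : ‖Polynomial.aeval R p - functionOf R f‖ ≤ ε / 2 := by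
      have e : Polynomial.aeval R p - functionOf R f
          = functionOf R (fun x => p.eval x + (-1) * f x) := by
        rw [functionOf_add hR (g := fun x => (-1) * f x) p.continuousOn (continuousOn_const.mul hfR),
          functionOf_const_mul hR _ hfR, functionOf_eq hR (isFunctionOf_aeval R p)]
        simp [sub_eq_add_neg]
      rw [e]
      refine norm_functionOf_le hR (f := fun x => p.eval x + (-1) * f x)
        (p.continuousOn.add (continuousOn_const.mul hfR)) fun x hx => ?_
      have := (hp x ⟨hx.1, hx.2.trans (le_max_left _ _)⟩).le
      rwa [neg_one_mul, ← sub_eq_add_neg]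
    have := norm_sub_le_norm_sub_add_norm_sub (Polynomial.aeval T q) (Polynomial.aeval R p)
      (functionOf R f)
    linarith

end Rules

end FunctionalCalculus

end SCBF


namespace SCBF

/-! ### The scalar kernels `x^{-a} e^{-s/x}`. -/

section ScalarKernel

/-- The function `x ↦ x^{-a} e^{-s/x}`. -/
noncomputable def expKernel (a s x : ℝ) : ℝ := x ^ (-a) * Real.exp (-s / x)

theorem expKernel_zero {a : ℝ} (ha : 0 < a) (s : ℝ) : expKernel a s 0 = 0 := by
  rw [expKernel, Real.zero_rpow (by linarith), zero_mul]

theorem expKernel_nonneg (a s : ℝ) {x : ℝ} (hx : 0 ≤ x) : 0 ≤ expKernel a s x := by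
  unfold expKernel; positivity

/-- With `y = s/x` this bounds `y^a e^{-y}`, whose maximum is at `y = a`. The inequality `log z ≤ z
- 1` at `z = y/a` proves it, even with an additional factor `e^{-a}` that is dropped. -/
theorem expKernel_le {a s x : ℝ} (ha : 0 < a) (hs : 0 < s) (hx : 0 ≤ x) :
    expKernel a s x ≤ a ^ a * s ^ (-a) := by
  rcases hx.eq_or_lt with rfl | hx
  · rw [expKernel_zero ha]; positivity
  have h1 : expKernel a s x = Real.exp (-a * Real.log x - s / x) := by
    rw [expKernel, Real.rpow_def_of_pos hx, ← Real.exp_add]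
    congr 1; ring
  have h2 : a ^ a * s ^ (-a) = Real.exp (a * Real.log a - a * Real.log s) := by
    rw [Real.rpow_def_of_pos ha, Real.rpow_def_of_pos hs, ← Real.exp_add]
    congr 1; ring
  rw [h1, h2, Real.exp_le_exp]
  have h3 := Real.log_le_sub_one_of_pos (show 0 < s / x / a by positivity)
  rw [Real.log_div (by positivity) ha.ne', Real.log_div hs.ne' hx.ne'] at h3
  have h4 : a * (s / x / a - 1) = s / x - a := by field_simp
  nlinarith [mul_le_mul_of_nonneg_left h3 ha.le]

theorem rpow_mul_expKernel {a b : ℝ} (hb : 0 < b) (hab : b < a) (s : ℝ) {x : ℝ} (hx : 0 ≤ x) :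
    x ^ (a - b) * expKernel a s x = expKernel b s x := by
  rcases hx.eq_or_lt with rfl | hx
  · rw [expKernel_zero hb, expKernel_zero (hb.trans hab), mul_zero]
  · rw [expKernel, expKernel, ← mul_assoc, ← Real.rpow_add hx]
    congr 2; ring

theorem mul_expKernel_add_one {a : ℝ} (ha : 0 < a) (s : ℝ) {x : ℝ} (hx : 0 ≤ x) :
    x * expKernel (a + 1) s x = expKernel a s x := by
  have := rpow_mul_expKernel ha (lt_add_one a) s hx
  rwa [add_sub_cancel_left, Real.rpow_one] at this

/-- For `x ≤ M` the power of `1/x` can be raised at the price of `M^{b-a}`, so the kernel decays in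
`s` as fast as desired. Here `M` will be `‖A⁻¹‖`, and the decay expresses the spectral gap. -/
theorem expKernel_le_of_le {a b s x M : ℝ} (ha : 0 < a) (hab : a ≤ b) (hs : 0 < s)
    (hx : x ∈ Icc 0 M) : expKernel a s x ≤ M ^ (b - a) * b ^ b * s ^ (-b) := by
  rcases hab.eq_or_lt with rfl | hab
  · simpa using expKernel_le ha hs hx.1
  rw [← rpow_mul_expKernel ha hab s hx.1, mul_assoc]
  have := hx.1.trans hx.2
  exact mul_le_mul (Real.rpow_le_rpow hx.1 hx.2 (by linarith))
    (expKernel_le (ha.trans hab) hs hx.1) (expKernel_nonneg _ _ hx.1) (by positivity)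

/-- Only `x = 0` is delicate: there the kernel is `x` times the kernel of exponent `a + 1`, which is
bounded locally in `s > 0`. -/
theorem continuousOn_expKernel {a : ℝ} (ha : 0 < a) :
    ContinuousOn (fun q : ℝ × ℝ => expKernel a q.1 q.2) (Ioi 0 ×ˢ Ici 0) := by
  rintro ⟨s, x⟩ ⟨hs, hx⟩
  have hs : 0 < s := hs
  have hx : 0 ≤ x := hx
  rcases hx.eq_or_lt with rfl | hx
  · change Tendsto _ _ (𝓝 (expKernel a s 0))
    rw [expKernel_zero ha]
    have hlim : Tendsto (fun q : ℝ × ℝ => q.2 * ((a + 1) ^ (a + 1) * q.1 ^ (-(a + 1))))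
        (𝓝[Ioi 0 ×ˢ Ici 0] (s, (0 : ℝ))) (𝓝 0) := by
      have : ContinuousAt (fun q : ℝ × ℝ => q.2 * ((a + 1) ^ (a + 1) * q.1 ^ (-(a + 1))))
          (s, (0 : ℝ)) := by
        refine continuousAt_snd.mul (continuousAt_const.mul ?_)
        exact ContinuousAt.rpow_const continuousAt_fst (Or.inl hs.ne')
      have h2 := this.tendsto.mono_left (nhdsWithin_le_nhds (s := Ioi 0 ×ˢ Ici 0))
      simpa using h2
    refine squeeze_zero' ?_ ?_ hlim
    · filter_upwards [self_mem_nhdsWithin] with q hq using expKernel_nonneg _ _ hq.2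
    · filter_upwards [self_mem_nhdsWithin] with q hq
      rw [← mul_expKernel_add_one ha q.1 hq.2]
      exact mul_le_mul_of_nonneg_left (expKernel_le (by linarith) hq.1 hq.2) hq.2
  · apply ContinuousAt.continuousWithinAt
    unfold expKernel
    refine (ContinuousAt.rpow_const continuousAt_snd (Or.inl hx.ne')).mul
      (Real.continuous_exp.continuousAt.comp ?_)
    exact continuousAt_fst.neg.div continuousAt_snd hx.ne'

end ScalarKernel

/-! ### Continuity and differentiability of operator families `F_s(T)`. -/

section OperatorFamilies

variable {H : Type*} [NormedAddCommGroup H] [InnerProductSpace ℝ H] [CompleteSpace H]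
  {T : H →L[ℝ] H}

theorem functionOf_sub (hT : IsNonnegOp T) {f g : ℝ → ℝ} (hf : ContinuousOn f (Icc 0 ‖T‖))
    (hg : ContinuousOn g (Icc 0 ‖T‖)) :
    functionOf T (fun x => f x - g x) = functionOf T f - functionOf T g := by
  have h : ContinuousOn (fun x => (-1) * g x) (Icc 0 ‖T‖) := continuousOn_const.mul hg
  have := functionOf_add hT hf h
  rw [functionOf_const_mul hT _ hg] at this
  simpa [sub_eq_add_neg] using this

theorem ContinuousOn.slice_right {F : ℝ → ℝ → ℝ} {S : Set ℝ} {M : ℝ}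
    (hF : ContinuousOn (Function.uncurry F) (S ×ˢ Icc 0 M)) {s : ℝ} (hs : s ∈ S) :
    ContinuousOn (F s) (Icc 0 M) :=
  hF.comp (f := fun x => (s, x)) (by fun_prop) fun _ hx => ⟨hs, hx⟩

/-- By compactness, joint continuity is continuity in `s` uniformly in `x`, and the calculus does
not increase the supremum norm. -/
theorem continuousOn_functionOf (hT : IsNonnegOp T) {F : ℝ → ℝ → ℝ} {S : Set ℝ}
    (hF : ContinuousOn (Function.uncurry F) (S ×ˢ Icc 0 ‖T‖)) :
    ContinuousOn (fun s => functionOf T (F s)) S := by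
  intro s hs
  rw [ContinuousWithinAt, Metric.tendsto_nhds]
  intro ε hε
  obtain ⟨v, hv, h⟩ := isCompact_Icc.mem_uniformity_of_prod hF hs
    (Metric.dist_mem_uniformity (half_pos hε))
  filter_upwards [hv, self_mem_nhdsWithin] with p hp hpS
  rw [dist_eq_norm, ← functionOf_sub hT (ContinuousOn.slice_right hF hpS)
    (ContinuousOn.slice_right hF hs)]
  refine (norm_functionOf_le hT ((ContinuousOn.slice_right hF hpS).sub
    (ContinuousOn.slice_right hF hs)) (c := ε / 2) fun x hx => ?_).trans_lt (half_lt_self hε)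
  have := h p hp x hx
  exact le_of_lt this

/-- The mean value inequality bounds the scalar Taylor remainder by `ε |p - s|` uniformly in `x`,
and the calculus turns this into the bound for the operators. -/
theorem hasDerivAt_functionOf (hT : IsNonnegOp T) {F F' : ℝ → ℝ → ℝ}
    (hF : ∀ s ∈ Ioi (0 : ℝ), ContinuousOn (F s) (Icc 0 ‖T‖))
    (hF' : ContinuousOn (Function.uncurry F') (Ioi 0 ×ˢ Icc 0 ‖T‖))
    (hd : ∀ s ∈ Ioi (0 : ℝ), ∀ x ∈ Icc 0 ‖T‖, HasDerivAt (fun s => F s x) (F' s x) s)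
    {s : ℝ} (hs : 0 < s) :
    HasDerivAt (fun s => functionOf T (F s)) (functionOf T (F' s)) s := by
  have hF's := ContinuousOn.slice_right hF' (mem_Ioi.2 hs)
  rw [hasDerivAt_iff_isLittleO, Asymptotics.isLittleO_iff]
  intro ε hε
  obtain ⟨v, hv, h⟩ := isCompact_Icc.mem_uniformity_of_prod hF' (mem_Ioi.2 hs)
    (Metric.dist_mem_uniformity hε)
  rw [isOpen_Ioi.nhdsWithin_eq hs] at hv
  obtain ⟨r, hr, hball⟩ := Metric.mem_nhds_iff.1 (inter_mem hv (Ioi_mem_nhds hs))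
  filter_upwards [Metric.ball_mem_nhds s hr] with p hp
  have hpS : p ∈ Ioi (0 : ℝ) := (hball hp).2
  have h1 : ContinuousOn (fun x => (p - s) * F' s x) (Icc 0 ‖T‖) := continuousOn_const.mul hF's
  have h2 : ContinuousOn (fun x => F p x - F s x) (Icc 0 ‖T‖) := (hF p hpS).sub (hF s hs)
  rw [← functionOf_sub hT (hF p hpS) (hF s hs), ← functionOf_const_mul hT _ hF's,
    ← functionOf_sub hT h2 h1]
  refine norm_functionOf_le hT (h2.sub h1) fun x hx => ?_
  have hmv := (convex_ball s r).norm_image_sub_le_of_norm_hasDerivWithin_le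
    (f := fun q => F q x - q * F' s x) (f' := fun q => F' q x - F' s x) (C := ε)
    (fun q hq => (((hd q (hball hq).2 x hx).sub (by
      simpa using (hasDerivAt_id q).mul_const (F' s x))).hasDerivWithinAt))
    (fun q hq => by
      have : dist (F' q x) (F' s x) < ε := h q (hball hq).1 x hx
      rw [Real.dist_eq] at this
      exact this.le) (Metric.mem_ball_self hr) hp
  have e : F p x - F s x - (p - s) * F' s x = F p x - p * F' s x - (F s x - s * F' s x) := by ring
  change |F p x - F s x - (p - s) * F' s x| ≤ _
  rw [e]
  exact hmv

end OperatorFamilies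

/-! ### Convolution of singular operator kernels with Hölder paths. -/

section KernelIntegrals

variable {H : Type*} [NormedAddCommGroup H] [NormedSpace ℝ H]

/-- A family `P s`, `s > 0`, of bounded operators with the singularity `s^{-(1+δ)}` at `0` and the
decay `s^{-(2+δ)}` at infinity. -/
structure IsSingularKernel (δ : ℝ) (P : ℝ → H →L[ℝ] H) : Prop where
  continuousOn : ContinuousOn P (Ioi 0)
  bound : ∃ C : ℝ, 0 ≤ C ∧ ∀ s : ℝ, 0 < s →
    ‖P s‖ ≤ C * s ^ (-(1 + δ)) ∧ ‖P s‖ ≤ C * s ^ (-(2 + δ))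

/-- The Hölder bound with exponent `ξ` and square root growth. -/
def HolderGrowth {Y : Type*} [NormedAddCommGroup Y] (ξ : ℝ) (η : ℝ → Y) : Prop :=
  ∃ C : ℝ, 0 ≤ C ∧ ∀ t s : ℝ, ‖η t - η s‖ ≤ C * (|t - s| ^ ξ * (1 + |t| + |s|) ^ (1 / 2 : ℝ))

theorem integrableOn_piecewise_rpow {p q A : ℝ} (hp : -1 < p) (hq : q < -1) :
    IntegrableOn (fun s : ℝ => if s ≤ 1 then A * s ^ p else A * s ^ q) (Ioi 0) := by
  rw [← Ioc_union_Ioi_eq_Ioi zero_le_one]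
  refine IntegrableOn.union ?_ ?_
  · refine IntegrableOn.congr_fun (f := fun s => A * s ^ p) ?_
      (fun s hs => by simp [hs.2]) measurableSet_Ioc
    exact ((intervalIntegrable_iff_integrableOn_Ioc_of_le zero_le_one).1
      (intervalIntegral.intervalIntegrable_rpow' hp)).const_mul A
  · refine IntegrableOn.congr_fun (f := fun s => A * s ^ q) ?_
      (fun s hs => by simp [not_le.2 (mem_Ioi.1 hs)]) measurableSet_Ioi
    exact (integrableOn_Ioi_rpow_of_lt hq zero_lt_one).const_mul A

variable {δ ξ : ℝ} {P : ℝ → H →L[ℝ] H} {η : ℝ → H}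

/-- Near `0` the increment `s^ξ` beats `s^{-(1+δ)}` because `δ < ξ`. At infinity the growth of the
path contributes `s^{ξ + 1/2}`, which is integrable against `s^{-(2+δ)}` because `ξ - δ < 1/2`.
Uniformity in `|t| ≤ R` serves dominated convergence. -/
theorem IsSingularKernel.exists_dominating (hP : IsSingularKernel δ P) (hδξ : δ < ξ)
    (hξ : ξ < 1 / 2) (hδ : 0 < δ) (hη : HolderGrowth ξ η) (R : ℝ) (hR : 0 ≤ R) :
    ∃ B : ℝ → ℝ, IntegrableOn B (Ioi 0) ∧
      ∀ t, |t| ≤ R → ∀ s ∈ Ioi (0 : ℝ), ‖P s (η t - η (t - s))‖ ≤ B s := by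
  obtain ⟨C, hC, hPC⟩ := hP.bound
  obtain ⟨C', hC', hηC⟩ := hη
  -- The factor `2 + 2R` bounds `1 + 2R + s` for `s ≤ 1`, and bounds it up to a factor `s` for `s >
  -- 1`.
  refine ⟨_, integrableOn_piecewise_rpow (p := ξ - 1 - δ) (q := ξ - δ - 3 / 2)
    (A := C * C' * (2 + 2 * R) ^ (1 / 2 : ℝ)) (by linarith) (by linarith), fun t ht s hs => ?_⟩
  have hs : 0 < s := hs
  have h1 : ‖η t - η (t - s)‖ ≤ C' * (s ^ ξ * (1 + 2 * R + s) ^ (1 / 2 : ℝ)) := by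
    refine (hηC t (t - s)).trans ?_
    rw [sub_sub_cancel, abs_of_pos hs]
    have := abs_sub t s
    rw [abs_of_pos hs] at this
    have h3 : 1 + |t| + |t - s| ≤ 1 + 2 * R + s := by linarith
    gcongr
  have h2 := (P s).le_opNorm (η t - η (t - s))
  obtain ⟨b1, b2⟩ := hPC s hs
  split_ifs with h
  · calc ‖P s (η t - η (t - s))‖ ≤ (C * s ^ (-(1 + δ))) *
          (C' * (s ^ ξ * (1 + 2 * R + s) ^ (1 / 2 : ℝ))) := h2.trans (by gcongr)
      _ ≤ (C * s ^ (-(1 + δ))) * (C' * (s ^ ξ * (2 + 2 * R) ^ (1 / 2 : ℝ))) := by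
          have h3 : 1 + 2 * R + s ≤ 2 + 2 * R := by linarith
          gcongr
      _ = C * C' * (2 + 2 * R) ^ (1 / 2 : ℝ) * (s ^ (-(1 + δ)) * s ^ ξ) := by ring
      _ = _ := by rw [← Real.rpow_add hs]; congr 2; ring
  · push Not at h
    have h3 : (1 + 2 * R + s) ^ (1 / 2 : ℝ) ≤ (2 + 2 * R) ^ (1 / 2 : ℝ) * s ^ (1 / 2 : ℝ) := by
      rw [← Real.mul_rpow (by positivity) hs.le]
      gcongr
      nlinarith
    calc ‖P s (η t - η (t - s))‖ ≤ (C * s ^ (-(2 + δ))) *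
          (C' * (s ^ ξ * (1 + 2 * R + s) ^ (1 / 2 : ℝ))) := h2.trans (by gcongr)
      _ ≤ (C * s ^ (-(2 + δ))) *
          (C' * (s ^ ξ * ((2 + 2 * R) ^ (1 / 2 : ℝ) * s ^ (1 / 2 : ℝ)))) := by gcongr
      _ = C * C' * (2 + 2 * R) ^ (1 / 2 : ℝ) * (s ^ (-(2 + δ)) * s ^ ξ * s ^ (1 / 2 : ℝ)) := by
          ring
      _ = _ := by rw [← Real.rpow_add hs, ← Real.rpow_add hs]; congr 2; ring

theorem IsSingularKernel.aestronglyMeasurable (hP : IsSingularKernel δ P) {g : ℝ → H}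
    (hg : Continuous g) :
    AEStronglyMeasurable (fun s => P s (g s)) (volume.restrict (Ioi 0)) :=
  (hP.continuousOn.clm_apply hg.continuousOn).aestronglyMeasurable measurableSet_Ioi

theorem IsSingularKernel.integrableOn (hP : IsSingularKernel δ P) (hδξ : δ < ξ)
    (hξ : ξ < 1 / 2) (hδ : 0 < δ) (hη : HolderGrowth ξ η) (hc : Continuous η) (t : ℝ) :
    IntegrableOn (fun s => P s (η t - η (t - s))) (Ioi 0) := by
  obtain ⟨B, hB, h⟩ := hP.exists_dominating hδξ hξ hδ hη |t| (abs_nonneg t)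
  refine Integrable.mono' hB (hP.aestronglyMeasurable (by fun_prop)) ?_
  exact (ae_restrict_iff' measurableSet_Ioi).2 (ae_of_all _ fun s hs => h t le_rfl s hs)

theorem IsSingularKernel.continuous_integral (hP : IsSingularKernel δ P) (hδξ : δ < ξ)
    (hξ : ξ < 1 / 2) (hδ : 0 < δ) (hη : HolderGrowth ξ η) (hc : Continuous η) :
    Continuous fun t => ∫ s in Ioi 0, P s (η t - η (t - s)) := by
  refine continuous_iff_continuousAt.2 fun t => ?_
  obtain ⟨B, hB, h⟩ := hP.exists_dominating hδξ hξ hδ hη (|t| + 1) (by positivity)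
  refine continuousAt_of_dominated (bound := B)
    (Eventually.of_forall fun t => hP.aestronglyMeasurable (by fun_prop)) ?_ hB
    (ae_of_all _ fun s => by fun_prop)
  filter_upwards [Metric.ball_mem_nhds t zero_lt_one] with p hp
  refine (ae_restrict_iff' measurableSet_Ioi).2 (ae_of_all _ fun s hs => h p ?_ s hs)
  rw [Metric.mem_ball, Real.dist_eq] at hp
  have := abs_sub_abs_le_abs_sub p t
  linarith

end KernelIntegrals

end SCBF


namespace SCBF

/-! ### Symbols of the semigroup and of the Ornstein-Uhlenbeck kernels. -/

section Symbols

/-- The function of `x = 1 / a` whose value is `e^{-s (μ a + χ)}`. -/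
noncomputable def heatSymbol (μ χ s x : ℝ) : ℝ :=
  Real.exp (-s * χ) * (x * expKernel 1 (μ * s) x)

/-- The function of `x = 1 / a` whose value is `a^δ (μ a + χ) e^{-s (μ a + χ)}`. -/
noncomputable def ouSymbol (μ χ δ s x : ℝ) : ℝ :=
  (μ + χ * x) * Real.exp (-s * χ) * expKernel (1 + δ) (μ * s) x

/-- The function of `x = 1 / a` whose value is `a` times the difference of the values of
`ouSymbol` for `χ₁` and `χ₂`. -/
noncomputable def ouDiffSymbol (μ χ₁ χ₂ δ s x : ℝ) : ℝ :=
  ((μ + χ₁ * x) * Real.exp (-s * χ₁) - (μ + χ₂ * x) * Real.exp (-s * χ₂)) *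
    expKernel (2 + δ) (μ * s) x

variable {μ χ χ₁ χ₂ δ s x M : ℝ}

theorem continuousOn_expKernel_mul {a : ℝ} (ha : 0 < a) (hμ : 0 < μ) :
    ContinuousOn (fun q : ℝ × ℝ => expKernel a (μ * q.1) q.2) (Ioi 0 ×ˢ Icc 0 M) :=
  (continuousOn_expKernel ha).comp (f := fun q : ℝ × ℝ => (μ * q.1, q.2)) (by fun_prop)
    fun _ hq => ⟨mul_pos hμ hq.1, hq.2.1⟩

theorem continuousOn_heatSymbol (hμ : 0 < μ) :
    ContinuousOn (Function.uncurry (heatSymbol μ χ)) (Ioi 0 ×ˢ Icc 0 M) := by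
  have := continuousOn_expKernel_mul (M := M) zero_lt_one hμ
  unfold Function.uncurry heatSymbol
  fun_prop

theorem continuousOn_ouSymbol (hμ : 0 < μ) (hδ : 0 < δ) :
    ContinuousOn (Function.uncurry (ouSymbol μ χ δ)) (Ioi 0 ×ˢ Icc 0 M) := by
  have := continuousOn_expKernel_mul (M := M) (show 0 < 1 + δ by linarith) hμ
  unfold Function.uncurry ouSymbol
  fun_prop

theorem continuousOn_ouDiffSymbol (hμ : 0 < μ) (hδ : 0 < δ) :
    ContinuousOn (Function.uncurry (ouDiffSymbol μ χ₁ χ₂ δ)) (Ioi 0 ×ˢ Icc 0 M) := by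
  have := continuousOn_expKernel_mul (M := M) (show 0 < 2 + δ by linarith) hμ
  unfold Function.uncurry ouDiffSymbol
  fun_prop

theorem exists_expKernel_le {a b : ℝ} (ha : 0 < a) (hab : a ≤ b) (hμ : 0 < μ) (hM : 0 ≤ M) :
    ∃ C, 0 ≤ C ∧ ∀ s, 0 < s → ∀ x ∈ Icc 0 M, expKernel a (μ * s) x ≤ C * s ^ (-b) := by
  have hb := ha.trans_le hab
  refine ⟨M ^ (b - a) * b ^ b * μ ^ (-b), by positivity, fun s hs x hx => ?_⟩
  refine (expKernel_le_of_le ha hab (mul_pos hμ hs) hx).trans (le_of_eq ?_)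
  rw [Real.mul_rpow hμ.le hs.le]; ring

theorem heatSymbol_of_ne_zero (hx : x ≠ 0) :
    heatSymbol μ χ s x = Real.exp (-s * (μ / x + χ)) := by
  rw [heatSymbol, expKernel, ← mul_assoc x, Real.rpow_neg_one, mul_inv_cancel₀ hx, one_mul,
    ← Real.exp_add]
  congr 1; field_simp; ring

theorem heatSymbol_zero : heatSymbol μ χ s 0 = 0 := by simp [heatSymbol]

theorem heatSymbol_nonneg (hx : 0 ≤ x) : 0 ≤ heatSymbol μ χ s x := by
  have := expKernel_nonneg 1 (μ * s) hx
  unfold heatSymbol; positivity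

theorem heatSymbol_le_one (hμ : 0 < μ) (hχ : 0 ≤ χ) (hs : 0 ≤ s) (hx : 0 ≤ x) :
    heatSymbol μ χ s x ≤ 1 := by
  rcases hx.eq_or_lt with rfl | hx
  · rw [heatSymbol_zero]; exact zero_le_one
  · rw [heatSymbol_of_ne_zero hx.ne', Real.exp_le_one_iff]
    have : 0 ≤ s * (μ / x + χ) := by positivity
    linarith

theorem heatSymbol_add {s h : ℝ} :
    heatSymbol μ χ (h + s) x = heatSymbol μ χ h x * heatSymbol μ χ s x := by
  rcases eq_or_ne x 0 with rfl | hx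
  · simp [heatSymbol_zero]
  · rw [heatSymbol_of_ne_zero hx, heatSymbol_of_ne_zero hx, heatSymbol_of_ne_zero hx,
      ← Real.exp_add]
    congr 1; ring

theorem mul_heatSymbol_time_zero : x * heatSymbol μ χ 0 x = x := by
  rcases eq_or_ne x 0 with rfl | hx
  · simp
  · simp [heatSymbol_of_ne_zero hx]

theorem abs_mul_heatSymbol_sub_le (hμ : 0 < μ) (hχ : 0 ≤ χ) (hs : 0 ≤ s) (hx : 0 ≤ x) :
    |x * heatSymbol μ χ s x - x| ≤ s * (μ + χ * x) := by
  rcases hx.eq_or_lt with rfl | hx'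
  · simp; positivity
  · have h1 := heatSymbol_le_one (x := x) hμ hχ hs hx
    have h2 := Real.add_one_le_exp (-s * (μ / x + χ))
    rw [← heatSymbol_of_ne_zero hx'.ne'] at h2
    have h3 : x * (-s * (μ / x + χ)) = -(s * (μ + χ * x)) := by field_simp
    rw [abs_le]
    constructor <;> nlinarith [mul_le_mul_of_nonneg_left h2 hx,
      mul_le_mul_of_nonneg_left h1 hx, show 0 ≤ s * (μ + χ * x) by positivity]

/-- The factor `x` compensates the unbounded generator: the derivative is the bounded symbol `μ + χ
x` times the semigroup, which stays under control as `s → 0`. -/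
theorem hasDerivAt_mul_heatSymbol (x : ℝ) (s : ℝ) :
    HasDerivAt (fun s => x * heatSymbol μ χ s x) (-((μ + χ * x) * heatSymbol μ χ s x)) s := by
  rcases eq_or_ne x 0 with rfl | hx
  · simpa [heatSymbol_zero] using hasDerivAt_const s (0 : ℝ)
  · simp only [heatSymbol_of_ne_zero hx]
    have h1 : HasDerivAt (fun s : ℝ => -s * (μ / x + χ)) (-1 * (μ / x + χ)) s :=
      (hasDerivAt_neg s).mul_const _
    refine (h1.exp.const_mul x).congr_deriv ?_
    field_simp

theorem rpow_mul_ouSymbol (hδ : 0 < δ) (hx : 0 ≤ x) :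
    x ^ δ * (x * ouSymbol μ χ δ s x) = (μ + χ * x) * heatSymbol μ χ s x := by
  have h := rpow_mul_expKernel (a := 1 + δ) zero_lt_one (by linarith) (μ * s) hx
  rw [add_sub_cancel_left] at h
  rw [ouSymbol, heatSymbol, ← h]; ring

theorem mul_ouDiffSymbol (hδ : 0 < δ) (hx : 0 ≤ x) :
    x * ouDiffSymbol μ χ₁ χ₂ δ s x = ouSymbol μ χ₁ δ s x - ouSymbol μ χ₂ δ s x := by
  have h := mul_expKernel_add_one (a := 1 + δ) (by linarith) (μ * s) hx
  rw [show 1 + δ + 1 = 2 + δ by ring] at h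
  rw [ouDiffSymbol, ouSymbol, ouSymbol, ← h]; ring

theorem exp_neg_mul_le_one (hχ : 0 ≤ χ) (hs : 0 < s) : Real.exp (-s * χ) ≤ 1 := by
  rw [Real.exp_le_one_iff]
  have : 0 ≤ s * χ := by positivity
  linarith

theorem exists_abs_heatSymbol_le (hμ : 0 < μ) (hχ : 0 ≤ χ) (hM : 0 ≤ M) {b : ℝ} (hb : 1 ≤ b) :
    ∃ C, 0 ≤ C ∧ ∀ s, 0 < s → ∀ x ∈ Icc 0 M, |heatSymbol μ χ s x| ≤ C * s ^ (-b) := by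
  obtain ⟨C, hC, h⟩ := exists_expKernel_le zero_lt_one hb hμ hM
  refine ⟨M * C, by positivity, fun s hs x hx => ?_⟩
  rw [abs_of_nonneg (heatSymbol_nonneg hx.1), heatSymbol, mul_assoc M]
  have h0 := expKernel_nonneg 1 (μ * s) hx.1
  calc Real.exp (-s * χ) * (x * expKernel 1 (μ * s) x) ≤ 1 * (M * (C * s ^ (-b))) :=
        mul_le_mul (exp_neg_mul_le_one hχ hs)
          (mul_le_mul hx.2 (h s hs x hx) h0 hM) (mul_nonneg hx.1 h0) zero_le_one
    _ = _ := one_mul _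

theorem exists_abs_ouSymbol_le (hμ : 0 < μ) (hχ : 0 ≤ χ) (hδ : 0 < δ) (hM : 0 ≤ M) {b : ℝ}
    (hb : 1 + δ ≤ b) :
    ∃ C, 0 ≤ C ∧ ∀ s, 0 < s → ∀ x ∈ Icc 0 M, |ouSymbol μ χ δ s x| ≤ C * s ^ (-b) := by
  obtain ⟨C, hC, h⟩ := exists_expKernel_le (show 0 < 1 + δ by linarith) hb hμ hM
  refine ⟨(μ + χ * M) * C, by positivity, fun s hs x hx => ?_⟩
  have h0 := expKernel_nonneg (1 + δ) (μ * s) hx.1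
  have h1 : 0 ≤ μ + χ * x := add_nonneg hμ.le (mul_nonneg hχ hx.1)
  rw [ouSymbol, abs_of_nonneg (by positivity), mul_assoc _ C]
  refine mul_le_mul ?_ (h s hs x hx) h0 (by positivity)
  calc (μ + χ * x) * Real.exp (-s * χ) ≤ (μ + χ * x) * 1 := by
        gcongr; exact exp_neg_mul_le_one hχ hs
    _ ≤ μ + χ * M := by rw [mul_one]; gcongr; exact hx.2

/-- The kernel has exponent `2 + δ`, one too many, but the coefficients for `χ₁` and `χ₂` differ
only by `O(s + x)`. The factor `s` gains one power of `s`, and the factor `x` lowers the exponent of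
the kernel by one. So `A(Υ_{χ₁} - Υ_{χ₂})` has a kernel no more singular than that of each path. -/
theorem exists_abs_ouDiffSymbol_le (hμ : 0 < μ) (hχ₁ : 0 ≤ χ₁) (hχ₂ : 0 ≤ χ₂) (hδ : 0 < δ)
    (hM : 0 ≤ M) {b : ℝ} (hb : 1 + δ ≤ b) :
    ∃ C, 0 ≤ C ∧ ∀ s, 0 < s → ∀ x ∈ Icc 0 M, |ouDiffSymbol μ χ₁ χ₂ δ s x| ≤ C * s ^ (-b) := by
  obtain ⟨C, hC, h⟩ := exists_expKernel_le (show 0 < 1 + δ by linarith) hb hμ hM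
  obtain ⟨C', hC', h'⟩ := exists_expKernel_le (b := b + 1) (show 0 < 2 + δ by linarith)
    (by linarith) hμ hM
  set B := (μ + 1) * (χ₁ + χ₂) with hB
  have hB0 : 0 ≤ B := by positivity
  refine ⟨B * (C' + C), by positivity, fun s hs x hx => ?_⟩
  have h0 := expKernel_nonneg (2 + δ) (μ * s) hx.1
  have hcoef : |(μ + χ₁ * x) * Real.exp (-s * χ₁) - (μ + χ₂ * x) * Real.exp (-s * χ₂)|
      ≤ B * (s + x) := by
    have a1 := exp_neg_mul_le_one hχ₁ hs
    have a2 := exp_neg_mul_le_one hχ₂ hs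
    have b1 := Real.add_one_le_exp (-s * χ₁)
    have b2 := Real.add_one_le_exp (-s * χ₂)
    have c1 := (Real.exp_pos (-s * χ₁)).le
    have c2 := (Real.exp_pos (-s * χ₂)).le
    have hx0 := hx.1
    set e₁ := Real.exp (-s * χ₁)
    set e₂ := Real.exp (-s * χ₂)
    have d1 : |μ * (e₁ - e₂)| ≤ μ * (s * (χ₁ + χ₂)) := by
      rw [abs_mul, abs_of_pos hμ]
      gcongr
      rw [abs_le]
      have := mul_nonneg hs.le hχ₁
      have := mul_nonneg hs.le hχ₂
      constructor <;> linarith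
    have d2 : |x * (χ₁ * e₁ - χ₂ * e₂)| ≤ x * (χ₁ + χ₂) := by
      rw [abs_mul, abs_of_nonneg hx0]
      gcongr
      have := mul_nonneg hχ₁ c1
      have := mul_nonneg hχ₂ c2
      have := mul_le_mul_of_nonneg_left a1 hχ₁
      have := mul_le_mul_of_nonneg_left a2 hχ₂
      rw [abs_le]; constructor <;> linarith
    have e : (μ + χ₁ * x) * e₁ - (μ + χ₂ * x) * e₂
        = μ * (e₁ - e₂) + x * (χ₁ * e₁ - χ₂ * e₂) := by ring
    rw [e]
    refine (abs_add_le _ _).trans ((add_le_add d1 d2).trans ?_)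
    have : 0 ≤ s * (χ₁ + χ₂) + μ * (x * (χ₁ + χ₂)) := by positivity
    rw [hB]; linarith
  have hmul := mul_expKernel_add_one (a := 1 + δ) (by linarith) (μ * s) hx.1
  rw [show 1 + δ + 1 = 2 + δ by ring] at hmul
  have hs1 : s * s ^ (-(b + 1)) = s ^ (-b) := by
    nth_rewrite 1 [← Real.rpow_one s]
    rw [← Real.rpow_add hs]; congr 1; ring
  rw [ouDiffSymbol, abs_mul, abs_of_nonneg h0]
  calc _ ≤ B * (s + x) * expKernel (2 + δ) (μ * s) x := by gcongr
    _ = B * (s * expKernel (2 + δ) (μ * s) x + expKernel (1 + δ) (μ * s) x) := by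
        rw [← hmul]; ring
    _ ≤ B * (s * (C' * s ^ (-(b + 1))) + C * s ^ (-b)) := by
        gcongr
        · exact h' s hs x hx
        · exact h s hs x hx
    _ = B * (C' * (s * s ^ (-(b + 1))) + C * s ^ (-b)) := by ring
    _ = _ := by rw [hs1]; ring

end Symbols

section SymbolOperators

variable {H : Type*} [NormedAddCommGroup H] [InnerProductSpace ℝ H] [CompleteSpace H]
  {K : H →L[ℝ] H} {δ : ℝ}

theorem isSingularKernel_functionOf (hK : IsNonnegOp K) {F : ℝ → ℝ → ℝ}
    (hF : ContinuousOn (Function.uncurry F) (Ioi 0 ×ˢ Icc 0 ‖K‖))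
    (h : ∀ b, 1 + δ ≤ b →
      ∃ C, 0 ≤ C ∧ ∀ s, 0 < s → ∀ x ∈ Icc 0 ‖K‖, |F s x| ≤ C * s ^ (-b)) :
    IsSingularKernel δ fun s => functionOf K (F s) := by
  obtain ⟨C₁, hC₁, h₁⟩ := h (1 + δ) le_rfl
  obtain ⟨C₂, hC₂, h₂⟩ := h (2 + δ) (by linarith)
  refine ⟨continuousOn_functionOf hK hF, C₁ + C₂, by positivity, fun s hs => ⟨?_, ?_⟩⟩
  · refine norm_functionOf_le hK (ContinuousOn.slice_right hF hs) fun x hx =>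
      (h₁ s hs x hx).trans ?_
    gcongr; linarith
  · refine norm_functionOf_le hK (ContinuousOn.slice_right hF hs) fun x hx =>
      (h₂ s hs x hx).trans ?_
    gcongr; linarith

end SymbolOperators

end SCBF


namespace SCBF

/-! ### The Ornstein-Uhlenbeck path in an abstract Hilbert space, with `A = K⁻¹`. -/

section OrnsteinUhlenbeck

variable {H : Type*} [NormedAddCommGroup H] [InnerProductSpace ℝ H] [CompleteSpace H]

/-- The operator `e^{-s (μ A + χ)}` for `A = K⁻¹`. -/
noncomputable def heatOp (K : H →L[ℝ] H) (μ χ s : ℝ) : H →L[ℝ] H :=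
  functionOf K (heatSymbol μ χ s)

/-- The operator `A^δ (μ A + χ) e^{-s (μ A + χ)}` for `A = K⁻¹`. -/
noncomputable def ouOp (K : H →L[ℝ] H) (μ χ δ s : ℝ) : H →L[ℝ] H :=
  functionOf K (ouSymbol μ χ δ s)

/-- The operator `μ + χ K`. -/
noncomputable def shiftOp (K : H →L[ℝ] H) (μ χ : ℝ) : H →L[ℝ] H := μ • (1 : H →L[ℝ] H) + χ • K

/-- The convolution `∫_{-∞}^t e^{-(t-τ)(μ A + χ)} η(τ) dτ` for `A = K⁻¹`. -/
noncomputable def heatConv (K : H →L[ℝ] H) (μ χ : ℝ) (η : ℝ → H) (t : ℝ) : H :=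
  ∫ s in Ioi 0, heatOp K μ χ s (η (t - s))

/-- The path `∫_{-∞}^t A^δ (μ A + χ) e^{-(t-τ)(μ A + χ)} (η(t) - η(τ)) dτ` for `A = K⁻¹`. -/
noncomputable def ouConv (K : H →L[ℝ] H) (μ χ δ : ℝ) (η : ℝ → H) (t : ℝ) : H :=
  ∫ s in Ioi 0, ouOp K μ χ δ s (η t - η (t - s))

variable {K : H →L[ℝ] H} {μ χ δ ξ : ℝ} {η : ℝ → H}

theorem continuousOn_self_mul {f : ℝ → ℝ} {S : Set ℝ} (hf : ContinuousOn f S) :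
    ContinuousOn (fun x => x * f x) S := (continuousOn_id' _).mul hf

theorem functionOf_self_mul (hK : IsNonnegOp K) {f : ℝ → ℝ} (hf : ContinuousOn f (Icc 0 ‖K‖)) :
    functionOf K (fun x => x * f x) = K * functionOf K f := by
  have := functionOf_mul hK (f := fun x => x) (continuousOn_id' _) hf
  rwa [functionOf_id hK] at this

theorem functionOf_mul_comm (hK : IsNonnegOp K) {f : ℝ → ℝ} (hf : ContinuousOn f (Icc 0 ‖K‖)) :
    functionOf K f * K = K * functionOf K f := by
  have := functionOf_mul hK (g := fun x => x) hf (continuousOn_id' _)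
  rw [functionOf_id hK] at this
  rw [← this, ← functionOf_self_mul hK hf]
  simp only [mul_comm]

theorem shiftOp_eq (hK : IsNonnegOp K) : shiftOp K μ χ = functionOf K (fun x => μ + χ * x) := by
  rw [functionOf_add hK continuousOn_const (by fun_prop), functionOf_const hK,
    functionOf_const_mul hK (f := fun x => x) _ (continuousOn_id' _), functionOf_id hK, shiftOp]

theorem continuousOn_heatSymbol_slice (hμ : 0 < μ) {s : ℝ} (hs : 0 < s) {M : ℝ} :
    ContinuousOn (heatSymbol μ χ s) (Icc 0 M) :=
  ContinuousOn.slice_right (continuousOn_heatSymbol hμ) (mem_Ioi.2 hs)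

theorem isSingularKernel_heatOp (hK : IsNonnegOp K) (hμ : 0 < μ) (hχ : 0 ≤ χ) (hδ : 0 < δ) :
    IsSingularKernel δ (heatOp K μ χ) :=
  isSingularKernel_functionOf hK (continuousOn_heatSymbol hμ) fun _ hb =>
    exists_abs_heatSymbol_le hμ hχ (norm_nonneg _) (by linarith)

theorem isSingularKernel_ouOp (hK : IsNonnegOp K) (hμ : 0 < μ) (hχ : 0 ≤ χ) (hδ : 0 < δ) :
    IsSingularKernel δ (ouOp K μ χ δ) :=
  isSingularKernel_functionOf hK (continuousOn_ouSymbol hμ hδ) fun _ hb =>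
    exists_abs_ouSymbol_le hμ hχ hδ (norm_nonneg _) hb

theorem heatOp_add (hK : IsNonnegOp K) (hμ : 0 < μ) {s h : ℝ} (hs : 0 < s) (hh : 0 < h) :
    heatOp K μ χ (h + s) = heatOp K μ χ h * heatOp K μ χ s := by
  rw [heatOp, heatOp, heatOp, ← functionOf_mul hK (continuousOn_heatSymbol_slice hμ hh)
    (continuousOn_heatSymbol_slice hμ hs)]
  congr 1
  ext x
  exact heatSymbol_add

theorem norm_heatOp_le_one (hK : IsNonnegOp K) (hμ : 0 < μ) (hχ : 0 ≤ χ) {s : ℝ} (hs : 0 < s) :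
    ‖heatOp K μ χ s‖ ≤ 1 :=
  norm_functionOf_le hK (continuousOn_heatSymbol_slice hμ hs) fun x hx => by
    rw [abs_of_nonneg (heatSymbol_nonneg hx.1)]
    exact heatSymbol_le_one hμ hχ hs.le hx.1

theorem integrableOn_heatOp (hK : IsNonnegOp K) (hμ : 0 < μ) (hχ : 0 ≤ χ) :
    IntegrableOn (heatOp K μ χ) (Ioi 0) := by
  -- Any positive exponent would do in place of `1`: near `0` the semigroup is bounded by `1`, and
  -- only the decay at infinity is taken from the kernel bound.
  have hk := isSingularKernel_heatOp hK hμ hχ zero_lt_one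
  obtain ⟨C, hC, h⟩ := hk.bound
  refine Integrable.mono' (integrableOn_piecewise_rpow (p := 0) (q := -(2 + 1)) (A := 1 + C)
    (by norm_num) (by norm_num)) (hk.continuousOn.aestronglyMeasurable measurableSet_Ioi) ?_
  refine (ae_restrict_iff' measurableSet_Ioi).2 (ae_of_all _ fun s hs => ?_)
  have hs : 0 < s := hs
  split_ifs
  · rw [Real.rpow_zero]
    linarith [norm_heatOp_le_one (s := s) hK hμ hχ hs]
  · refine (h s hs).2.trans ?_
    gcongr
    linarith

theorem mul_heatOp (hK : IsNonnegOp K) (hμ : 0 < μ) {s : ℝ} (hs : 0 < s) :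
    K * heatOp K μ χ s = functionOf K (fun x => x * heatSymbol μ χ s x) :=
  (functionOf_self_mul hK (continuousOn_heatSymbol_slice hμ hs)).symm

theorem norm_mul_heatOp_sub_le (hK : IsNonnegOp K) (hμ : 0 < μ) (hχ : 0 ≤ χ) {s : ℝ}
    (hs : 0 < s) : ‖K * heatOp K μ χ s - K‖ ≤ s * (μ + χ * ‖K‖) := by
  have hc := continuousOn_self_mul (continuousOn_heatSymbol_slice (M := ‖K‖) (χ := χ) hμ hs)
  have e : K * heatOp K μ χ s - K = functionOf K (fun x => x * heatSymbol μ χ s x - x) := by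
    rw [functionOf_sub hK hc (continuousOn_id' _), functionOf_id hK, mul_heatOp hK hμ hs]
  rw [e]
  refine norm_functionOf_le hK (f := fun x => x * heatSymbol μ χ s x - x)
    (hc.sub (continuousOn_id' _)) fun x hx => (abs_mul_heatSymbol_sub_le hμ hχ hs.le hx.1).trans ?_
  gcongr
  exact hx.2

theorem hasDerivAt_mul_heatOp (hK : IsNonnegOp K) (hμ : 0 < μ) {s : ℝ} (hs : 0 < s) :
    HasDerivAt (fun s => functionOf K (fun x => x * heatSymbol μ χ s x))
      (-(shiftOp K μ χ * heatOp K μ χ s)) s := by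
  have hc : ∀ s ∈ Ioi (0 : ℝ), ContinuousOn (heatSymbol μ χ s) (Icc 0 ‖K‖) :=
    fun s hs => continuousOn_heatSymbol_slice hμ hs
  have h1 : ContinuousOn (Function.uncurry fun s x => (-1) * ((μ + χ * x) * heatSymbol μ χ s x))
      (Ioi 0 ×ˢ Icc 0 ‖K‖) := by
    have := continuousOn_heatSymbol (χ := χ) (M := ‖K‖) hμ
    unfold Function.uncurry at this ⊢
    fun_prop
  have := hasDerivAt_functionOf hK (F := fun s x => x * heatSymbol μ χ s x)
    (fun s hs => continuousOn_self_mul (hc s hs)) h1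
    (fun s _ x _ => by simpa using hasDerivAt_mul_heatSymbol x s) hs
  have hN : ContinuousOn (fun x : ℝ => μ + χ * x) (Icc 0 ‖K‖) := by fun_prop
  rwa [functionOf_const_mul hK (f := fun x => (μ + χ * x) * heatSymbol μ χ s x) (-1)
    (hN.mul (hc s hs)), functionOf_mul hK hN (hc s hs),
    ← shiftOp_eq hK, neg_one_smul] at this

theorem functionOf_mul_heatSymbol_time_zero (hK : IsNonnegOp K) :
    functionOf K (fun x => x * heatSymbol μ χ 0 x) = K := by
  simp only [mul_heatSymbol_time_zero]
  exact functionOf_id hK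

theorem continuousWithinAt_mul_heatOp (hK : IsNonnegOp K) (hμ : 0 < μ) (hχ : 0 ≤ χ) :
    ContinuousWithinAt (fun s => functionOf K (fun x => x * heatSymbol μ χ s x)) (Ici 0) 0 := by
  rw [ContinuousWithinAt, functionOf_mul_heatSymbol_time_zero hK, tendsto_iff_norm_sub_tendsto_zero]
  have hlim : Tendsto (fun s : ℝ => s * (μ + χ * ‖K‖)) (𝓝[≥] 0) (𝓝 0) := by
    have : Continuous fun s : ℝ => s * (μ + χ * ‖K‖) := by fun_prop
    simpa using (this.tendsto 0).mono_left nhdsWithin_le_nhds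
  refine squeeze_zero' (Eventually.of_forall fun _ => norm_nonneg _) ?_ hlim
  filter_upwards [self_mem_nhdsWithin] with s hs
  rcases (mem_Ici.1 hs).eq_or_lt with rfl | hs
  · simp [functionOf_mul_heatSymbol_time_zero hK]
  · rw [← mul_heatOp hK hμ hs]
    exact norm_mul_heatOp_sub_le hK hμ hχ hs

theorem integrableOn_shiftOp_mul_heatOp (hK : IsNonnegOp K) (hμ : 0 < μ) (hχ : 0 ≤ χ) :
    IntegrableOn (fun s => shiftOp K μ χ * heatOp K μ χ s) (Ioi 0) :=
  ((ContinuousLinearMap.mul ℝ (H →L[ℝ] H)) (shiftOp K μ χ)).integrable_comp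
    (integrableOn_heatOp hK hμ hχ)

/-- The derivative of `K e^{-s(μA+χ)}` is `-(μ + χK) e^{-s(μA+χ)}`; integrate it from the value `K`
at `s = 0` to the limit `0` at infinity. This is `(μA+χ) ∫ e^{-s(μA+χ)} ds = 1`, multiplied by `K`
to avoid the unbounded operator. -/
theorem shiftOp_mul_integral_heatOp (hK : IsNonnegOp K) (hμ : 0 < μ) (hχ : 0 ≤ χ) :
    shiftOp K μ χ * ∫ s in Ioi 0, heatOp K μ χ s = K := by
  have h1 : ∫ s in Ioi 0, shiftOp K μ χ * heatOp K μ χ s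
      = shiftOp K μ χ * ∫ s in Ioi 0, heatOp K μ χ s :=
    ((ContinuousLinearMap.mul ℝ (H →L[ℝ] H)) (shiftOp K μ χ)).integral_comp_comm
      (integrableOn_heatOp hK hμ hχ)
  have hk := isSingularKernel_heatOp (δ := 1) hK hμ hχ zero_lt_one
  obtain ⟨C, hC, h⟩ := hk.bound
  have hlim : Tendsto (fun s => functionOf K (fun x => x * heatSymbol μ χ s x)) atTop (𝓝 0) := by
    rw [tendsto_zero_iff_norm_tendsto_zero]
    have h2 : Tendsto (fun s : ℝ => ‖K‖ * (C * s ^ (-(1 + 1 : ℝ)))) atTop (𝓝 0) := by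
      simpa using ((tendsto_rpow_neg_atTop (show (0 : ℝ) < 1 + 1 by norm_num)).const_mul
        C).const_mul ‖K‖
    refine squeeze_zero' (Eventually.of_forall fun _ => norm_nonneg _) ?_ h2
    filter_upwards [Ioi_mem_atTop (0 : ℝ)] with s hs
    rw [← mul_heatOp hK hμ hs]
    refine (norm_mul_le _ _).trans ?_
    gcongr
    exact (h s hs).1
  have h3 := integral_Ioi_of_hasDerivAt_of_tendsto (continuousWithinAt_mul_heatOp hK hμ hχ)
    (fun s hs => hasDerivAt_mul_heatOp (χ := χ) hK hμ hs)
    (integrableOn_shiftOp_mul_heatOp hK hμ hχ).neg hlim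
  rw [functionOf_mul_heatSymbol_time_zero hK, integral_neg, zero_sub, neg_inj] at h3
  rw [← h1, h3]

theorem integral_shiftOp_mul_heatOp (hK : IsNonnegOp K) (hμ : 0 < μ) (hχ : 0 ≤ χ) {h : ℝ}
    (hh : 0 < h) :
    ∫ s in (0 : ℝ)..h, shiftOp K μ χ * heatOp K μ χ s = K - K * heatOp K μ χ h := by
  have hint : IntervalIntegrable (fun s => shiftOp K μ χ * heatOp K μ χ s) volume 0 h :=
    (intervalIntegrable_iff_integrableOn_Ioc_of_le hh.le).2
      ((integrableOn_shiftOp_mul_heatOp hK hμ hχ).mono_set fun s hs => hs.1)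
  have h3 := intervalIntegral.integral_eq_sub_of_hasDerivAt_of_le hh.le
    (f := fun s => functionOf K (fun x => x * heatSymbol μ χ s x)) (fun s hs => by
      rcases hs.1.eq_or_lt with rfl | hs'
      · exact (continuousWithinAt_mul_heatOp hK hμ hχ).mono fun s hs => hs.1
      · exact (hasDerivAt_mul_heatOp hK hμ hs').continuousAt.continuousWithinAt)
    (fun s hs => hasDerivAt_mul_heatOp (χ := χ) hK hμ hs.1) hint.neg
  rw [functionOf_mul_heatSymbol_time_zero hK, intervalIntegral.integral_neg,
    ← mul_heatOp hK hμ hh] at h3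
  rw [← neg_sub, ← h3, neg_neg]

theorem continuousOn_rpow_Icc (hδ : 0 < δ) {M : ℝ} :
    ContinuousOn (fun x : ℝ => x ^ δ) (Icc 0 M) :=
  (Real.continuous_rpow_const hδ.le).continuousOn

theorem rpow_mul_ouOp (hK : IsNonnegOp K) (hμ : 0 < μ) (hδ : 0 < δ) {s : ℝ} (hs : 0 < s) :
    functionOf K (fun x => x ^ δ) * (K * ouOp K μ χ δ s) = shiftOp K μ χ * heatOp K μ χ s := by
  have hF : ContinuousOn (ouSymbol μ χ δ s) (Icc 0 ‖K‖) :=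
    ContinuousOn.slice_right (continuousOn_ouSymbol hμ hδ) (mem_Ioi.2 hs)
  have hN : ContinuousOn (fun x : ℝ => μ + χ * x) (Icc 0 ‖K‖) := by fun_prop
  have h1 : K * ouOp K μ χ δ s = functionOf K (fun x => x * ouSymbol μ χ δ s x) :=
    (functionOf_self_mul hK hF).symm
  rw [h1, ← functionOf_mul hK (continuousOn_rpow_Icc hδ) (continuousOn_self_mul hF), shiftOp_eq hK,
    heatOp, ← functionOf_mul hK hN (continuousOn_heatSymbol_slice hμ hs)]
  exact functionOf_congr hK ((continuousOn_rpow_Icc hδ).mul (continuousOn_self_mul hF))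
    fun x hx => rpow_mul_ouSymbol hδ hx.1

theorem integrableOn_heatOp_apply (hK : IsNonnegOp K) (hμ : 0 < μ) (hχ : 0 ≤ χ) (v : H) :
    IntegrableOn (fun s => heatOp K μ χ s v) (Ioi 0) :=
  (ContinuousLinearMap.apply ℝ H v).integrable_comp (integrableOn_heatOp hK hμ hχ)

theorem integral_heatOp_apply (hK : IsNonnegOp K) (hμ : 0 < μ) (hχ : 0 ≤ χ) (v : H) :
    ∫ s in Ioi 0, heatOp K μ χ s v = (∫ s in Ioi 0, heatOp K μ χ s) v :=
  (ContinuousLinearMap.apply ℝ H v).integral_comp_comm (integrableOn_heatOp hK hμ hχ)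

section Paths

variable (hK : IsNonnegOp K) (hμ : 0 < μ) (hχ : 0 ≤ χ) (hδ : 0 < δ) (hδξ : δ < ξ)
  (hξ : ξ < 1 / 2) (hη : HolderGrowth ξ η) (hc : Continuous η)
include hK hμ hχ hδ hδξ hξ hη hc

theorem integrableOn_heatConv (t : ℝ) :
    IntegrableOn (fun s => heatOp K μ χ s (η (t - s))) (Ioi 0) := by
  have h := (integrableOn_heatOp_apply hK hμ hχ (η t)).sub
    ((isSingularKernel_heatOp hK hμ hχ hδ).integrableOn hδξ hξ hδ hη hc t)
  refine h.congr (ae_of_all _ fun s => ?_)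
  simp

/-- Subtracting and adding `η(t)` reduces the convolution with the growing path to the integrals of
increments already estimated. -/
theorem heatConv_eq (t : ℝ) : heatConv K μ χ η t = (∫ s in Ioi 0, heatOp K μ χ s) (η t)
    - ∫ s in Ioi 0, heatOp K μ χ s (η t - η (t - s)) := by
  rw [← integral_heatOp_apply hK hμ hχ, ← integral_sub (integrableOn_heatOp_apply hK hμ hχ _)
    ((isSingularKernel_heatOp hK hμ hχ hδ).integrableOn hδξ hξ hδ hη hc t), heatConv]
  simp

theorem continuous_heatConv : Continuous (heatConv K μ χ η) := by
  have h1 := (isSingularKernel_heatOp hK hμ hχ hδ).continuous_integral hδξ hξ hδ hη hc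
  have : heatConv K μ χ η = fun t => (∫ s in Ioi 0, heatOp K μ χ s) (η t)
      - ∫ s in Ioi 0, heatOp K μ χ s (η t - η (t - s)) :=
    funext (heatConv_eq hK hμ hχ hδ hδξ hξ hη hc)
  rw [this]
  fun_prop

theorem continuous_ouConv : Continuous (ouConv K μ χ δ η) :=
  (isSingularKernel_ouOp hK hμ hχ hδ).continuous_integral hδξ hξ hδ hη hc

/-- This is `A^{-δ}Υ = η - (μA+χ)y`, multiplied by `K`: the power `A^{-δ}` cancels `A^δ` in the
kernel, and the term with `η(t)` is integrated explicitly by `shiftOp_mul_integral_heatOp`. -/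
theorem rpow_mul_ouConv (t : ℝ) :
    functionOf K (fun x => x ^ δ) (K (ouConv K μ χ δ η t))
      = K (η t) - shiftOp K μ χ (heatConv K μ χ η t) := by
  have hi := (isSingularKernel_ouOp hK hμ hχ hδ).integrableOn hδξ hξ hδ hη hc t
  have hi' := (isSingularKernel_heatOp hK hμ hχ hδ).integrableOn hδξ hξ hδ hη hc t
  have h1 : functionOf K (fun x => x ^ δ) (K (ouConv K μ χ δ η t))
      = ∫ s in Ioi 0, (functionOf K (fun x => x ^ δ) * K) (ouOp K μ χ δ s (η t - η (t - s))) :=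
    ((functionOf K (fun x => x ^ δ) * K).integral_comp_comm hi).symm
  have h2 : ∫ s in Ioi 0, (functionOf K (fun x => x ^ δ) * K) (ouOp K μ χ δ s (η t - η (t - s)))
      = ∫ s in Ioi 0, shiftOp K μ χ (heatOp K μ χ s (η t - η (t - s))) := by
    refine setIntegral_congr_fun measurableSet_Ioi fun s hs => ?_
    exact congrArg (fun S : H →L[ℝ] H => S (η t - η (t - s))) (rpow_mul_ouOp hK hμ hδ hs)
  have h3 : shiftOp K μ χ ((∫ s in Ioi 0, heatOp K μ χ s) (η t)) = K (η t) :=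
    congrArg (fun S : H →L[ℝ] H => S (η t)) (shiftOp_mul_integral_heatOp hK hμ hχ)
  rw [h1, h2, (shiftOp K μ χ).integral_comp_comm hi', heatConv_eq hK hμ hχ hδ hδξ hξ hη hc, map_sub,
    h3, sub_sub_cancel]

/-- The integral is cut at `s = h`, and on `s > h` the semigroup law takes `e^{-h(μA+χ)}` out. -/
theorem heatConv_add (t : ℝ) {h : ℝ} (hh : 0 < h) : heatConv K μ χ η (t + h)
    = (∫ s in (0 : ℝ)..h, heatOp K μ χ s (η (t + h - s))) + heatOp K μ χ h (heatConv K μ χ η t) := by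
  have hi := integrableOn_heatConv hK hμ hχ hδ hδξ hξ hη hc (t + h)
  have hi' := integrableOn_heatConv hK hμ hχ hδ hδξ hξ hη hc t
  have h1 : ∫ s in Ioi h, heatOp K μ χ s (η (t + h - s))
      = ∫ s in Ioi 0, heatOp K μ χ (h + s) (η (t - s)) := by
    have := (measurePreserving_add_left volume h).setIntegral_preimage_emb
      (measurableEmbedding_addLeft h) (fun s => heatOp K μ χ s (η (t + h - s))) (Ioi h)
    rw [← this]
    have hp : (fun s : ℝ => h + s) ⁻¹' Ioi h = Ioi 0 := by ext s; simp
    rw [hp]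
    refine setIntegral_congr_fun measurableSet_Ioi fun s _ => ?_
    congr 2; ring
  have h2 : ∫ s in Ioi 0, heatOp K μ χ (h + s) (η (t - s))
      = heatOp K μ χ h (heatConv K μ χ η t) := by
    rw [heatConv, ← (heatOp K μ χ h).integral_comp_comm hi']
    refine setIntegral_congr_fun measurableSet_Ioi fun s hs => ?_
    change heatOp K μ χ (h + s) (η (t - s)) = (heatOp K μ χ h * heatOp K μ χ s) (η (t - s))
    rw [heatOp_add hK hμ hs hh]
  rw [← h2, ← h1, heatConv, intervalIntegral.integral_of_le hh.le,
    ← setIntegral_union (Ioc_disjoint_Ioi le_rfl) measurableSet_Ioi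
      (hi.mono_set Ioc_subset_Ioi_self) (hi.mono_set (Ioi_subset_Ioi hh.le)),
    Ioc_union_Ioi_eq_Ioi hh.le]

theorem mul_heatConv_sub (t : ℝ) {h : ℝ} (hh : 0 < h) :
    K (heatConv K μ χ η (t + h)) - K (heatConv K μ χ η t)
      = ∫ s in (0 : ℝ)..h, (K (heatOp K μ χ s (η (t + h - s)))
          - shiftOp K μ χ (heatOp K μ χ s (heatConv K μ χ η t))) := by
  have hi : IntervalIntegrable (fun s => heatOp K μ χ s (η (t + h - s))) volume 0 h :=
    (intervalIntegrable_iff_integrableOn_Ioc_of_le hh.le).2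
      ((integrableOn_heatConv hK hμ hχ hδ hδξ hξ hη hc (t + h)).mono_set fun s hs => hs.1)
  have hi2 : IntervalIntegrable (fun s => shiftOp K μ χ * heatOp K μ χ s) volume 0 h :=
    (intervalIntegrable_iff_integrableOn_Ioc_of_le hh.le).2
      ((integrableOn_shiftOp_mul_heatOp hK hμ hχ).mono_set fun s hs => hs.1)
  set v := heatConv K μ χ η t with hv
  have hKi : IntervalIntegrable (fun s => K (heatOp K μ χ s (η (t + h - s)))) volume 0 h :=
    ⟨K.integrable_comp hi.1, K.integrable_comp hi.2⟩
  have hNi : IntervalIntegrable (fun s => shiftOp K μ χ (heatOp K μ χ s v)) volume 0 h :=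
    ⟨(ContinuousLinearMap.apply ℝ H v).integrable_comp hi2.1,
      (ContinuousLinearMap.apply ℝ H v).integrable_comp hi2.2⟩
  have h3 : ∫ s in (0 : ℝ)..h, shiftOp K μ χ (heatOp K μ χ s v)
      = K v - K (heatOp K μ χ h v) := by
    have := (ContinuousLinearMap.apply ℝ H v).intervalIntegral_comp_comm hi2
    rw [integral_shiftOp_mul_heatOp hK hμ hχ hh] at this
    exact this
  rw [intervalIntegral.integral_sub hKi hNi, h3, K.intervalIntegral_comp_comm hi,
    heatConv_add hK hμ hχ hδ hδξ hξ hη hc t hh, map_add]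
  abel

/-- This is `y' = η - (μA+χ)y = A^{-δ}Υ`, multiplied by `K²`. One factor `K` replaces the unbounded
`μA + χ` by `μ + χK`, the other makes the semigroup norm continuous at time `0`. The splitting of
`y(t + h)` yields a right derivative, which suffices for the fundamental theorem of calculus. -/
theorem hasDerivWithinAt_heatConv (t : ℝ) :
    HasDerivWithinAt (fun t => K (K (heatConv K μ χ η t)))
      (K (functionOf K (fun x => x ^ δ) (K (ouConv K μ χ δ η t)))) (Ioi t) t := by
  have hcomm : ∀ s, 0 < s → ∀ v, K (shiftOp K μ χ (heatOp K μ χ s v))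
      = shiftOp K μ χ ((K * heatOp K μ χ s) v) := fun s _ v => by
    simp [shiftOp]
  rw [rpow_mul_ouConv hK hμ hχ hδ hδξ hξ hη hc, hasDerivWithinAt_iff_isLittleO,
    Asymptotics.isLittleO_iff]
  intro ε hε
  set y := heatConv K μ χ η with hy
  set N := shiftOp K μ χ with hN
  -- The error has two halves: replacing `K e^{-s(μA+χ)}` by `K` costs at most `h B`, and the
  -- oscillation of `η` is controlled by the radius `r`.
  set B := ‖K‖ * (μ + χ * ‖K‖) * (‖η t‖ + 1) + ‖N‖ * (μ + χ * ‖K‖) * ‖y t‖ with hB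
  have hB0 : 0 ≤ B := by positivity
  have hKK : 0 < ‖K‖ * ‖K‖ + 1 := by positivity
  obtain ⟨r, hr, hηr⟩ := Metric.continuousAt_iff.1 (hc.continuousAt (x := t))
    (min 1 (ε / 2 / (‖K‖ * ‖K‖ + 1))) (by positivity)
  have hr2 : 0 < min r (ε / 2 / (B + 1)) := by positivity
  filter_upwards [self_mem_nhdsWithin, mem_nhdsWithin_of_mem_nhds (Metric.ball_mem_nhds t hr2)]
    with p hp hpr
  obtain ⟨h, rfl⟩ : ∃ h, p = t + h := ⟨p - t, by ring⟩
  have hh : 0 < h := by simpa using hp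
  rw [Metric.mem_ball, Real.dist_eq, add_sub_cancel_left, abs_of_pos hh, lt_min_iff] at hpr
  have hi1 : IntervalIntegrable (fun s => heatOp K μ χ s (η (t + h - s))) volume 0 h :=
    (intervalIntegrable_iff_integrableOn_Ioc_of_le hh.le).2
      ((integrableOn_heatConv hK hμ hχ hδ hδξ hξ hη hc (t + h)).mono_set fun s hs => hs.1)
  have hi2 : IntervalIntegrable (fun s => heatOp K μ χ s (y t)) volume 0 h :=
    (intervalIntegrable_iff_integrableOn_Ioc_of_le hh.le).2
      ((integrableOn_heatOp_apply hK hμ hχ (y t)).mono_set fun s hs => hs.1)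
  have hi : IntervalIntegrable (fun s => K (heatOp K μ χ s (η (t + h - s)))
      - N (heatOp K μ χ s (y t))) volume 0 h :=
    ⟨(K.integrable_comp hi1.1).sub (N.integrable_comp hi2.1),
      (K.integrable_comp hi1.2).sub (N.integrable_comp hi2.2)⟩
  have hKi : IntervalIntegrable (fun s => K (K (heatOp K μ χ s (η (t + h - s)))
      - N (heatOp K μ χ s (y t)))) volume 0 h :=
    ⟨K.integrable_comp hi.1, K.integrable_comp hi.2⟩
  rw [add_sub_cancel_left, ← map_sub, mul_heatConv_sub hK hμ hχ hδ hδξ hξ hη hc t hh,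
    ← K.intervalIntegral_comp_comm hi]
  have hconst : h • K (K (η t) - N (y t)) = ∫ _ in (0 : ℝ)..h, K (K (η t) - N (y t)) := by
    rw [intervalIntegral.integral_const, sub_zero]
  rw [hconst, ← intervalIntegral.integral_sub hKi intervalIntegrable_const]
  have hbound : ∀ s ∈ Set.uIoc 0 h, ‖K (K (heatOp K μ χ s (η (t + h - s)))
      - N (heatOp K μ χ s (y t))) - K (K (η t) - N (y t))‖ ≤ ε := by
    intro s hs
    rw [uIoc_of_le hh.le] at hs
    have hs0 := hs.1
    have hE := norm_mul_heatOp_sub_le hK hμ hχ hs0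
    have hd : ‖η (t + h - s) - η t‖ < min 1 (ε / 2 / (‖K‖ * ‖K‖ + 1)) := by
      rw [← dist_eq_norm]
      refine hηr ?_
      rw [Real.dist_eq, abs_lt]
      constructor <;> linarith [hs.2, hpr.1]
    rw [lt_min_iff] at hd
    have hE1 : ‖(K * heatOp K μ χ s - K)‖ ≤ h * (μ + χ * ‖K‖) :=
      hE.trans (by gcongr; exact hs.2)
    have hn : ‖η (t + h - s)‖ ≤ ‖η t‖ + 1 := by
      have := norm_sub_norm_le (η (t + h - s)) (η t)
      linarith [hd.1]
    have e : K (K (heatOp K μ χ s (η (t + h - s))) - N (heatOp K μ χ s (y t)))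
        - K (K (η t) - N (y t)) = K ((K * heatOp K μ χ s - K) (η (t + h - s)))
          + (K * K) (η (t + h - s) - η t) - N ((K * heatOp K μ χ s - K) (y t)) := by
      have h1 : K (N (y t)) = N (K (y t)) := by simp [hN, shiftOp]
      have h2 : ∀ v, (K * heatOp K μ χ s) v = K (heatOp K μ χ s v) := fun v => rfl
      have h3 : ∀ v, (K * K) v = K (K v) := fun v => rfl
      generalize η (t + h - s) = z
      simp only [map_sub, hcomm s hs0, h1, h2, h3, _root_.sub_apply]
      abel
    rw [e]
    have k1 : ‖K ((K * heatOp K μ χ s - K) (η (t + h - s)))‖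
        ≤ ‖K‖ * (h * (μ + χ * ‖K‖) * (‖η t‖ + 1)) := by
      refine (K.le_opNorm _).trans ?_
      gcongr
      refine (ContinuousLinearMap.le_opNorm _ _).trans ?_
      gcongr
    have k2 : ‖(K * K) (η (t + h - s) - η t)‖ ≤ ε / 2 := by
      refine ((K * K).le_opNorm _).trans ?_
      have h5 : ‖K * K‖ ≤ ‖K‖ * ‖K‖ + 1 := (norm_mul_le _ _).trans (by linarith)
      calc ‖K * K‖ * ‖η (t + h - s) - η t‖
          ≤ (‖K‖ * ‖K‖ + 1) * (ε / 2 / (‖K‖ * ‖K‖ + 1)) := by gcongr; exact hd.2.le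
        _ = ε / 2 := by field_simp
    have k3 : ‖N ((K * heatOp K μ χ s - K) (y t))‖ ≤ ‖N‖ * (h * (μ + χ * ‖K‖) * ‖y t‖) := by
      refine (N.le_opNorm _).trans ?_
      gcongr
      refine (ContinuousLinearMap.le_opNorm _ _).trans ?_
      gcongr
    have k4 : h * B ≤ ε / 2 := by
      have := hpr.2
      rw [lt_div_iff₀ (by positivity)] at this
      nlinarith
    refine (norm_sub_le _ _).trans ?_
    refine (add_le_add ((norm_add_le _ _).trans (add_le_add k1 k2)) k3).trans ?_
    have : ‖K‖ * (h * (μ + χ * ‖K‖) * (‖η t‖ + 1)) + ‖N‖ * (h * (μ + χ * ‖K‖) * ‖y t‖)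
        = h * B := by rw [hB]; ring
    linarith
  refine (intervalIntegral.norm_integral_le_of_norm_le_const hbound).trans (le_of_eq ?_)
  rw [sub_zero, Real.norm_eq_abs]

/-- Integrate `K² y' = K² A^{-δ} Υ` and cancel the two factors `K`. -/
theorem heatConv_sub (hinj : Function.Injective K) {t : ℝ} (ht : 0 ≤ t) :
    heatConv K μ χ η t - heatConv K μ χ η 0
      = functionOf K (fun x => x ^ δ) (∫ s in (0 : ℝ)..t, ouConv K μ χ δ η s) := by
  have hy := continuous_heatConv hK hμ hχ hδ hδξ hξ hη hc
  have hU := continuous_ouConv hK hμ hχ hδ hδξ hξ hη hc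
  have h1 := intervalIntegral.integral_eq_sub_of_hasDeriv_right_of_le ht
    (f := fun t => K (K (heatConv K μ χ η t))) (by fun_prop)
    (fun s _ => hasDerivWithinAt_heatConv hK hμ hχ hδ hδξ hξ hη hc s)
    (Continuous.intervalIntegrable (by fun_prop) _ _)
  have h2 := (K * functionOf K (fun x => x ^ δ) * K).intervalIntegral_comp_comm
    (hU.intervalIntegrable (μ := volume) 0 t)
  have hcomm := functionOf_mul_comm hK (continuousOn_rpow_Icc (M := ‖K‖) hδ)
  have h3 : (K * functionOf K (fun x => x ^ δ) * K) (∫ s in (0 : ℝ)..t, ouConv K μ χ δ η s)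
      = K (K (functionOf K (fun x => x ^ δ) (∫ s in (0 : ℝ)..t, ouConv K μ χ δ η s))) := by
    rw [mul_assoc, hcomm]; rfl
  rw [h3] at h2
  rw [← map_sub, ← map_sub] at h1
  exact hinj (hinj (h1.symm.trans h2))

/-- The Ornstein-Uhlenbeck equation, smoothed by `A^{-(1+δ)}`. -/
theorem ouConv_equation (hinj : Function.Injective K) {t : ℝ} (ht : 0 ≤ t) :
    functionOf K (fun x => x ^ δ) (K (ouConv K μ χ δ η t - ouConv K μ χ δ η 0)
      + shiftOp K μ χ (∫ s in (0 : ℝ)..t, ouConv K μ χ δ η s)) = K (η t - η 0) := by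
  have hN : ContinuousOn (fun x : ℝ => μ + χ * x) (Icc 0 ‖K‖) := by fun_prop
  have hcomm : functionOf K (fun x => x ^ δ) * shiftOp K μ χ
      = shiftOp K μ χ * functionOf K (fun x => x ^ δ) := by
    rw [shiftOp_eq hK, ← functionOf_mul hK (continuousOn_rpow_Icc hδ) hN,
      ← functionOf_mul hK hN (continuousOn_rpow_Icc hδ)]
    simp only [mul_comm]
  have h1 : ∀ v, functionOf K (fun x => x ^ δ) (shiftOp K μ χ v)
      = shiftOp K μ χ (functionOf K (fun x => x ^ δ) v) :=
    fun v => congrArg (fun S : H →L[ℝ] H => S v) hcomm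
  rw [map_add, h1, ← heatConv_sub hK hμ hχ hδ hδξ hξ hη hc hinj ht, map_sub, map_sub, map_sub,
    map_sub, rpow_mul_ouConv hK hμ hχ hδ hδξ hξ hη hc, rpow_mul_ouConv hK hμ hχ hδ hδξ hξ hη hc]
  abel

end Paths

/-- `K = K^{1-δ} K^δ`, so the kernel of `K^δ` lies in that of `K`. -/
theorem injective_rpow (hK : IsNonnegOp K) (hinj : Function.Injective K) (hδ : 0 < δ)
    (hδ1 : δ < 1) : Function.Injective (functionOf K (fun x => x ^ δ)) := by
  refine (injective_iff_map_eq_zero _).2 fun v hv => hinj ?_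
  have h1 : K = functionOf K (fun x => x ^ (1 - δ)) * functionOf K (fun x => x ^ δ) := by
    rw [← functionOf_mul hK (continuousOn_rpow_Icc (by linarith)) (continuousOn_rpow_Icc hδ)]
    conv_lhs => rw [← functionOf_id hK]
    refine functionOf_congr hK continuousOn_id fun x hx => ?_
    rcases hx.1.eq_or_lt with rfl | hx
    · rw [Real.zero_rpow hδ.ne', mul_zero]
    · rw [← Real.rpow_add hx]; simp
  rw [h1, map_zero]
  change functionOf K (fun x => x ^ (1 - δ)) (functionOf K (fun x => x ^ δ) v) = 0
  rw [hv, map_zero]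

/-- The difference of two Ornstein-Uhlenbeck paths has values in the domain of `A`, and solves
a linear equation in `H`. -/
theorem exists_ouConv_sub (hK : IsNonnegOp K) (hinj : Function.Injective K) {χ₁ χ₂ : ℝ}
    (hμ : 0 < μ) (hχ₁ : 0 ≤ χ₁) (hχ₂ : 0 ≤ χ₂) (hδ : 0 < δ) (hδξ : δ < ξ)
    (hξ : ξ < 1 / 2) (hη : HolderGrowth ξ η) (hc : Continuous η) :
    ∃ G : ℝ → H, Continuous G ∧
      (∀ t, ouConv K μ χ₁ δ η t - ouConv K μ χ₂ δ η t = K (G t)) ∧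
      ∀ t, 0 ≤ t → (ouConv K μ χ₁ δ η t - ouConv K μ χ₂ δ η t)
        = (ouConv K μ χ₁ δ η 0 - ouConv K μ χ₂ δ η 0)
          + ∫ s in (0 : ℝ)..t,
            (χ₂ • ouConv K μ χ₂ δ η s - χ₁ • ouConv K μ χ₁ δ η s - μ • G s) := by
  have hk : IsSingularKernel δ fun s => functionOf K (ouDiffSymbol μ χ₁ χ₂ δ s) :=
    isSingularKernel_functionOf hK (continuousOn_ouDiffSymbol hμ hδ) fun _ hb =>
      exists_abs_ouDiffSymbol_le hμ hχ₁ hχ₂ hδ (norm_nonneg _) hb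
  have hU₁ := continuous_ouConv hK hμ hχ₁ hδ hδξ hξ hη hc
  have hU₂ := continuous_ouConv hK hμ hχ₂ hδ hδξ hξ hη hc
  -- `G` is `A(Υ₁ - Υ₂)`, defined through the kernel of the difference since neither path need lie
  -- in the domain of `A`.
  set G : ℝ → H := fun t => ∫ s in Ioi 0,
    functionOf K (ouDiffSymbol μ χ₁ χ₂ δ s) (η t - η (t - s)) with hG
  have hGc : Continuous G := hk.continuous_integral hδξ hξ hδ hη hc
  have hKG : ∀ t, ouConv K μ χ₁ δ η t - ouConv K μ χ₂ δ η t = K (G t) := by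
    intro t
    have i1 := (isSingularKernel_ouOp hK hμ hχ₁ hδ).integrableOn hδξ hξ hδ hη hc t
    have i2 := (isSingularKernel_ouOp hK hμ hχ₂ hδ).integrableOn hδξ hξ hδ hη hc t
    rw [hG, ← K.integral_comp_comm (hk.integrableOn hδξ hξ hδ hη hc t), ouConv, ouConv,
      ← integral_sub i1 i2]
    refine setIntegral_congr_fun measurableSet_Ioi fun s hs => ?_
    have c1 : ContinuousOn (ouSymbol μ χ₁ δ s) (Icc 0 ‖K‖) :=
      ContinuousOn.slice_right (continuousOn_ouSymbol hμ hδ) hs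
    have c2 : ContinuousOn (ouSymbol μ χ₂ δ s) (Icc 0 ‖K‖) :=
      ContinuousOn.slice_right (continuousOn_ouSymbol hμ hδ) hs
    have c3 : ContinuousOn (ouDiffSymbol μ χ₁ χ₂ δ s) (Icc 0 ‖K‖) :=
      ContinuousOn.slice_right (continuousOn_ouDiffSymbol hμ hδ) hs
    have h : ouOp K μ χ₁ δ s - ouOp K μ χ₂ δ s
        = K * functionOf K (ouDiffSymbol μ χ₁ χ₂ δ s) := by
      rw [ouOp, ouOp, ← functionOf_sub hK c1 c2, ← functionOf_self_mul hK c3]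
      exact (functionOf_congr hK (continuousOn_self_mul c3)
        fun x hx => mul_ouDiffSymbol hδ hx.1).symm
    exact congrArg (fun S : H →L[ℝ] H => S (η t - η (t - s))) h
  refine ⟨G, hGc, hKG, fun t ht => ?_⟩
  -- Both equations have the same noise increment on the right, so they can be equated. Injectivity
  -- of `K^δ` removes the fractional smoothing; writing `∫ (Υ₁ - Υ₂) = K ∫ G` then makes every term
  -- a multiple of `K`, which is cancelled too.
  have e1 := ouConv_equation hK hμ hχ₁ hδ hδξ hξ hη hc hinj ht
  have e2 := ouConv_equation hK hμ hχ₂ hδ hδξ hξ hη hc hinj ht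
  have e3 := injective_rpow hK hinj hδ (by linarith) (e1.trans e2.symm)
  set U₁ := ouConv K μ χ₁ δ η
  set U₂ := ouConv K μ χ₂ δ η
  have hi₁ := hU₁.intervalIntegrable (μ := volume) 0 t
  have hi₂ := hU₂.intervalIntegrable (μ := volume) 0 t
  have hiG := hGc.intervalIntegrable (μ := volume) 0 t
  have e4 : (∫ s in (0 : ℝ)..t, U₁ s) - ∫ s in (0 : ℝ)..t, U₂ s = K (∫ s in (0 : ℝ)..t, G s) := by
    rw [← intervalIntegral.integral_sub hi₁ hi₂, ← K.intervalIntegral_comp_comm hiG]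
    exact intervalIntegral.integral_congr fun s _ => hKG s
  have e0 : ∫ s in (0 : ℝ)..t, (χ₂ • U₂ s - χ₁ • U₁ s - μ • G s)
      = χ₂ • (∫ s in (0 : ℝ)..t, U₂ s) - χ₁ • (∫ s in (0 : ℝ)..t, U₁ s)
        - μ • ∫ s in (0 : ℝ)..t, G s := by
    rw [intervalIntegral.integral_sub, intervalIntegral.integral_sub,
      intervalIntegral.integral_smul, intervalIntegral.integral_smul,
      intervalIntegral.integral_smul]
    all_goals exact Continuous.intervalIntegrable (by fun_prop) _ _
  rw [e0]
  set J₁ := ∫ s in (0 : ℝ)..t, U₁ s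
  set J₂ := ∫ s in (0 : ℝ)..t, U₂ s
  set JG := ∫ s in (0 : ℝ)..t, G s
  refine hinj ?_

  simp only [shiftOp, _root_.add_apply, _root_.smul_apply, one_apply_eq_self,
    map_sub] at e3
  simp only [map_add, map_sub, map_smul]
  rw [← e4, smul_sub, ← sub_eq_zero]
  rw [← sub_eq_zero] at e3
  rw [← e3]
  abel

end OrnsteinUhlenbeck

end SCBF


namespace SCBF

section Shortcuts

variable {d : ℕ} {O : Set (Ed d)}

noncomputable scoped instance : NormedAddCommGroup (VSpace O) := inferInstance

noncomputable scoped instance : NormedSpace ℝ (VSpace O) := inferInstance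

noncomputable scoped instance : SeminormedAddCommGroup (VSpace O) := inferInstance

noncomputable scoped instance : AddCommGroup (VSpace O) := inferInstance

noncomputable scoped instance : AddCommMonoid (VSpace O) := inferInstance

noncomputable scoped instance : Module ℝ (VSpace O) := inferInstance

noncomputable scoped instance : TopologicalSpace (VSpace O) := inferInstance

noncomputable scoped instance {r : ℝ} : NormedAddCommGroup (WSpace O r) := inferInstance

noncomputable scoped instance {r : ℝ} : NormedSpace ℝ (WSpace O r) := inferInstance

noncomputable scoped instance {r : ℝ} : SeminormedAddCommGroup (WSpace O r) := inferInstance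

noncomputable scoped instance {r : ℝ} : AddCommGroup (WSpace O r) := inferInstance

noncomputable scoped instance {r : ℝ} : AddCommMonoid (WSpace O r) := inferInstance

noncomputable scoped instance {r : ℝ} : Module ℝ (WSpace O r) := inferInstance

noncomputable scoped instance {r : ℝ} : TopologicalSpace (WSpace O r) := inferInstance

end Shortcuts

/-! ### Test fields, their closures and the Poincaré inequality. -/

section TestFields

variable {d : ℕ} {O : Set (Ed d)}

/-- The linear map from derivatives to values of gradients. -/
noncomputable def gradCLM (d : ℕ) : (Ed d →L[ℝ] Ed d) →L[ℝ] GradVal d :=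
  (PiLp.continuousLinearEquiv 2 ℝ (fun _ : Fin d => Ed d)).symm.toContinuousLinearMap ∘L
    ContinuousLinearMap.pi fun i =>
      ContinuousLinearMap.apply ℝ (Ed d) (EuclideanSpace.single i (1 : ℝ))

theorem gradField_eq (φ : Ed d → Ed d) (x : Ed d) : gradField φ x = gradCLM d (fderiv ℝ φ x) := rfl

theorem IsSmoothCompact.differentiable {φ : Ed d → Ed d} (h : IsSmoothCompact O φ) :
    Differentiable ℝ φ := h.smooth.differentiable (by simp)

theorem gradField_add {φ ψ : Ed d → Ed d} (hφ : Differentiable ℝ φ) (hψ : Differentiable ℝ ψ) :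
    gradField (φ + ψ) = gradField φ + gradField ψ := by
  ext1 x
  rw [Pi.add_apply, gradField_eq, gradField_eq, gradField_eq, fderiv_add (hφ x) (hψ x), map_add]

theorem gradField_smul (c : ℝ) {φ : Ed d → Ed d} (hφ : Differentiable ℝ φ) :
    gradField (c • φ) = c • gradField φ := by
  ext1 x
  rw [Pi.smul_apply, gradField_eq, gradField_eq, fderiv_const_smul (hφ x), map_smul]

theorem IsTestField.zero : IsTestField O (0 : Ed d → Ed d) where
  smooth := contDiff_const
  compact := HasCompactSupport.zero
  support := by simp [tsupport]
  div_free x := by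
    have : fderiv ℝ (0 : Ed d → Ed d) x = 0 := by
      change fderiv ℝ (fun _ => (0 : Ed d)) x = 0
      simp
    simp [divField, gradField_eq, this]

theorem IsTestField.add {φ ψ : Ed d → Ed d} (hφ : IsTestField O φ) (hψ : IsTestField O ψ) :
    IsTestField O (φ + ψ) where
  smooth := hφ.smooth.add hψ.smooth
  compact := hφ.compact.add hψ.compact
  support := (tsupport_add φ ψ).trans (union_subset hφ.support hψ.support)
  div_free x := by
    have h1 := hφ.div_free x
    have h2 := hψ.div_free x
    simp only [divField] at h1 h2 ⊢
    rw [gradField_add hφ.differentiable hψ.differentiable]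
    simp [Finset.sum_add_distrib, h1, h2]

theorem IsTestField.smul (c : ℝ) {φ : Ed d → Ed d} (hφ : IsTestField O φ) :
    IsTestField O (c • φ) where
  smooth := contDiff_const.smul hφ.smooth
  compact := hφ.compact.smul_left
  support := (closure_mono (Function.support_const_smul_subset c φ)).trans hφ.support
  div_free x := by
    have h1 := hφ.div_free x
    simp only [divField] at h1 ⊢
    rw [gradField_smul c hφ.differentiable]
    simp [← Finset.mul_sum, h1]

theorem IsSmoothCompact.continuous_gradField {φ : Ed d → Ed d} (h : IsSmoothCompact O φ) :
    Continuous (gradField φ) :=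
  (gradCLM d).continuous.comp (h.smooth.continuous_fderiv (by simp))

theorem IsSmoothCompact.hasCompactSupport_gradField {φ : Ed d → Ed d} (h : IsSmoothCompact O φ) :
    HasCompactSupport (gradField φ) :=
  (h.compact.fderiv (𝕜 := ℝ)).comp_left (g := gradCLM d) (map_zero _)

theorem IsSmoothCompact.memLp {φ : Ed d → Ed d} (h : IsSmoothCompact O φ) (p : ℝ≥0∞) :
    MemLp φ p (volume.restrict O) :=
  (h.smooth.continuous.memLp_of_hasCompactSupport h.compact).restrict O

theorem IsSmoothCompact.memLp_gradField {φ : Ed d → Ed d} (h : IsSmoothCompact O φ) (p : ℝ≥0∞) :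
    MemLp (gradField φ) p (volume.restrict O) :=
  (h.continuous_gradField.memLp_of_hasCompactSupport h.hasCompactSupport_gradField).restrict O

/-- `w` is the pair `(φ, ∇φ)`. -/
def IsPairOf (O : Set (Ed d)) (w : LpField O 2 × L2Grad O) (φ : Ed d → Ed d) : Prop :=
  w.1 =ᵐ[volume.restrict O] φ ∧ w.2 =ᵐ[volume.restrict O] gradField φ

/-- Test fields form a vector space, so the span in the definition of `𝕍` adds nothing and
approximating elements are themselves test fields. -/
theorem exists_of_mem_span {w : LpField O 2 × L2Grad O}
    (hw : w ∈ Submodule.span ℝ {w : LpField O 2 × L2Grad O | ∃ φ : Ed d → Ed d, IsTestField O φ ∧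
      w.1 =ᵐ[volume.restrict O] φ ∧ w.2 =ᵐ[volume.restrict O] gradField φ}) :
    ∃ φ, IsTestField O φ ∧ IsPairOf O w φ := by
  induction hw using Submodule.span_induction with
  | mem w h => exact h
  | zero =>
    refine ⟨0, IsTestField.zero, Lp.coeFn_zero _ _ _, ?_⟩
    have : gradField (0 : Ed d → Ed d) = 0 := by
      have := gradField_smul (0 : ℝ) (φ := (0 : Ed d → Ed d)) (differentiable_const _)
      simpa using this
    rw [this]
    exact Lp.coeFn_zero _ _ _
  | add a b _ _ ha hb =>
    obtain ⟨φ, hφ, h1, h2⟩ := ha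
    obtain ⟨ψ, hψ, h3, h4⟩ := hb
    refine ⟨φ + ψ, hφ.add hψ, (Lp.coeFn_add a.1 b.1).trans (h1.add h3), ?_⟩
    rw [gradField_add hφ.differentiable hψ.differentiable]
    exact (Lp.coeFn_add a.2 b.2).trans (h2.add h4)
  | smul c a _ ha =>
    obtain ⟨φ, hφ, h1, h2⟩ := ha
    refine ⟨c • φ, hφ.smul c, (Lp.coeFn_smul c a.1).trans (h1.const_smul c), ?_⟩
    rw [gradField_smul c hφ.differentiable]
    exact (Lp.coeFn_smul c a.2).trans (h2.const_smul c)

/-- Every element of `𝕍` is a limit of test fields. -/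
theorem exists_seq_tendsto {w : LpField O 2 × L2Grad O} (hw : w ∈ VSpace O) :
    ∃ (W : ℕ → LpField O 2 × L2Grad O) (φ : ℕ → Ed d → Ed d),
      (∀ n, IsTestField O (φ n) ∧ IsPairOf O (W n) (φ n)) ∧ Tendsto W atTop (𝓝 w) := by
  have hw' : w ∈ closure (Submodule.span ℝ {w : LpField O 2 × L2Grad O |
      ∃ φ : Ed d → Ed d, IsTestField O φ ∧
      w.1 =ᵐ[volume.restrict O] φ ∧ w.2 =ᵐ[volume.restrict O] gradField φ} : Set _) := hw
  obtain ⟨W, hW, hlim⟩ := mem_closure_iff_seq_limit.1 hw'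
  choose φ hφ using fun n => exists_of_mem_span (hW n)
  exact ⟨W, φ, hφ, hlim⟩

/-- A closed condition which holds for test fields holds on `𝕍`. -/
theorem vSpace_induction {P : LpField O 2 × L2Grad O → Prop} (hc : IsClosed {w | P w})
    (h : ∀ w φ, IsTestField O φ → IsPairOf O w φ → P w) {w : LpField O 2 × L2Grad O}
    (hw : w ∈ VSpace O) : P w := by
  obtain ⟨W, φ, hW, hlim⟩ := exists_seq_tendsto hw
  exact hc.mem_of_tendsto hlim (Eventually.of_forall fun n => h _ _ (hW n).1 (hW n).2)

theorem mem_vSpace {w : LpField O 2 × L2Grad O} {φ : Ed d → Ed d} (hφ : IsTestField O φ)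
    (hw : IsPairOf O w φ) : w ∈ VSpace O :=
  subset_closure (Submodule.subset_span ⟨φ, hφ, hw⟩)

theorem mem_ltilde {p : ℝ≥0∞} [Fact (1 ≤ p)] {u : LpField O p} {φ : Ed d → Ed d}
    (hφ : IsTestField O φ) (hu : u =ᵐ[volume.restrict O] φ) : u ∈ Ltilde O p :=
  subset_closure (Submodule.subset_span ⟨φ, hφ, hu⟩)

/-- A closed linear condition which holds for test fields holds on `L̃ᵖ`. -/
theorem ltilde_le {p : ℝ≥0∞} [Fact (1 ≤ p)] {S : Submodule ℝ (LpField O p)}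
    (hc : IsClosed (S : Set (LpField O p)))
    (h : ∀ (u : LpField O p) (φ : Ed d → Ed d), IsTestField O φ → u =ᵐ[volume.restrict O] φ →
      u ∈ S) : Ltilde O p ≤ S :=
  Submodule.topologicalClosure_minimal _
    (Submodule.span_le.2 fun u ⟨φ, hφ, hu⟩ => h u φ hφ hu) hc

instance {p : ℝ≥0∞} [Fact (1 ≤ p)] : CompleteSpace (Ltilde O p) :=
  (Submodule.isClosed_topologicalClosure _).completeSpace_coe

theorem exists_pair {φ : Ed d → Ed d} (hφ : IsTestField O φ) :
    ∃ w : VSpace O, IsPairOf O w.1 φ := by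
  have h : IsPairOf O ((hφ.memLp 2).toLp φ, (hφ.memLp_gradField 2).toLp (gradField φ)) φ :=
    ⟨(hφ.memLp 2).coeFn_toLp, (hφ.memLp_gradField 2).coeFn_toLp⟩
  exact ⟨⟨_, mem_vSpace hφ h⟩, h⟩

theorem vField_mem (u : VSpace O) : vField u ∈ HSpace O :=
  vSpace_induction (P := fun w => w.1 ∈ HSpace O)
    ((Submodule.isClosed_topologicalClosure _).preimage continuous_fst)
    (fun _ _ hφ hw => mem_ltilde hφ hw.1) u.2

/-- The inclusion `𝕍 → ℍ`. -/
noncomputable def vToH (O : Set (Ed d)) : VSpace O →L[ℝ] HSpace O :=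
  ((ContinuousLinearMap.fst ℝ (LpField O 2) (L2Grad O)).comp (VSpace O).subtypeL).codRestrict
    (HSpace O) vField_mem

theorem coe_vToH (u : VSpace O) : (vToH O u : LpField O 2) = vField u := rfl

theorem norm_sq_eq_integral {E : Type*} [NormedAddCommGroup E] [InnerProductSpace ℝ E]
    {α : Type*} [MeasurableSpace α] {m : Measure α} (u : Lp E 2 m) :
    ‖u‖ ^ 2 = ∫ x, ‖u x‖ ^ 2 ∂m := by
  rw [← real_inner_self_eq_norm_sq, L2.inner_def]
  simp only [real_inner_self_eq_norm_sq]

theorem poincare (hP : PoincareDomain O) :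
    ∃ lam : ℝ, 0 < lam ∧ ∀ u : VSpace O, lam * ‖vField u‖ ^ 2 ≤ ‖vGrad u‖ ^ 2 := by
  obtain ⟨lam, hlam, h⟩ := hP
  refine ⟨lam, hlam, fun u => ?_⟩
  refine vSpace_induction (P := fun w => lam * ‖w.1‖ ^ 2 ≤ ‖w.2‖ ^ 2)
    (isClosed_le (by fun_prop) (by fun_prop)) (fun w φ hφ hw => ?_) u.2
  rw [norm_sq_eq_integral, norm_sq_eq_integral]
  have e1 : ∫ x in O, ‖w.1 x‖ ^ 2 = ∫ x in O, ‖φ x‖ ^ 2 :=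
    integral_congr_ae (hw.1.mono fun x hx => by simp only [hx])
  have e2 : ∫ x in O, ‖w.2 x‖ ^ 2 = ∫ x in O, ‖gradField φ x‖ ^ 2 :=
    integral_congr_ae (hw.2.mono fun x hx => by simp only [hx])
  rw [e1, e2]
  exact h φ hφ.toIsSmoothCompact

end TestFields

/-! ### The Stokes resolvent. -/

section Stokes

variable {d : ℕ} {O : Set (Ed d)} {μ χ : ℝ}

theorem vField_sub (u v : VSpace O) : vField (u - v) = vField u - vField v := rfl
theorem vGrad_sub (u v : VSpace O) : vGrad (u - v) = vGrad u - vGrad v := rfl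
theorem vField_add (u v : VSpace O) : vField (u + v) = vField u + vField v := rfl
theorem vGrad_add (u v : VSpace O) : vGrad (u + v) = vGrad u + vGrad v := rfl
theorem vField_smul (c : ℝ) (u : VSpace O) : vField (c • u) = c • vField u := rfl

theorem eq_zero_of_stokesForm (hP : PoincareDomain O) (hμ : 0 < μ) (hχ : 0 ≤ χ) {u : VSpace O}
    (h : μ * inner ℝ (vGrad u) (vGrad u) + χ * inner ℝ (vField u) (vField u) = 0) : u = 0 := by
  obtain ⟨lam, hlam, hp⟩ := poincare hP
  rw [real_inner_self_eq_norm_sq, real_inner_self_eq_norm_sq] at h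
  have h1 : 0 ≤ χ * ‖vField u‖ ^ 2 := by positivity
  have h2 : ‖vGrad u‖ ^ 2 = 0 := by
    have h3 : 0 ≤ μ * ‖vGrad u‖ ^ 2 := by positivity
    have h4 : μ * ‖vGrad u‖ ^ 2 = 0 := by linarith
    exact (mul_eq_zero.1 h4).resolve_left hμ.ne'
  have h3 : ‖vField u‖ ^ 2 = 0 := by
    have := hp u
    have h5 : 0 ≤ ‖vField u‖ ^ 2 := by positivity
    nlinarith
  refine Subtype.ext (Prod.ext ?_ ?_)
  · exact norm_eq_zero.1 (pow_eq_zero_iff two_ne_zero |>.1 h3)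
  · exact norm_eq_zero.1 (pow_eq_zero_iff two_ne_zero |>.1 h2)

/-- The Lax-Milgram theorem for the form `μ (y, y') + χ (x, x')` on a closed space of pairs
`(x, y)` of elements of two Hilbert spaces. -/
theorem exists_solution_of_form {X Y : Type*} [NormedAddCommGroup X] [InnerProductSpace ℝ X]
    [CompleteSpace X] [NormedAddCommGroup Y] [InnerProductSpace ℝ Y] [CompleteSpace Y]
    {V : Submodule ℝ (X × Y)} (hV : IsClosed (V : Set (X × Y))) (hμ : 0 < μ) (hχ : 0 ≤ χ)
    {lam : ℝ} (hlam : 0 < lam) (hp : ∀ w ∈ V, lam * ‖w.1‖ ^ 2 ≤ ‖w.2‖ ^ 2) :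
    ∃ S : X →L[ℝ] V, ∀ (h : X) (ψ : V), μ * inner ℝ (S h).1.2 ψ.1.2
      + χ * inner ℝ (S h).1.1 ψ.1.1 = inner ℝ h ψ.1.1 := by
  -- The product carries the maximum norm, which is not Hilbertian; Lax-Milgram is applied in the
  -- equivalent `ℓ²` product.
  let e := WithLp.prodContinuousLinearEquiv 2 ℝ X Y
  let V2 : Submodule ℝ (WithLp 2 (X × Y)) := V.comap e.toLinearEquiv.toLinearMap
  have hV2 : IsClosed (V2 : Set (WithLp 2 (X × Y))) := hV.preimage e.continuous
  have : CompleteSpace V2 := hV2.completeSpace_coe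
  let p₁ : V2 →L[ℝ] X := (ContinuousLinearMap.fst ℝ X Y).comp
    (e.toContinuousLinearMap.comp V2.subtypeL)
  let p₂ : V2 →L[ℝ] Y := (ContinuousLinearMap.snd ℝ X Y).comp
    (e.toContinuousLinearMap.comp V2.subtypeL)
  let B : V2 →L[ℝ] V2 →L[ℝ] ℝ := μ • (innerSL ℝ).bilinearComp p₂ p₂
    + χ • (innerSL ℝ).bilinearComp p₁ p₁
  have hB : ∀ u w, B u w = μ * inner ℝ (p₂ u) (p₂ w) + χ * inner ℝ (p₁ u) (p₁ w) := fun _ _ => rfl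
  let toV : V2 →L[ℝ] V := (e.toContinuousLinearMap.comp V2.subtypeL).codRestrict V fun u => u.2
  have hcoer : IsCoercive B := by
    -- By the Poincaré inequality the full squared norm is at most `(1 + 1/lam)` times that of the
    -- second component.
    refine ⟨μ / (1 + 1 / lam), by positivity, fun u => ?_⟩
    have h1 : ‖u‖ ^ 2 = ‖p₁ u‖ ^ 2 + ‖p₂ u‖ ^ 2 :=
      WithLp.prod_norm_sq_eq_of_L2 (α := X) (β := Y) u.1
    have h2 : lam * ‖p₁ u‖ ^ 2 ≤ ‖p₂ u‖ ^ 2 := hp _ (toV u).2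
    rw [hB, real_inner_self_eq_norm_sq, real_inner_self_eq_norm_sq, mul_assoc, ← pow_two, h1,
      div_mul_eq_mul_div, div_le_iff₀ (by positivity)]
    have h3 : ‖p₁ u‖ ^ 2 ≤ ‖p₂ u‖ ^ 2 / lam := by rw [le_div_iff₀ hlam]; linarith
    have h4 : 0 ≤ χ * ‖p₁ u‖ ^ 2 * (1 + 1 / lam) := by positivity
    have h5 : μ * ‖p₂ u‖ ^ 2 * (1 / lam) = μ * (‖p₂ u‖ ^ 2 / lam) := by ring
    nlinarith [mul_le_mul_of_nonneg_left h3 hμ.le]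
  let E := hcoer.continuousLinearEquivOfBilin
  let S2 : X →L[ℝ] V2 := E.symm.toContinuousLinearMap.comp (ContinuousLinearMap.adjoint p₁)
  refine ⟨toV.comp S2, fun h ψ => ?_⟩
  obtain ⟨w, rfl⟩ : ∃ w : V2, toV w = ψ :=
    ⟨⟨e.symm ψ.1, by simp [V2]⟩, Subtype.ext (e.apply_symm_apply ψ.1)⟩
  have h1 := hcoer.continuousLinearEquivOfBilin_apply (S2 h) w
  have h2 : E (S2 h) = ContinuousLinearMap.adjoint p₁ h := E.apply_symm_apply _
  change inner ℝ (E (S2 h)) w = _ at h1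
  rw [h2, ContinuousLinearMap.adjoint_inner_left, hB] at h1
  exact h1.symm

theorem exists_stokesSolution (hP : PoincareDomain O) (hμ : 0 < μ) (hχ : 0 ≤ χ) :
    ∃ S : HSpace O →L[ℝ] VSpace O, ∀ (h : HSpace O) (ψ : VSpace O),
      μ * inner ℝ (vGrad (S h)) (vGrad ψ) + χ * inner ℝ (vField (S h)) (vField ψ)
        = inner ℝ (h : LpField O 2) (vField ψ) := by
  obtain ⟨lam, hlam, hp⟩ := poincare hP
  obtain ⟨S, hS⟩ := exists_solution_of_form (V := VSpace O)
    (Submodule.isClosed_topologicalClosure _) hμ hχ hlam fun w hw => hp ⟨w, hw⟩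
  exact ⟨S.comp (HSpace O).subtypeL, fun h ψ => hS h ψ⟩

theorem exists_isInvStokes (hP : PoincareDomain O) (hμ : 0 < μ) (hχ : 0 ≤ χ) :
    ∃ T, IsInvStokes O μ χ T := by
  obtain ⟨S, hS⟩ := exists_stokesSolution hP hμ hχ
  exact ⟨(vToH O).comp S, fun h => ⟨S h, rfl, hS h⟩⟩

theorem isInvStokes_invStokes (hP : PoincareDomain O) (hμ : 0 < μ) (hχ : 0 ≤ χ) :
    IsInvStokes O μ χ (invStokes O μ χ) := by
  have h := exists_isInvStokes hP hμ hχ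
  rw [invStokes, dif_pos h]
  exact h.choose_spec

/-- Uniqueness for the Stokes problem. -/
theorem invStokes_eq (hP : PoincareDomain O) (hμ : 0 < μ) (hχ : 0 ≤ χ) {h : HSpace O}
    {u : VSpace O} (hu : ∀ ψ : VSpace O, μ * inner ℝ (vGrad u) (vGrad ψ)
      + χ * inner ℝ (vField u) (vField ψ) = inner ℝ (h : LpField O 2) (vField ψ)) :
    invStokes O μ χ h = vToH O u := by
  obtain ⟨w, hw, hw'⟩ := isInvStokes_invStokes hP hμ hχ h
  have h0 : w - u = 0 := by
    refine eq_zero_of_stokesForm hP hμ hχ ?_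
    have h1 := hw' (w - u)
    have h2 := hu (w - u)
    rw [vField_sub, vGrad_sub] at *
    simp only [inner_sub_left] at h1 h2 ⊢
    linarith
  rw [sub_eq_zero] at h0
  exact Subtype.ext (by rw [← hw, h0]; rfl)

theorem isNonnegOp_invStokes (hP : PoincareDomain O) (hμ : 0 < μ) (hχ : 0 ≤ χ) :
    IsNonnegOp (invStokes O μ χ) := by
  refine ⟨fun h k => ?_, fun h => ?_⟩
  · obtain ⟨u, hu, hu'⟩ := isInvStokes_invStokes hP hμ hχ h
    obtain ⟨w, hw, hw'⟩ := isInvStokes_invStokes hP hμ hχ k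
    change inner ℝ (invStokes O μ χ h : LpField O 2) (k : LpField O 2)
      = inner ℝ (h : LpField O 2) (invStokes O μ χ k : LpField O 2)
    rw [← hu, ← hw, ← hu', real_inner_comm, ← hw', real_inner_comm (vGrad u),
      real_inner_comm (vField u)]
  · obtain ⟨u, hu, hu'⟩ := isInvStokes_invStokes hP hμ hχ h
    change 0 ≤ inner ℝ (invStokes O μ χ h : LpField O 2) (h : LpField O 2)
    rw [← hu, real_inner_comm, ← hu', real_inner_self_eq_norm_sq, real_inner_self_eq_norm_sq]
    positivity

theorem eq_zero_of_inner_vField {h : HSpace O}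
    (h0 : ∀ ψ : VSpace O, inner ℝ (h : LpField O 2) (vField ψ) = 0) : h = 0 := by
  have h1 : HSpace O ≤ LinearMap.ker (innerSL ℝ (h : LpField O 2)).toLinearMap := by
    refine ltilde_le ((innerSL ℝ (h : LpField O 2)).isClosed_ker) fun u φ hφ hu => ?_
    obtain ⟨w, hw⟩ := exists_pair hφ
    have : u = vField w := Lp.ext (hu.trans hw.1.symm)
    rw [this]
    exact h0 w
  have h2 := h1 h.2
  have h3 : inner ℝ (h : LpField O 2) (h : LpField O 2) = (0 : ℝ) := h2
  exact Subtype.ext (inner_self_eq_zero.1 h3)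

theorem injective_invStokes (hP : PoincareDomain O) (hμ : 0 < μ) (hχ : 0 ≤ χ) :
    Function.Injective (invStokes O μ χ) := by
  refine (injective_iff_map_eq_zero _).2 fun h hh => eq_zero_of_inner_vField fun ψ => ?_
  obtain ⟨u, hu, hu'⟩ := isInvStokes_invStokes hP hμ hχ h
  have hu0 : vField u = 0 := by rw [hu, hh]; rfl
  have h1 : u = 0 := eq_zero_of_stokesForm hP hμ hχ (by rw [hu' u, hu0, inner_zero_right])
  rw [← hu' ψ, h1]
  have e1 : vGrad (0 : VSpace O) = 0 := rfl
  have e2 : vField (0 : VSpace O) = 0 := rfl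
  rw [e1, e2, inner_zero_left, inner_zero_left]; ring

/-- This is `(μA + χ)A⁻¹ = μ + χA⁻¹` in weak form. It makes every resolvent a function of the one
operator `A⁻¹`, so that different values of `χ` can be compared in a single calculus. -/
theorem invStokes_mul_shiftOp (hP : PoincareDomain O) (hμ : 0 < μ) (hχ : 0 ≤ χ) :
    invStokes O μ χ * shiftOp (invStokes O 1 0) μ χ = invStokes O 1 0 := by
  ext1 h
  obtain ⟨u, hu, hu'⟩ := isInvStokes_invStokes hP zero_lt_one le_rfl h
  have h1 : invStokes O 1 0 h = vToH O u := Subtype.ext (by rw [← hu]; rfl)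
  change invStokes O μ χ (shiftOp (invStokes O 1 0) μ χ h) = _
  rw [h1]
  refine invStokes_eq hP hμ hχ fun ψ => ?_
  have h2 : ((shiftOp (invStokes O 1 0) μ χ h : HSpace O) : LpField O 2)
      = μ • (h : LpField O 2) + χ • vField u := by
    rw [hu]; rfl
  rw [h2, inner_add_left, real_inner_smul_left, real_inner_smul_left, ← hu' ψ]
  ring

end Stokes

end SCBF


namespace SCBF

/-! ### Powers and exponentials of `μA + χ` as functions of `A⁻¹`. -/

section FractionalPowers

variable {H : Type*} [NormedAddCommGroup H] [InnerProductSpace ℝ H] [CompleteSpace H]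
  {K R : H →L[ℝ] H} {μ χ δ : ℝ}

theorem shift_pos (hμ : 0 < μ) (hχ : 0 ≤ χ) {x : ℝ} (hx : 0 ≤ x) : 0 < μ + χ * x := by positivity

theorem continuousOn_resolvent (hμ : 0 < μ) (hχ : 0 ≤ χ) {M : ℝ} :
    ContinuousOn (fun x : ℝ => x / (μ + χ * x)) (Icc 0 M) :=
  (continuousOn_id' _).div (by fun_prop) fun _ hx => (shift_pos hμ hχ hx.1).ne'

theorem continuousOn_shift_rpow (hμ : 0 < μ) (hχ : 0 ≤ χ) {M : ℝ} :
    ContinuousOn (fun x : ℝ => (μ + χ * x) ^ (-δ)) (Icc 0 M) := by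
  refine ContinuousOn.rpow_const (by fun_prop) fun x hx => Or.inl (shift_pos hμ hχ hx.1).ne'

theorem isFunctionOf_resolvent (hK : IsNonnegOp K) (hμ : 0 < μ) (hχ : 0 ≤ χ)
    (hR : R * shiftOp K μ χ = K) : IsFunctionOf K (fun x => x / (μ + χ * x)) R := by
  have hN : ContinuousOn (fun x : ℝ => μ + χ * x) (Icc 0 ‖K‖) := by fun_prop
  have hi : ContinuousOn (fun x : ℝ => (μ + χ * x)⁻¹) (Icc 0 ‖K‖) :=
    hN.inv₀ fun x hx => (shift_pos hμ hχ hx.1).ne'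
  have h2 : shiftOp K μ χ * functionOf K (fun x => (μ + χ * x)⁻¹) = 1 := by
    rw [shiftOp_eq hK, ← functionOf_mul hK hN hi,
      functionOf_congr hK (f := fun x => (μ + χ * x) * (μ + χ * x)⁻¹) (g := fun _ => 1)
        (hN.mul hi) fun x hx => mul_inv_cancel₀ (shift_pos hμ hχ hx.1).ne',
      functionOf_const hK, one_smul]
  have h3 : R = functionOf K (fun x => x * (μ + χ * x)⁻¹) := by
    rw [functionOf_self_mul hK hi]
    nth_rewrite 1 [← hR]
    rw [mul_assoc, h2, mul_one]
  rw [h3]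
  exact (isFunctionOf_functionOf hK (continuousOn_self_mul hi)).congr fun x _ =>
    (div_eq_mul_inv _ _).symm

theorem functionOf_rpow_resolvent (hK : IsNonnegOp K) (hR' : IsNonnegOp R) (hμ : 0 < μ)
    (hχ : 0 ≤ χ) (hδ : 0 < δ) (hR : R * shiftOp K μ χ = K) :
    functionOf R (fun x => x ^ δ) = functionOf K (fun x => (μ + χ * x) ^ (-δ))
      * functionOf K (fun x => x ^ δ) := by
  rw [functionOf_comp hK hR' (continuousOn_resolvent hμ hχ)
    (fun x hx => div_nonneg hx.1 (shift_pos hμ hχ hx.1).le) (isFunctionOf_resolvent hK hμ hχ hR)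
    (Real.continuous_rpow_const hδ.le).continuousOn,
    ← functionOf_mul hK (continuousOn_shift_rpow hμ hχ) (continuousOn_rpow_Icc hδ)]
  refine functionOf_congr hK ((Real.continuous_rpow_const hδ.le).comp_continuousOn
    (continuousOn_resolvent hμ hχ)) fun x hx => ?_
  have := shift_pos hμ hχ hx.1
  rw [Real.div_rpow hx.1 this.le, Real.rpow_neg this.le]
  field_simp

/-- Here `x ↦ x/(μ + χx)` represents `(μA+χ)⁻¹`. The factor `(μ + χx)^{-δ}`, by which `(μA+χ)^{-δ}`
differs from `A^{-δ}`, reduces `(μA+χ)^{1+δ}` to `A^δ(μA+χ)`. Thus the path can be driven by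
`A^{-δ}ω` for every `χ`. -/
theorem functionOf_exp_resolvent_mul (hK : IsNonnegOp K) (hR' : IsNonnegOp R) (hμ : 0 < μ)
    (hχ : 0 ≤ χ) (hδ : 0 < δ) (hR : R * shiftOp K μ χ = K) {s : ℝ} (hs : 0 < s) :
    functionOf R (fun x => x ^ (-(1 + δ)) * Real.exp (-s / x))
      * functionOf K (fun x => (μ + χ * x) ^ (-δ)) = ouOp K μ χ δ s := by
  have hc : ContinuousOn (fun x : ℝ => x ^ (-(1 + δ)) * Real.exp (-s / x)) (Ici 0) :=
    (continuousOn_expKernel (show 0 < 1 + δ by linarith)).comp (f := fun x => (s, x))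
      (by fun_prop) fun _ hx => ⟨hs, hx⟩
  have hm0 : ∀ x ∈ Icc 0 ‖K‖, 0 ≤ x / (μ + χ * x) :=
    fun x hx => div_nonneg hx.1 (shift_pos hμ hχ hx.1).le
  have hc' : ContinuousOn (fun x : ℝ => (x / (μ + χ * x)) ^ (-(1 + δ))
      * Real.exp (-s / (x / (μ + χ * x)))) (Icc 0 ‖K‖) :=
    hc.comp (continuousOn_resolvent (M := ‖K‖) hμ hχ) hm0
  have hsh : ContinuousOn (fun x : ℝ => (μ + χ * x) ^ (-δ)) (Icc 0 ‖K‖) :=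
    continuousOn_shift_rpow hμ hχ
  rw [functionOf_comp hK hR' (continuousOn_resolvent hμ hχ)
    hm0 (isFunctionOf_resolvent hK hμ hχ hR) hc, ouOp, ← functionOf_mul hK hc' hsh]
  refine functionOf_congr hK (hc'.mul hsh) fun x hx => ?_
  rcases hx.1.eq_or_lt with rfl | hx0
  · rw [ouSymbol, expKernel_zero (by linarith), zero_div, Real.zero_rpow (by linarith), zero_mul,
      zero_mul, mul_zero]
  · have h0 := shift_pos hμ hχ hx.1
    rw [ouSymbol, expKernel, Real.div_rpow hx.1 h0.le, Real.rpow_neg h0.le (1 + δ), div_inv_eq_mul,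
      neg_add (1 : ℝ)]
    have e1 : (μ + χ * x) ^ (1 + δ) * (μ + χ * x) ^ (-δ) = μ + χ * x := by
      rw [← Real.rpow_add h0]; simp
    have e2 : Real.exp (-s / (x / (μ + χ * x)))
        = Real.exp (-s * χ) * Real.exp (-(μ * s) / x) := by
      rw [← Real.exp_add]
      congr 1
      field_simp
      ring
    rw [e2]
    linear_combination (x ^ (-1 + -δ) * Real.exp (-s * χ) * Real.exp (-(μ * s) / x)) * e1

theorem integral_Iic_eq_integral_Ioi_sub {E : Type*} [NormedAddCommGroup E] [NormedSpace ℝ E]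
    (g : ℝ → E) (t : ℝ) : ∫ τ in Iic t, g τ = ∫ s in Ioi 0, g (t - s) := by
  have h := (Measure.measurePreserving_sub_left volume t).setIntegral_preimage_emb
    (MeasurableEquiv.subLeft t).measurableEmbedding g (Iic t)
  have hp : (fun s : ℝ => t - s) ⁻¹' Iic t = Ici 0 := by ext s; simp
  rw [hp] at h
  rw [← h, integral_Ici_eq_integral_Ioi]

end FractionalPowers

/-! ### The noise space and the Ornstein-Uhlenbeck path in `ℍ`. -/

section NoiseSpace

variable {d : ℕ} {O : Set (Ed d)} {p : ℝ≥0∞} [Fact (1 ≤ p)] {μ χ δ ξ : ℝ}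

theorem norm_xToH_le (y : XSpace O p) : ‖xToH O p y‖ ≤ ‖y‖ := by
  have h : ‖(y : WithLp 1 (LpField O 2 × LpField O p))‖
      = ‖(y : WithLp 1 (LpField O 2 × LpField O p)).fst‖
        + ‖(y : WithLp 1 (LpField O 2 × LpField O p)).snd‖ := WithLp.prod_norm_eq_of_L1 _
  change ‖(y : WithLp 1 (LpField O 2 × LpField O p)).fst‖ ≤
    ‖(y : WithLp 1 (LpField O 2 × LpField O p))‖
  rw [h]
  exact le_add_of_nonneg_right (norm_nonneg _)

theorem negPow_preToH (z : PreNoise O p δ) :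
    negPow O 1 0 δ (preToH z) = xToH O p (preSmoothed O p δ z) := by
  have h : xToH O p (preSmoothed O p δ z) - negPow O 1 0 δ (preToH z) = 0 :=
    (z : noiseGraph O p δ).2
  exact (sub_eq_zero.1 h).symm

theorem norm_negPow_preToH_le (z : PreNoise O p δ) : ‖negPow O 1 0 δ (preToH z)‖ ≤ ‖z‖ := by
  rw [negPow_preToH]
  exact norm_xToH_le _

theorem preToH_sub (z w : PreNoise O p δ) : preToH (z - w) = preToH z - preToH w := rfl

theorem norm_negPow_sub_le (z w : PreNoise O p δ) :
    ‖negPow O 1 0 δ (preToH z) - negPow O 1 0 δ (preToH w)‖ ≤ ‖z - w‖ := by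
  rw [← map_sub, ← preToH_sub]
  exact norm_negPow_preToH_le _

theorem lipschitz_negPow_one :
    LipschitzWith 1 fun z : PreNoise O p δ => negPow O 1 0 δ (preToH z) :=
  LipschitzWith.of_dist_le_mul fun z w => by
    rw [dist_eq_norm, dist_eq_norm, NNReal.coe_one, one_mul]
    exact norm_negPow_sub_le z w

theorem negPow_eq_comp (hP : PoincareDomain O) (hμ : 0 < μ) (hχ : 0 ≤ χ) (hδ : 0 < δ) :
    negPow O μ χ δ
      = functionOf (invStokes O 1 0) (fun x => (μ + χ * x) ^ (-δ)) * negPow O 1 0 δ :=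
  functionOf_rpow_resolvent (isNonnegOp_invStokes hP zero_lt_one le_rfl)
    (isNonnegOp_invStokes hP hμ hχ) hμ hχ hδ (invStokes_mul_shiftOp hP hμ hχ)

theorem negPowE_one_coe (z : PreNoise O p δ) :
    negPowE O p 1 0 δ (z : NoiseSpace O p δ) = negPow O 1 0 δ (preToH z) :=
  UniformSpace.Completion.extension_coe lipschitz_negPow_one.uniformContinuous z

theorem continuous_negPowE (O : Set (Ed d)) (p : ℝ≥0∞) [Fact (1 ≤ p)] (μ χ δ : ℝ) :
    Continuous (negPowE O p μ χ δ) :=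
  UniformSpace.Completion.continuous_extension

/-- On the pre-completed space this is the factorization of `(μA+χ)^{-δ}` through `A^{-δ}`, which
also gives the uniform continuity needed for the extension to `E`; density does the rest. -/
theorem negPowE_eq (hP : PoincareDomain O) (hμ : 0 < μ) (hχ : 0 ≤ χ) (hδ : 0 < δ)
    (e : NoiseSpace O p δ) : negPowE O p μ χ δ e
      = functionOf (invStokes O 1 0) (fun x => (μ + χ * x) ^ (-δ)) (negPowE O p 1 0 δ e) := by
  have h1 := continuous_negPowE O p μ χ δ
  have h2 := continuous_negPowE O p 1 0 δ
  induction e using UniformSpace.Completion.induction_on with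
  | hp => exact isClosed_eq h1 (by fun_prop)
  | ih z =>
    rw [negPowE_one_coe]
    have hu : UniformContinuous fun z : PreNoise O p δ => negPow O μ χ δ (preToH z) := by
      rw [negPow_eq_comp hP hμ hχ hδ]
      exact (functionOf (invStokes O 1 0) (fun x => (μ + χ * x) ^ (-δ))).uniformContinuous.comp
        (lipschitz_negPow_one (O := O) (p := p) (δ := δ)).uniformContinuous
    have h3 := UniformSpace.Completion.extension_coe hu z
    refine h3.trans ?_
    rw [negPow_eq_comp hP hμ hχ hδ]
    rfl

theorem norm_negPowE_sub_le (e e' : NoiseSpace O p δ) :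
    ‖negPowE O p 1 0 δ e - negPowE O p 1 0 δ e'‖ ≤ ‖e - e'‖ := by
  have h := continuous_negPowE O p 1 0 δ
  induction e, e' using UniformSpace.Completion.induction_on₂ with
  | hp => exact isClosed_le (by fun_prop) (by fun_prop)
  | ih z w =>
    rw [negPowE_one_coe, negPowE_one_coe, ← UniformSpace.Completion.coe_sub,
      UniformSpace.Completion.norm_coe]
    exact norm_negPow_sub_le z w

theorem holderGrowth_negPowE {ω : ℝ → NoiseSpace O p δ} (hω : IsHolderPath ξ ω) :
    HolderGrowth ξ fun t => negPowE O p 1 0 δ (ω t) := by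
  obtain ⟨C, hC⟩ := hω.bound
  refine ⟨max C 0, le_max_right _ _, fun t s =>
    (norm_negPowE_sub_le _ _).trans ((hC t s).trans ?_)⟩
  gcongr
  exact le_max_left _ _

/-- After the substitution `τ = t - s`, the bounded factor `(μ + χK)^{-δ}` passes from the noise
into the kernel. The remaining path `A^{-δ}ω` is common to all `χ`. -/
theorem ouPath_eq (hP : PoincareDomain O) (hμ : 0 < μ) (hχ : 0 ≤ χ) (hδ : 0 < δ)
    (ω : ℝ → NoiseSpace O p δ) (t : ℝ) : ouPath O p μ χ δ ω t
      = ouConv (invStokes O 1 0) μ χ δ (fun t => negPowE O p 1 0 δ (ω t)) t := by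
  have h2 : ∀ s ∈ Ioi (0 : ℝ), powExp O μ χ δ s
      * functionOf (invStokes O 1 0) (fun x => (μ + χ * x) ^ (-δ))
      = ouOp (invStokes O 1 0) μ χ δ s := fun s hs =>
    functionOf_exp_resolvent_mul (isNonnegOp_invStokes hP zero_lt_one le_rfl)
      (isNonnegOp_invStokes hP hμ hχ) hμ hχ hδ (invStokes_mul_shiftOp hP hμ hχ) hs
  rw [ouPath, integral_Iic_eq_integral_Ioi_sub, ouConv]
  refine setIntegral_congr_fun measurableSet_Ioi fun s hs => ?_
  rw [← h2 s hs]
  simp only [sub_sub_cancel, negPowE_eq hP hμ hχ hδ]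
  rw [← map_sub]
  rfl

/-- The factorization `K = J S` through `V` records the gain of regularity: `S G` is a continuous
`V`-valued path representing the difference. -/
theorem exists_ouConv_sub_factor {H V : Type*} [NormedAddCommGroup H] [InnerProductSpace ℝ H]
    [CompleteSpace H] [NormedAddCommGroup V] [NormedSpace ℝ V] {K : H →L[ℝ] H} {S : H →L[ℝ] V}
    {J : V →L[ℝ] H} (hK : IsNonnegOp K) (hinj : Function.Injective K) (hKS : ∀ h, K h = J (S h))
    {η Υ₁ Υ₂ : ℝ → H} {χ₁ χ₂ : ℝ} (hμ : 0 < μ) (hχ₁ : 0 ≤ χ₁)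
    (hχ₂ : 0 ≤ χ₂) (hδ : 0 < δ) (hδξ : δ < ξ) (hξ : ξ < 1 / 2)
    (hη : HolderGrowth ξ η) (hc : Continuous η) (e₁ : ∀ t, Υ₁ t = ouConv K μ χ₁ δ η t)
    (e₂ : ∀ t, Υ₂ t = ouConv K μ χ₂ δ η t) :
    Continuous Υ₁ ∧ Continuous Υ₂ ∧ ∃ G : ℝ → H, Continuous G ∧
      (∀ t, Υ₁ t - Υ₂ t = J (S (G t))) ∧ ∀ t, 0 ≤ t → J (S (G t)) = J (S (G 0))
        + ∫ s in (0 : ℝ)..t, (χ₂ • Υ₂ s - χ₁ • Υ₁ s - μ • G s) := by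
  obtain rfl : Υ₁ = ouConv K μ χ₁ δ η := funext e₁
  obtain rfl : Υ₂ = ouConv K μ χ₂ δ η := funext e₂
  refine ⟨continuous_ouConv hK hμ hχ₁ hδ hδξ hξ hη hc,
    continuous_ouConv hK hμ hχ₂ hδ hδξ hξ hη hc, ?_⟩
  obtain ⟨G, hG, hD, heq⟩ := exists_ouConv_sub hK hinj hμ hχ₁ hχ₂ hδ hδξ hξ hη hc
  refine ⟨G, hG, fun t => by rw [hD, hKS], fun t ht => ?_⟩
  rw [← hKS, ← hKS, ← hD, ← hD]
  exact heq t ht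

set_option maxHeartbeats 1000000 in
/-- The difference of the Ornstein-Uhlenbeck paths for `χ₁` and `χ₂`. -/
theorem exists_ouPath_sub (hP : PoincareDomain O) {χ₁ χ₂ : ℝ} (hμ : 0 < μ) (hχ₁ : 0 ≤ χ₁)
    (hχ₂ : 0 ≤ χ₂) (hδ : 0 < δ) (hδξ : δ < ξ) (hξ : ξ < 1 / 2) {ω : ℝ → NoiseSpace O p δ}
    (hω : IsHolderPath ξ ω) :
    Continuous (ouPath O p μ χ₁ δ ω) ∧ Continuous (ouPath O p μ χ₂ δ ω) ∧
    ∃ (G : ℝ → HSpace O) (D : ℝ → VSpace O), Continuous G ∧ Continuous D ∧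
      (∀ t, ouPath O p μ χ₁ δ ω t - ouPath O p μ χ₂ δ ω t = vToH O (D t)) ∧
      (∀ t (ψ : VSpace O), inner ℝ (vGrad (D t)) (vGrad ψ)
        = inner ℝ (G t : LpField O 2) (vField ψ)) ∧
      ∀ t, 0 ≤ t → vToH O (D t) = vToH O (D 0) + ∫ s in (0 : ℝ)..t,
        (χ₂ • ouPath O p μ χ₂ δ ω s - χ₁ • ouPath O p μ χ₁ δ ω s - μ • G s) := by
  have hη := holderGrowth_negPowE hω
  have hc : Continuous fun t => negPowE O p 1 0 δ (ω t) :=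
    (continuous_negPowE O p 1 0 δ).comp hω.continuous
  obtain ⟨S, hS⟩ := exists_stokesSolution (O := O) hP zero_lt_one le_rfl
  have hKS : ∀ h, invStokes O 1 0 h = vToH O (S h) :=
    fun h => invStokes_eq hP zero_lt_one le_rfl (hS h)
  obtain ⟨h1, h2, G, hG, hD, heq⟩ := exists_ouConv_sub_factor
    (isNonnegOp_invStokes (O := O) hP zero_lt_one le_rfl)
    (injective_invStokes (O := O) hP zero_lt_one le_rfl) hKS hμ hχ₁ hχ₂ hδ hδξ hξ hη hc
    (ouPath_eq hP hμ hχ₁ hδ ω) (ouPath_eq hP hμ hχ₂ hδ ω)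
  exact ⟨h1, h2, G, fun t => S (G t), hG, S.continuous.comp hG, hD,
    fun t ψ => by rw [← hS (G t) ψ]; ring, heq⟩

end NoiseSpace

end SCBF


namespace SCBF

/-! ### Time translations of pairings between `L²(V) ∩ L^q(L)` and its dual. -/

section EnergyIdentity

theorem tendsto_eLpNorm_translate {Y : Type*} [NormedAddCommGroup Y] {q : ℝ≥0∞} [Fact (1 ≤ q)]
    (hq : q ≠ ∞) {g : ℝ → Y} (hg : MemLp g q volume) :
    Tendsto (fun η => eLpNorm (fun s => g (s + η) - g s) q volume) (𝓝 0) (𝓝 0) := by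
  have hmp : ∀ η : ℝ, MeasurePreserving (fun s : ℝ => s + η) volume volume :=
    fun η => measurePreserving_add_right volume η
  let c : ℝ → C(ℝ, ℝ) := fun η => ⟨fun s => s + η, by fun_prop⟩
  have hc : Continuous c := ContinuousMap.continuous_of_continuous_uncurry _ (by
    show Continuous fun x : ℝ × ℝ => x.2 + x.1
    fun_prop)
  have h1 : Tendsto (fun η => Lp.compMeasurePreserving (c η) (hmp η) (hg.toLp g)) (𝓝 0)
      (𝓝 (Lp.compMeasurePreserving (c 0) (hmp 0) (hg.toLp g))) :=
    Filter.Tendsto.compMeasurePreservingLp tendsto_const_nhds (hc.tendsto 0) hmp (hmp 0) hq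
  rw [tendsto_iff_edist_tendsto_0] at h1
  refine h1.congr fun η => ?_
  rw [Lp.edist_def]
  refine eLpNorm_congr_ae ?_
  have key : ∀ η, Lp.compMeasurePreserving (c η) (hmp η) (hg.toLp g)
      =ᵐ[volume] fun s => g (s + η) := fun η =>
    (Lp.coeFn_compMeasurePreserving _ (hmp η)).trans
      ((hmp η).quasiMeasurePreserving.ae_eq_comp hg.coeFn_toLp)
  filter_upwards [key η, key 0] with s hs hs0
  rw [Pi.sub_apply, hs, hs0, add_zero]

variable {H W V L : Type*} [NormedAddCommGroup H] [InnerProductSpace ℝ H]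
  [NormedAddCommGroup W] [NormedSpace ℝ W] [NormedAddCommGroup V] [NormedSpace ℝ V]
  [NormedAddCommGroup L] [NormedSpace ℝ L] {iH : W →L[ℝ] H} {iV : W →L[ℝ] V} {iL : W →L[ℝ] L}
  {q q' : ℝ≥0∞} [ENNReal.HolderConjugate q' q] {N : ℝ → StrongDual ℝ W} {a b : ℝ → ℝ}

theorem lintegral_mul_norm_le {α Y : Type*} {m : MeasurableSpace α} {ν : Measure α} {p p' : ℝ≥0∞}
    [ENNReal.HolderConjugate p' p] [NormedAddCommGroup Y] {c : α → ℝ} {y : α → Y}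
    (hc : AEStronglyMeasurable c ν) (hy : AEStronglyMeasurable y ν) :
    ∫⁻ s, ‖c s * ‖y s‖‖ₑ ∂ν ≤ eLpNorm c p' ν * eLpNorm y p ν := by
  rw [← eLpNorm_one_eq_lintegral_enorm]
  have h := eLpNorm_le_eLpNorm_mul_eLpNorm_of_nnnorm (p := p') (q := p) (r := 1) hc hy
    (fun (x : ℝ) (v : Y) => x * ‖v‖) 1 (ae_of_all _ fun x => by
      rw [one_mul, nnnorm_mul, nnnorm_norm])
  simpa using h

theorem lintegral_pairing_le (ha : MemLp a 2 volume) (hb : MemLp b q' volume)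
    (hN : ∀ᵐ s, ∀ ψ, |N s ψ| ≤ a s * ‖iV ψ‖ + b s * ‖iL ψ‖) {ζ : ℝ → W}
    (hζ : AEStronglyMeasurable ζ volume) :
    ∫⁻ s, ‖N s (ζ s)‖ₑ ≤ eLpNorm a 2 volume * eLpNorm (fun s => iV (ζ s)) 2 volume
      + eLpNorm b q' volume * eLpNorm (fun s => iL (ζ s)) q volume := by
  have hV : AEStronglyMeasurable (fun s => iV (ζ s)) volume :=
    iV.continuous.comp_aestronglyMeasurable hζ
  have hL : AEStronglyMeasurable (fun s => iL (ζ s)) volume :=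
    iL.continuous.comp_aestronglyMeasurable hζ
  calc ∫⁻ s, ‖N s (ζ s)‖ₑ
      ≤ ∫⁻ s, (‖a s * ‖iV (ζ s)‖‖ₑ + ‖b s * ‖iL (ζ s)‖‖ₑ) := by
        refine lintegral_mono_ae ?_
        filter_upwards [hN] with s hs
        refine le_trans ?_ (enorm_add_le _ _)
        rw [enorm_le_iff_norm_le, Real.norm_eq_abs, Real.norm_eq_abs]
        exact (hs _).trans (le_abs_self _)
    _ = _ := lintegral_add_left' ((ha.1.mul hV.norm).enorm) _
    _ ≤ _ := add_le_add (lintegral_mul_norm_le ha.1 hV) (lintegral_mul_norm_le hb.1 hL)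

variable {z : ℝ → W}

theorem aestronglyMeasurable_pairing {α : Type*} {m : MeasurableSpace α} {ν : Measure α}
    {M : α → StrongDual ℝ W} {ζ : α → W}
    (hM : AEStronglyMeasurable M ν) (hζ : AEStronglyMeasurable ζ ν) :
    AEStronglyMeasurable (fun s => M s (ζ s)) ν :=
  (ContinuousLinearMap.id ℝ (StrongDual ℝ W)).aestronglyMeasurable_comp₂ hM hζ

/-- The modulus of continuity under translation which controls the pairing. -/
noncomputable def translateModulus (iV : W →L[ℝ] V) (iL : W →L[ℝ] L) (q q' : ℝ≥0∞) (a b : ℝ → ℝ)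
    (z : ℝ → W) (η : ℝ) : ℝ≥0∞ :=
  eLpNorm a 2 volume * eLpNorm (fun s => iV (z (s + η)) - iV (z s)) 2 volume
    + eLpNorm b q' volume * eLpNorm (fun s => iL (z (s + η)) - iL (z s)) q volume

theorem tendsto_translateModulus [Fact (1 ≤ q)] (hq : q ≠ ∞) (ha : MemLp a 2 volume)
    (hb : MemLp b q' volume)
    (hzV : MemLp (fun s => iV (z s)) 2 volume) (hzL : MemLp (fun s => iL (z s)) q volume) :
    Tendsto (translateModulus iV iL q q' a b z) (𝓝 0) (𝓝 0) := by
  have h1 := ENNReal.Tendsto.const_mul (tendsto_eLpNorm_translate (by norm_num) hzV)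
    (Or.inr ha.eLpNorm_ne_top)
  have h2 := ENNReal.Tendsto.const_mul (tendsto_eLpNorm_translate hq hzL)
    (Or.inr hb.eLpNorm_ne_top)
  rw [mul_zero] at h1 h2
  exact add_zero (0 : ℝ≥0∞) ▸ h1.add h2

theorem aestronglyMeasurable_translate {Y : Type*} [TopologicalSpace Y] {g : ℝ → Y}
    (hg : AEStronglyMeasurable g volume) (η : ℝ) :
    AEStronglyMeasurable (fun s => g (s + η)) volume :=
  hg.comp_quasiMeasurePreserving (measurePreserving_add_right volume η).quasiMeasurePreserving

theorem lintegral_pairing_translate_le (ha : MemLp a 2 volume) (hb : MemLp b q' volume)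
    (hN : ∀ᵐ s, ∀ ψ, |N s ψ| ≤ a s * ‖iV ψ‖ + b s * ‖iL ψ‖)
    (hz : AEStronglyMeasurable z volume) (θ h : ℝ) :
    ∫⁻ s, ‖N (s + θ) (z (s + h) - z (s + θ))‖ₑ ≤ translateModulus iV iL q q' a b z (h - θ) := by
  have h1 := lintegral_add_right_eq_self (μ := volume)
    (fun s => ‖N s (z (s + (h - θ)) - z s)‖ₑ) θ
  have h2 : ∀ s, s + θ + (h - θ) = s + h := fun s => by ring
  simp only [h2] at h1
  rw [h1]
  refine (lintegral_pairing_le (q := q) ha hb hN ((aestronglyMeasurable_translate hz _).sub hz)).trans ?_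
  simp only [Pi.sub_apply, map_sub]
  exact le_rfl

theorem integrable_pairing (hNm : AEStronglyMeasurable N volume)
    (ha : MemLp a 2 volume) (hb : MemLp b q' volume)
    (hN : ∀ᵐ s, ∀ ψ, |N s ψ| ≤ a s * ‖iV ψ‖ + b s * ‖iL ψ‖)
    (hz : AEStronglyMeasurable z volume)
    (hzV : MemLp (fun s => iV (z s)) 2 volume) (hzL : MemLp (fun s => iL (z s)) q volume) :
    Integrable (fun s => N s (z s)) volume :=
  ⟨aestronglyMeasurable_pairing hNm hz, (lintegral_pairing_le ha hb hN hz).trans_lt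
    (ENNReal.add_lt_top.2 ⟨ENNReal.mul_lt_top ha.eLpNorm_lt_top hzV.eLpNorm_lt_top,
      ENNReal.mul_lt_top hb.eLpNorm_lt_top hzL.eLpNorm_lt_top⟩)⟩

/-- Prepares Fubini's theorem. By Hölder's inequality and translation invariance, the integral in
the first variable has a bound independent of the second, which ranges over a bounded interval. -/
theorem integrable_pairing_translate (hNm : AEStronglyMeasurable N volume)
    (ha : MemLp a 2 volume) (hb : MemLp b q' volume)
    (hN : ∀ᵐ s, ∀ ψ, |N s ψ| ≤ a s * ‖iV ψ‖ + b s * ‖iL ψ‖)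
    (hz : AEStronglyMeasurable z volume)
    (hzV : MemLp (fun s => iV (z s)) 2 volume) (hzL : MemLp (fun s => iL (z s)) q volume)
    (σ : ℝ) (T h : ℝ) :
    Integrable (fun x : ℝ × ℝ => N (x.1 + x.2) (z (x.1 + σ)))
      ((volume.restrict (Ioc 0 T)).prod (volume.restrict (Ioc 0 h))) := by
  have hqmp : Measure.QuasiMeasurePreserving (fun x : ℝ × ℝ => x.1 + x.2)
      (volume.prod volume) volume :=
    Measure.quasiMeasurePreserving_snd.comp
      (measurePreserving_prod_add (volume : Measure ℝ) (volume : Measure ℝ)).quasiMeasurePreserving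
  have hm : AEStronglyMeasurable (fun x : ℝ × ℝ => N (x.1 + x.2) (z (x.1 + σ)))
      ((volume : Measure ℝ).prod volume) :=
    aestronglyMeasurable_pairing (hNm.comp_quasiMeasurePreserving hqmp)
      ((aestronglyMeasurable_translate hz σ).comp_fst)
  have hm' : AEStronglyMeasurable (fun x : ℝ × ℝ => N (x.1 + x.2) (z (x.1 + σ)))
      ((volume.restrict (Ioc 0 T)).prod (volume.restrict (Ioc 0 h))) := by
    rw [Measure.prod_restrict]
    exact hm.restrict
  refine ⟨hm', ?_⟩
  rw [HasFiniteIntegral, lintegral_prod_symm _ hm'.enorm]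
  set C : ℝ≥0∞ := eLpNorm a 2 volume * eLpNorm (fun s => iV (z s)) 2 volume
      + eLpNorm b q' volume * eLpNorm (fun s => iL (z s)) q volume with hC
  have hCt : C < ∞ := ENNReal.add_lt_top.2
    ⟨ENNReal.mul_lt_top ha.eLpNorm_lt_top hzV.eLpNorm_lt_top,
      ENNReal.mul_lt_top hb.eLpNorm_lt_top hzL.eLpNorm_lt_top⟩
  have hle : ∀ θ : ℝ, ∫⁻ s in Ioc 0 T, ‖N (s + θ) (z (s + σ))‖ₑ ≤ C := fun θ => by
    refine (setLIntegral_le_lintegral _ _).trans ?_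
    have h1 := lintegral_add_right_eq_self (μ := volume)
      (fun s => ‖N s (z (s + (σ - θ)))‖ₑ) θ
    have h2 : ∀ s, s + θ + (σ - θ) = s + σ := fun s => by ring
    simp only [h2] at h1
    rw [h1]
    refine (lintegral_pairing_le (q := q) ha hb hN (aestronglyMeasurable_translate hz _)).trans ?_
    have h3 := eLpNorm_comp_measurePreserving (p := 2) hzV.1
      (measurePreserving_add_right volume (σ - θ))
    have h4 := eLpNorm_comp_measurePreserving (p := q) hzL.1
      (measurePreserving_add_right volume (σ - θ))
    simp only [Function.comp_def] at h3 h4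
    rw [h3, h4]
  calc ∫⁻ θ in Ioc 0 h, ∫⁻ s in Ioc 0 T, ‖N (s + θ) (z (s + σ))‖ₑ
      ≤ ∫⁻ θ in Ioc 0 h, C := lintegral_mono fun θ => hle θ
    _ < ∞ := by
      rw [lintegral_const]
      exact ENNReal.mul_lt_top hCt (by simp)

end EnergyIdentity

end SCBF


namespace SCBF

/-! ### The energy identity. -/

section EnergyIdentity

variable {H W V L : Type*} [NormedAddCommGroup H] [InnerProductSpace ℝ H]
  [NormedAddCommGroup W] [NormedSpace ℝ W] [NormedAddCommGroup V] [NormedSpace ℝ V]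
  [NormedAddCommGroup L] [NormedSpace ℝ L] {iH : W →L[ℝ] H} {iV : W →L[ℝ] V} {iL : W →L[ℝ] L}
  {q q' : ℝ≥0∞} [ENNReal.HolderConjugate q' q] {N : ℝ → StrongDual ℝ W} {a b : ℝ → ℝ} {z : ℝ → W}

theorem integrable_pairing_comp (hNm : AEStronglyMeasurable N volume)
    (ha : MemLp a 2 volume) (hb : MemLp b q' volume)
    (hN : ∀ᵐ s, ∀ ψ, |N s ψ| ≤ a s * ‖iV ψ‖ + b s * ‖iL ψ‖)
    (hz : AEStronglyMeasurable z volume)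
    (hzV : MemLp (fun s => iV (z s)) 2 volume) (hzL : MemLp (fun s => iL (z s)) q volume)
    (θ σ : ℝ) : Integrable (fun s => N (s + θ) (z (s + σ))) volume := by
  have h := (integrable_pairing (q := q) (z := fun s => z (s + (σ - θ))) hNm ha hb hN
    (aestronglyMeasurable_translate hz _)
    (hzV.comp_measurePreserving (measurePreserving_add_right volume (σ - θ)))
    (hzL.comp_measurePreserving (measurePreserving_add_right volume (σ - θ)))).comp_add_right θ
  refine h.congr (ae_of_all _ fun s => ?_)
  simp only
  congr 2
  ring

theorem abs_integral_pairing_sub_le (hNm : AEStronglyMeasurable N volume)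
    (ha : MemLp a 2 volume) (hb : MemLp b q' volume)
    (hN : ∀ᵐ s, ∀ ψ, |N s ψ| ≤ a s * ‖iV ψ‖ + b s * ‖iL ψ‖)
    (hz : AEStronglyMeasurable z volume)
    (hzV : MemLp (fun s => iV (z s)) 2 volume) (hzL : MemLp (fun s => iL (z s)) q volume)
    {ε : ℝ} (hε : 0 ≤ ε) {θ σ : ℝ}
    (h : translateModulus iV iL q q' a b z (σ - θ) ≤ ENNReal.ofReal ε) (S : Set ℝ) :
    |(∫ s in S, N (s + θ) (z (s + σ))) - ∫ s in S, N (s + θ) (z (s + θ))| ≤ ε := by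
  have hi := fun σ => integrable_pairing_comp hNm ha hb hN hz hzV hzL θ σ
  rw [← integral_sub (hi σ).integrableOn (hi θ).integrableOn, ← Real.norm_eq_abs]
  refine (norm_integral_le_lintegral_norm _).trans (ENNReal.toReal_le_of_le_ofReal hε ?_)
  refine (setLIntegral_le_lintegral _ _).trans (le_trans ?_ h)
  refine le_trans (le_of_eq ?_) (lintegral_pairing_translate_le (q := q) ha hb hN hz θ σ)
  simp only [map_sub, ofReal_norm]

/-- The integral of the difference telescopes to the averages of `y` over `[T, T+h]` and `[0, h]`.
-/
theorem tendsto_average_sub {y : ℝ → ℝ} (hy : Continuous y) (T : ℝ) :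
    Tendsto (fun h : ℝ => h⁻¹ * ∫ s in (0 : ℝ)..T, (y (s + h) - y s)) (𝓝[>] 0)
      (𝓝 (y T - y 0)) := by
  have hi : ∀ a b, IntervalIntegrable y volume a b := fun a b => hy.intervalIntegrable a b
  have hd : ∀ t, HasDerivAt (fun u => ∫ s in (0 : ℝ)..u, y s) (y t) t := fun t =>
    intervalIntegral.integral_hasDerivAt_right (hi 0 t) (hy.stronglyMeasurableAtFilter _ _)
      hy.continuousAt
  refine ((hd T).tendsto_slope_zero_right.sub (hd 0).tendsto_slope_zero_right).congr fun h => ?_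
  have hc : Continuous fun s => y (s + h) := by fun_prop
  rw [intervalIntegral.integral_sub (hc.intervalIntegrable _ _) (hi 0 T),
    intervalIntegral.integral_comp_add_right, intervalIntegral.integral_same, sub_zero,
    smul_eq_mul, smul_eq_mul, ← mul_sub, zero_add,
    ← intervalIntegral.integral_add_adjacent_intervals (hi 0 h) (hi h (T + h))]
  ring

/-- Start from `‖w(s+h)‖² - ‖w(s)‖² = (w(s+h) - w(s), w(s+h) + w(s))` and insert the equation for
the increment, so that `z(s+h) + z(s)` is paired with `N(s+θ)`, `0 < θ ≤ h`. Integrate over `s ∈ (0,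
T)`, divide by `h` and let `h → 0`. Continuity of translations in `L²(V)` and `L^q(L)` allows
replacing both shifts of `z` by the shift `θ`. No mollification in time is needed, and `V` and `L`
enter only through the bound on `N`. -/
theorem energy_identity_of_global [Fact (1 ≤ q)] (hq : q ≠ ∞) (hNm : AEStronglyMeasurable N volume)
    (ha : MemLp a 2 volume) (hb : MemLp b q' volume)
    (hN : ∀ᵐ s, ∀ ψ, |N s ψ| ≤ a s * ‖iV ψ‖ + b s * ‖iL ψ‖)
    (hz : AEStronglyMeasurable z volume)
    (hzV : MemLp (fun s => iV (z s)) 2 volume) (hzL : MemLp (fun s => iL (z s)) q volume)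
    {w : ℝ → H} (hw : Continuous w) {T S : ℝ} (hT : 0 ≤ T) (hTS : T < S)
    (hzw : ∀ᵐ s, s ∈ Icc 0 S → iH (z s) = w s)
    (heq : ∀ ψ s t, 0 ≤ s → s ≤ t → t ≤ S →
      inner ℝ (w t - w s) (iH ψ) = ∫ τ in s..t, N τ ψ) :
    ‖w T‖ ^ 2 - ‖w 0‖ ^ 2 = 2 * ∫ s in (0 : ℝ)..T, N s (z s) := by
  set y : ℝ → ℝ := fun s => ‖w s‖ ^ 2 with hy
  have hyc : Continuous y := by fun_prop
  have hii := fun θ σ => integrable_pairing_comp (q := q) hNm ha hb hN hz hzV hzL θ σ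
  set J : ℝ → ℝ → ℝ := fun h θ => (∫ s in Ioc 0 T, N (s + θ) (z (s + h)))
    + ∫ s in Ioc 0 T, N (s + θ) (z (s + 0)) with hJ
  set I : ℝ := ∫ s in (0 : ℝ)..T, N s (z s) with hI
  have hprod : ∀ σ h, Integrable (Function.uncurry fun s θ : ℝ => N (s + θ) (z (s + σ)))
      ((volume.restrict (Ioc 0 T)).prod (volume.restrict (Ioc 0 h))) := fun σ h =>
    integrable_pairing_translate hNm ha hb hN hz hzV hzL σ T h
  have hJi : ∀ σ h, Integrable (fun θ => ∫ s in Ioc 0 T, N (s + θ) (z (s + σ)))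
      (volume.restrict (Ioc 0 h)) := fun σ h => (hprod σ h).integral_prod_right
  have hav : ∀ h, 0 < h → h ≤ S - T →
      ∫ s in (0 : ℝ)..T, (y (s + h) - y s) = ∫ θ in (0 : ℝ)..h, J h θ := by
    intro h hh hhS
    have e1 : ∀ᵐ s, s ∈ Ioc 0 T → y (s + h) - y s
        = (∫ θ in Ioc 0 h, N (s + θ) (z (s + h))) + ∫ θ in Ioc 0 h, N (s + θ) (z (s + 0)) := by
      filter_upwards [hzw, (measurePreserving_add_right volume h).quasiMeasurePreserving.ae hzw]
        with s h1 h2 hs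
      have h1 := h1 ⟨hs.1.le, by linarith [hs.2]⟩
      have h2 := h2 ⟨by linarith [hs.1], by linarith [hs.2]⟩
      have key : ∀ ψ, ∫ θ in Ioc 0 h, N (s + θ) ψ = inner ℝ (w (s + h) - w s) (iH ψ) := by
        intro ψ
        rw [heq ψ s (s + h) hs.1.le (by linarith) (by linarith [hs.2]),
          ← intervalIntegral.integral_of_le hh.le]
        have := intervalIntegral.integral_comp_add_left (a := 0) (b := h) (fun τ => N τ ψ) s
        simpa using this
      rw [key, key, ← inner_add_right, add_zero, h1, h2, real_inner_comm, hy]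
      simp only [inner_sub_right, inner_add_left, ← real_inner_self_eq_norm_sq]
      rw [real_inner_comm (w s) (w (s + h))]
      ring
    rw [intervalIntegral.integral_of_le hT, intervalIntegral.integral_of_le hh.le,
      setIntegral_congr_ae measurableSet_Ioc e1,
      integral_add (f := fun s => ∫ θ in Ioc 0 h, N (s + θ) (z (s + h)))
        (g := fun s => ∫ θ in Ioc 0 h, N (s + θ) (z (s + 0)))
        (hprod h h).integral_prod_left (hprod 0 h).integral_prod_left,
      integral_integral_swap (hprod h h), integral_integral_swap (hprod 0 h)]
    exact (integral_add (hJi h h) (hJi 0 h)).symm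
  -- With both arguments shifted by the same `θ`, the integral is a difference of primitives of
  -- `N_s(z_s)`, hence continuous in `θ`.
  have hΦ : Continuous fun θ => ∫ s in Ioc 0 T, N (s + θ) (z (s + θ)) := by
    have h0 : Integrable (fun s => N s (z s)) volume := by simpa using hii 0 0
    have h1 : ∀ θ, ∫ s in Ioc 0 T, N (s + θ) (z (s + θ))
        = (∫ s in (0 : ℝ)..(T + θ), N s (z s)) - ∫ s in (0 : ℝ)..θ, N s (z s) := fun θ => by
      rw [← intervalIntegral.integral_of_le hT,
        intervalIntegral.integral_comp_add_right (fun s => N s (z s)) θ, zero_add,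
        intervalIntegral.integral_interval_sub_left h0.intervalIntegrable h0.intervalIntegrable]
    simp only [h1]
    have h2 := intervalIntegral.continuous_primitive (f := fun s => N s (z s)) (μ := volume)
      (fun _ _ => h0.intervalIntegrable) 0
    exact (h2.comp (by fun_prop)).sub h2
  have hΦ0 : ∫ s in Ioc 0 T, N (s + 0) (z (s + 0)) = I := by
    simp only [add_zero]
    rw [hI, intervalIntegral.integral_of_le hT]
  have hmain : ∀ ε : ℝ, 0 < ε → |y T - y 0 - 2 * I| ≤ 4 * ε := by
    intro ε hε
    obtain ⟨η, hη, hmod⟩ := Metric.eventually_nhds_iff.1 ((ENNReal.tendsto_nhds_zero.1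
      (tendsto_translateModulus (q := q) (q' := q') (iV := iV) (iL := iL) hq ha hb hzV hzL))
      (ENNReal.ofReal ε) (by simpa using hε))
    obtain ⟨η', hη', hcont⟩ := Metric.continuousAt_iff.1 (hΦ.continuousAt (x := 0)) ε hε
    have hlim := ((tendsto_average_sub hyc T).sub_const (2 * I)).abs
    refine le_of_tendsto hlim ?_
    have hpos : 0 < min (min η η') (S - T) := lt_min (lt_min hη hη') (by linarith)
    filter_upwards [Ioo_mem_nhdsGT hpos] with h hh
    have hh1 : h < η := hh.2.trans_le ((min_le_left _ _).trans (min_le_left _ _))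
    have hh2 : h < η' := hh.2.trans_le ((min_le_left _ _).trans (min_le_right _ _))
    have hh3 : h < S - T := hh.2.trans_le (min_le_right _ _)
    -- The error `4ε` consists of one `ε` for each of the two translations and two for the
    -- replacement of `2Φ(θ)` by `2I`.
    have hJb : ∀ θ ∈ uIoc 0 h, ‖J h θ - 2 * I‖ ≤ 4 * ε := by
      intro θ hθ
      rw [uIoc_of_le hh.1.le] at hθ
      have b1 := abs_integral_pairing_sub_le hNm ha hb hN hz hzV hzL hε.le (θ := θ) (σ := h)
        (hmod (by rw [Real.dist_eq, sub_zero, abs_lt]; constructor <;> linarith [hθ.1, hθ.2]))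
        (Ioc 0 T)
      have b2 := abs_integral_pairing_sub_le hNm ha hb hN hz hzV hzL hε.le (θ := θ) (σ := 0)
        (hmod (by rw [Real.dist_eq, sub_zero, abs_lt]; constructor <;> linarith [hθ.1, hθ.2]))
        (Ioc 0 T)
      have b3 := hcont (x := θ) (by
        show dist θ 0 < η'
        rw [Real.dist_eq, sub_zero, abs_lt]; constructor <;> linarith [hθ.1, hθ.2])
      rw [hΦ0, Real.dist_eq] at b3
      rw [Real.norm_eq_abs, hJ]
      rw [abs_le] at b1 b2 ⊢
      rw [abs_lt] at b3
      constructor <;> simp only <;> linarith [b1.1, b1.2, b2.1, b2.2, b3.1, b3.2]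
    have hJint : IntervalIntegrable (J h) volume 0 h := by
      rw [intervalIntegrable_iff_integrableOn_Ioc_of_le hh.1.le]
      exact (hJi h h).add (hJi 0 h)
    have h5 := intervalIntegral.norm_integral_le_of_norm_le_const hJb
    rw [intervalIntegral.integral_sub hJint (by simp), intervalIntegral.integral_const,
      ← hav h hh.1 hh3.le, sub_zero, abs_of_pos hh.1, Real.norm_eq_abs, smul_eq_mul] at h5
    have h6 : h⁻¹ * (∫ s in (0 : ℝ)..T, (y (s + h) - y s)) - 2 * I
        = h⁻¹ * ((∫ s in (0 : ℝ)..T, (y (s + h) - y s)) - h * (2 * I)) := by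
      rw [mul_sub, inv_mul_cancel_left₀ hh.1.ne']
    rw [h6, abs_mul, abs_of_pos (inv_pos.2 hh.1), inv_mul_le_iff₀ hh.1, mul_comm h (4 * ε)]
    exact h5
  have h0 : |y T - y 0 - 2 * I| ≤ 0 := by
    refine le_of_forall_pos_le_add fun ε hε => ?_
    have := hmain (ε / 4) (by positivity)
    linarith
  linarith [abs_nonpos_iff.1 h0]

/-- The energy identity for `w' = N`, where `N` is in `L²(V') + L^{q'}(L')` and `w` is in
`L²(V) ∩ L^q(L)`. -/
theorem energy_identity [Fact (1 ≤ q)] (hq : q ≠ ∞)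
    (hNm : ∀ T > 0, AEStronglyMeasurable N (volume.restrict (Icc 0 T)))
    (ha : MemLocLp 2 a) (hb : MemLocLp q' b)
    (hN : ∀ᵐ s ∂volume.restrict (Ici (0 : ℝ)), ∀ ψ, |N s ψ| ≤ a s * ‖iV ψ‖ + b s * ‖iL ψ‖)
    (hz : ∀ T > 0, AEStronglyMeasurable z (volume.restrict (Icc 0 T)))
    (hzV : MemLocLp 2 fun s => iV (z s)) (hzL : MemLocLp q fun s => iL (z s))
    {w : ℝ → H} (hw : ContinuousOn w (Ici 0))
    (hzw : ∀ᵐ s ∂volume.restrict (Ici (0 : ℝ)), iH (z s) = w s)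
    (heq : ∀ ψ t, 0 ≤ t → inner ℝ (w t) (iH ψ) = inner ℝ (w 0) (iH ψ) + ∫ s in (0 : ℝ)..t, N s ψ)
    {T : ℝ} (hT : 0 ≤ T) :
    IntervalIntegrable (fun s => N s (z s)) volume 0 T ∧
      ‖w T‖ ^ 2 = ‖w 0‖ ^ 2 + 2 * ∫ s in (0 : ℝ)..T, N s (z s) := by
  have hS : 0 < T + 1 := by linarith
  -- Cutting off outside `[0, T + 1]` gives data on the whole line, where translations act; the
  -- extra unit leaves room for the shifts. The function `w` is continued by the constant `w 0`
  -- instead, which keeps it continuous.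
  set B : Set ℝ := Icc 0 (T + 1) with hB
  have hBm : MeasurableSet B := measurableSet_Icc
  have hNm' : AEStronglyMeasurable (B.indicator N) volume :=
    (aestronglyMeasurable_indicator_iff hBm).2 (hNm _ hS)
  have ha' : MemLp (B.indicator a) 2 volume := (memLp_indicator_iff_restrict hBm).2 (ha _ hS)
  have hb' : MemLp (B.indicator b) q' volume := (memLp_indicator_iff_restrict hBm).2 (hb _ hS)
  have hz' : AEStronglyMeasurable (B.indicator z) volume :=
    (aestronglyMeasurable_indicator_iff hBm).2 (hz _ hS)
  have hzV' : MemLp (fun s => iV (B.indicator z s)) 2 volume := by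
    have : (fun s => iV (B.indicator z s)) = B.indicator fun s => iV (z s) := by
      ext s; by_cases hs : s ∈ B <;> simp [hs]
    rw [this]
    exact (memLp_indicator_iff_restrict hBm).2 (hzV _ hS)
  have hzL' : MemLp (fun s => iL (B.indicator z s)) q volume := by
    have : (fun s => iL (B.indicator z s)) = B.indicator fun s => iL (z s) := by
      ext s; by_cases hs : s ∈ B <;> simp [hs]
    rw [this]
    exact (memLp_indicator_iff_restrict hBm).2 (hzL _ hS)
  have hN' : ∀ᵐ s, ∀ ψ, |B.indicator N s ψ|
      ≤ B.indicator a s * ‖iV ψ‖ + B.indicator b s * ‖iL ψ‖ := by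
    filter_upwards [(ae_restrict_iff' measurableSet_Ici).1 hN] with s hs ψ
    by_cases hsB : s ∈ B
    · simpa [hsB] using hs hsB.1 ψ
    · simp [hsB]
  have hBN : ∀ {s t : ℝ} (ζ : ℝ → W), 0 ≤ s → s ≤ t → t ≤ T + 1 →
      ∫ τ in s..t, B.indicator N τ (ζ τ) = ∫ τ in s..t, N τ (ζ τ) := by
    intro s t ζ hs hst ht
    refine intervalIntegral.integral_congr fun τ hτ => ?_
    rw [uIcc_of_le hst] at hτ
    have : τ ∈ B := ⟨hs.trans hτ.1, hτ.2.trans ht⟩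
    simp [this]
  have hint : ∀ ψ, Integrable (fun s => B.indicator N s ψ) volume := by
    intro ψ
    have hc : AEStronglyMeasurable (B.indicator fun _ => ψ) (volume : Measure ℝ) :=
      (stronglyMeasurable_const.indicator hBm).aestronglyMeasurable
    have hμB : volume B ≠ ∞ := by simp [hB]
    have e1 : (fun s => iV (B.indicator (fun _ => ψ) s)) = B.indicator fun _ => iV ψ := by
      ext s; by_cases hs : s ∈ B <;> simp [hs]
    have e2 : (fun s => iL (B.indicator (fun _ => ψ) s)) = B.indicator fun _ => iL ψ := by
      ext s; by_cases hs : s ∈ B <;> simp [hs]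
    refine (integrable_pairing (q := q) hNm' ha' hb' hN' hc
      (by rw [e1]; exact memLp_indicator_const _ hBm _ (Or.inr hμB))
      (by rw [e2]; exact memLp_indicator_const _ hBm _ (Or.inr hμB))).congr
      (ae_of_all _ fun s => ?_)
    by_cases hs : s ∈ B <;> simp [hs]
  have hmax : ∀ {s : ℝ}, 0 ≤ s → max s 0 = s := fun hs => max_eq_left hs
  have key := energy_identity_of_global (q := q) (iH := iH) (w := fun s => w (max s 0)) (T := T)
    (S := T + 1) hq hNm' ha' hb' hN' hz' hzV' hzL'
    (hw.comp_continuous (by fun_prop) fun s => mem_Ici.2 (le_max_right _ _)) hT (by linarith)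
    (by
      filter_upwards [(ae_restrict_iff' measurableSet_Ici).1 hzw] with s hs hsB
      rw [hmax hsB.1, indicator_of_mem hsB]
      exact hs hsB.1)
    (by
      intro ψ s t hs hst ht
      rw [hmax hs, hmax (hs.trans hst), inner_sub_left, heq ψ t (hs.trans hst), heq ψ s hs,
        ← hBN (fun _ => ψ) le_rfl (hs.trans hst) ht, ← hBN (fun _ => ψ) le_rfl hs (hst.trans ht),
        add_sub_add_left_eq_sub, intervalIntegral.integral_interval_sub_left
          (hint ψ).intervalIntegrable (hint ψ).intervalIntegrable])
  have hzB : ∀ s, B.indicator N s (B.indicator z s) = B.indicator N s (z s) := fun s => by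
    by_cases hs : s ∈ B <;> simp [hs]
  simp only [hzB] at key
  rw [hBN z le_rfl hT (by linarith), hmax hT, hmax le_rfl] at key
  refine ⟨?_, by linarith⟩
  have h1 := integrable_pairing (q := q) hNm' ha' hb' hN' hz' hzV' hzL'
  rw [intervalIntegrable_iff_integrableOn_Ioc_of_le hT]
  refine h1.integrableOn.congr_fun (fun s hs => ?_) measurableSet_Ioc
  have : s ∈ B := ⟨hs.1.le, by linarith [hs.2]⟩
  simp [this]

end EnergyIdentity

/-! ### Gronwall's inequality. -/

section Gronwall

/-- Gronwall's inequality with an integrable coefficient, in the homogeneous case. -/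
theorem eq_zero_of_le_integral {y k : ℝ → ℝ} (hy : ContinuousOn y (Ici 0)) (hy0 : ∀ t, 0 ≤ y t)
    (hk0 : ∀ t, 0 ≤ k t) (hk : ∀ T, 0 ≤ T → IntervalIntegrable k volume 0 T)
    (h : ∀ t, 0 ≤ t → y t ≤ ∫ s in (0 : ℝ)..t, k s * y s) {t : ℝ} (ht : 0 ≤ t) : y t = 0 := by
  have hky : ∀ a b, 0 ≤ a → 0 ≤ b → IntervalIntegrable (fun s => k s * y s) volume a b := by
    intro a b ha hb
    refine ((hk a ha).symm.trans (hk b hb)).mul_continuousOn (hy.mono ?_)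
    exact fun x hx => (le_min ha hb).trans hx.1
  have hkk : ∀ a b, 0 ≤ a → 0 ≤ b → IntervalIntegrable k volume a b :=
    fun a b ha hb => (hk a ha).symm.trans (hk b hb)
  set K : ℝ → ℝ := fun t => ∫ s in (0 : ℝ)..t, k s with hK
  have hKc : ContinuousOn K (Icc 0 t) := by
    have := intervalIntegral.continuousOn_primitive_interval' (hk t ht) left_mem_uIcc
    rwa [uIcc_of_le ht] at this
  -- On intervals of length at most `ε/2` the integral of `k` is at most `1/2`. If `y` vanishes up
  -- to the start of such an interval, its maximum there is at most half of itself.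
  obtain ⟨ε, hε, hKε⟩ := Metric.uniformContinuousOn_iff.1
    (isCompact_Icc.uniformContinuousOn_of_continuous hKc) (1 / 2) (by norm_num)
  have hstep : ∀ n : ℕ, ∀ s ∈ Icc 0 t, s ≤ n * (ε / 2) → y s = 0 := by
    intro n
    induction n with
    | zero =>
      intro s hs hs0
      have : s = 0 := le_antisymm (by simpa using hs0) hs.1
      have h0 := h 0 le_rfl
      rw [intervalIntegral.integral_same] at h0
      rw [this]
      exact le_antisymm h0 (hy0 0)
    | succ n ih =>
      intro s hs hsn
      rcases le_or_gt s (n * (ε / 2)) with hle | hgt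
      · exact ih s hs hle
      set τ : ℝ := n * (ε / 2) with hτ
      have hτ0 : 0 ≤ τ := by positivity
      obtain ⟨m, hm, hmax⟩ := isCompact_Icc.exists_isMaxOn (nonempty_Icc.2 hgt.le)
        (hy.mono fun x hx => hτ0.trans hx.1)
      have hm0 : 0 ≤ m := hτ0.trans hm.1
      have e1 : ∫ x in (0 : ℝ)..τ, k x * y x = 0 := by
        refine intervalIntegral.integral_zero_ae (ae_of_all _ fun x hx => ?_)
        rw [uIoc_of_le hτ0] at hx
        rw [ih x ⟨hx.1.le, hx.2.trans (hgt.le.trans hs.2)⟩ hx.2, mul_zero]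
      have e2 : ∫ x in τ..m, k x * y x ≤ ∫ x in τ..m, k x * y m := by
        refine intervalIntegral.integral_mono_on hm.1 (hky _ _ hτ0 hm0)
          ((hkk _ _ hτ0 hm0).mul_const _) fun x hx => ?_
        exact mul_le_mul_of_nonneg_left (hmax ⟨hx.1, hx.2.trans hm.2⟩) (hk0 x)
      have e3 : ∫ x in τ..m, k x ≤ 1 / 2 := by
        have := hKε m ⟨hm0, hm.2.trans hs.2⟩ τ ⟨hτ0, hgt.le.trans hs.2⟩ (by
          rw [Real.dist_eq, abs_of_nonneg (by linarith [hm.1])]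
          push_cast at hsn
          linarith [hm.2])
        rw [Real.dist_eq, hK] at this
        simp only at this
        rw [intervalIntegral.integral_interval_sub_left (hk m hm0) (hk τ hτ0)] at this
        exact (le_abs_self _).trans this.le
      have e4 := h m hm0
      rw [← intervalIntegral.integral_add_adjacent_intervals (hky 0 τ le_rfl hτ0)
        (hky τ m hτ0 hm0), e1, zero_add] at e4
      rw [intervalIntegral.integral_mul_const] at e2
      have e5 : y s ≤ y m := hmax ⟨hgt.le, le_rfl⟩
      nlinarith [hy0 m, hy0 s]
  obtain ⟨n, hn⟩ := exists_nat_ge (t / (ε / 2))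
  exact hstep n t ⟨ht, le_rfl⟩ ((div_le_iff₀ (by positivity)).1 hn)

end Gronwall

end SCBF


namespace SCBF

variable {d : ℕ} {O : Set (Ed d)} {r : ℝ}

section Separability

theorem dampExp_ne_top : dampExp r ≠ ∞ := by simp [dampExp]

instance : Fact (dampExp r ≠ ∞) := ⟨dampExp_ne_top⟩

instance : Fact ((2 : ℝ≥0∞) ≠ ∞) := ⟨by norm_num⟩

instance : SecondCountableTopology (LpField O 2) := inferInstance

instance : SecondCountableTopology (L2Grad O) := inferInstance

instance : SecondCountableTopology (WSpace O r) :=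
  TopologicalSpace.Subtype.secondCountableTopology _

end Separability

/-! ### Measurability of integral functionals of time dependent fields. -/

section Lsc

variable {α E F : Type*} {m : MeasurableSpace α} {ν : Measure α} [NormedAddCommGroup E]
  [NormedAddCommGroup F] {p q : ℝ≥0∞} [Fact (1 ≤ p)] [Fact (1 ≤ q)]

/-- Integral functionals with a nonnegative continuous integrand are lower semicontinuous. -/
theorem lowerSemicontinuous_lintegral {h : E × F → ℝ≥0∞} (hh : Continuous h) :
    LowerSemicontinuous fun w : Lp E p ν × Lp F q ν => ∫⁻ x, h (w.1 x, w.2 x) ∂ν := by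
  rw [lowerSemicontinuous_iff_isClosed_preimage]
  intro y
  refine IsSeqClosed.isClosed fun w w₀ hw hlim => ?_
  obtain ⟨hl₁, hl₂⟩ := (Prod.tendsto_iff _ _).1 hlim
  obtain ⟨n₁, hn₁, h₁⟩ := (tendstoInMeasure_of_tendsto_Lp hl₁).exists_seq_tendsto_ae
  obtain ⟨n₂, hn₂, h₂⟩ := (tendstoInMeasure_of_tendsto_Lp
    (hl₂.comp hn₁.tendsto_atTop)).exists_seq_tendsto_ae
  have hae : ∀ᵐ x ∂ν, h (w₀.1 x, w₀.2 x)
      ≤ liminf (fun i => h ((w (n₁ (n₂ i))).1 x, (w (n₁ (n₂ i))).2 x)) atTop := by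
    filter_upwards [h₁, h₂] with x hx₁ hx₂
    have : Tendsto (fun i => h ((w (n₁ (n₂ i))).1 x, (w (n₁ (n₂ i))).2 x)) atTop
        (𝓝 (h (w₀.1 x, w₀.2 x))) :=
      (hh.tendsto _).comp ((hx₁.comp hn₂.tendsto_atTop).prodMk_nhds hx₂)
    exact this.liminf_eq.ge
  refine (lintegral_mono_ae hae).trans ((lintegral_liminf_le' fun i => ?_).trans ?_)
  · exact (hh.comp_aestronglyMeasurable
      ((Lp.aestronglyMeasurable _).prodMk (Lp.aestronglyMeasurable _))).aemeasurable
  · exact liminf_le_of_frequently_le' (Frequently.of_forall fun i => hw (n₁ (n₂ i)))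

variable {β : Type*} {mβ : MeasurableSpace β} {κ : Measure β} {u : β → Lp E p ν} {v : β → Lp F q ν}

theorem aemeasurable_lintegral {h : E × F → ℝ≥0∞} (hh : Continuous h)
    (hu : AEStronglyMeasurable u κ) (hv : AEStronglyMeasurable v κ) :
    AEMeasurable (fun s => ∫⁻ x, h (u s x, v s x) ∂ν) κ := by
  borelize (Lp E p ν × Lp F q ν)
  exact (lowerSemicontinuous_lintegral hh).measurable.comp_aemeasurable
    (hu.prodMk hv).aemeasurable

/-- The functional need not be continuous on `Lᵖ × L^q`, but the integrals of the positive and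
negative parts of the integrand are lower semicontinuous, hence Borel. -/
theorem aestronglyMeasurable_integral {h : E × F → ℝ} (hh : Continuous h)
    (hu : AEStronglyMeasurable u κ) (hv : AEStronglyMeasurable v κ)
    (hi : ∀ᵐ s ∂κ, Integrable (fun x => h (u s x, v s x)) ν) :
    AEStronglyMeasurable (fun s => ∫ x, h (u s x, v s x) ∂ν) κ := by
  have h1 := (aemeasurable_lintegral (ν := ν) (h := fun y => ENNReal.ofReal (h y))
    (ENNReal.continuous_ofReal.comp hh) hu hv).ennreal_toReal
  have h2 := (aemeasurable_lintegral (ν := ν) (h := fun y => ENNReal.ofReal (-h y))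
    (ENNReal.continuous_ofReal.comp hh.neg) hu hv).ennreal_toReal
  refine (h1.sub h2).aestronglyMeasurable.congr ?_
  filter_upwards [hi] with s hs
  exact (integral_eq_lintegral_pos_part_sub_lintegral_neg_part hs).symm

end Lsc

/-! ### Pointwise algebra of the trilinear form and of the damping. -/

section Pointwise

/-- The integrand of `triForm`. -/
noncomputable def triVal (u : Ed d) (G : GradVal d) (w : Ed d) : ℝ :=
  ∑ i : Fin d, ∑ j : Fin d, u i * G i j * w j

/-- The vector `(∑ j, G i j * w j)ᵢ`. -/
noncomputable def contract (G : GradVal d) (w : Ed d) : Ed d :=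
  WithLp.toLp 2 fun i => inner ℝ (G i) w

theorem triVal_eq (u : Ed d) (G : GradVal d) (w : Ed d) :
    triVal u G w = inner ℝ u (contract G w) := by
  simp only [triVal, contract, PiLp.inner_apply, RCLike.inner_apply, conj_trivial, Finset.sum_mul]
  exact Finset.sum_congr rfl fun i _ => Finset.sum_congr rfl fun j _ => by ring

theorem norm_contract_le (G : GradVal d) (w : Ed d) : ‖contract G w‖ ≤ ‖G‖ * ‖w‖ := by
  refine le_of_sq_le_sq ?_ (by positivity)
  rw [mul_pow, PiLp.norm_sq_eq_of_L2, PiLp.norm_sq_eq_of_L2, Finset.sum_mul]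
  refine Finset.sum_le_sum fun i _ => ?_
  rw [← mul_pow, Real.norm_eq_abs, sq_abs, ← sq_abs]
  exact pow_le_pow_left₀ (abs_nonneg _) (abs_real_inner_le_norm _ _) 2

theorem abs_triVal_le (u : Ed d) (G : GradVal d) (w : Ed d) :
    |triVal u G w| ≤ ‖u‖ * (‖G‖ * ‖w‖) := by
  rw [triVal_eq]
  exact (abs_real_inner_le_norm _ _).trans
    (mul_le_mul_of_nonneg_left (norm_contract_le G w) (norm_nonneg _))

theorem triVal_add_left (u u' : Ed d) (G : GradVal d) (w : Ed d) :
    triVal (u + u') G w = triVal u G w + triVal u' G w := by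
  simp only [triVal_eq, inner_add_left]

theorem contract_add_right (G : GradVal d) (w w' : Ed d) :
    contract G (w + w') = contract G w + contract G w' := by
  ext i; simp [contract, inner_add_right]

theorem contract_add_left (G G' : GradVal d) (w : Ed d) :
    contract (G + G') w = contract G w + contract G' w := by
  ext i; simp [contract, inner_add_left]

theorem triVal_add_right (u : Ed d) (G : GradVal d) (w w' : Ed d) :
    triVal u G (w + w') = triVal u G w + triVal u G w' := by
  simp only [triVal_eq, contract_add_right, inner_add_right]

theorem triVal_add_mid (u : Ed d) (G G' : GradVal d) (w : Ed d) :
    triVal u (G + G') w = triVal u G w + triVal u G' w := by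
  simp only [triVal_eq, contract_add_left, inner_add_right]

theorem continuous_contract : Continuous fun y : GradVal d × Ed d => contract y.1 y.2 := by
  unfold contract
  fun_prop

theorem continuous_triVal : Continuous fun y : (Ed d × GradVal d) × Ed d =>
    triVal y.1.1 y.1.2 y.2 := by
  simp only [triVal_eq]
  exact continuous_fst.fst.inner (continuous_contract.comp (by fun_prop :
    Continuous fun y : (Ed d × GradVal d) × Ed d => (y.1.2, y.2)))

/-- The right side equals `½(|a|^{r-1} + |b|^{r-1})|a-b|² + ½(|a|^{r-1} - |b|^{r-1})(|a|² - |b|²)`,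
whose last term is nonnegative by monotonicity of the powers. -/
theorem damping_monotone {E : Type*} [NormedAddCommGroup E] [InnerProductSpace ℝ E] (hr : 1 ≤ r)
    (a b : E) : 1 / 2 * ‖b‖ ^ (r - 1) * ‖a - b‖ ^ 2
      ≤ ‖a‖ ^ (r - 1) * inner ℝ a (a - b) - ‖b‖ ^ (r - 1) * inner ℝ b (a - b) := by
  have hA : 0 ≤ ‖a‖ ^ (r - 1) := by positivity
  have hm : 0 ≤ (‖a‖ ^ (r - 1) - ‖b‖ ^ (r - 1)) * (‖a‖ ^ 2 - ‖b‖ ^ 2) := by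
    rcases le_total ‖a‖ ‖b‖ with h | h
    · exact mul_nonneg_of_nonpos_of_nonpos
        (sub_nonpos.2 (Real.rpow_le_rpow (norm_nonneg _) h (by linarith)))
        (sub_nonpos.2 (pow_le_pow_left₀ (norm_nonneg _) h 2))
    · exact mul_nonneg (sub_nonneg.2 (Real.rpow_le_rpow (norm_nonneg _) h (by linarith)))
        (sub_nonneg.2 (pow_le_pow_left₀ (norm_nonneg _) h 2))
  have h1 : ‖a - b‖ ^ 2 = ‖a‖ ^ 2 - 2 * inner ℝ a b + ‖b‖ ^ 2 := norm_sub_sq_real a b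
  rw [inner_sub_right, inner_sub_right, real_inner_self_eq_norm_sq, real_inner_self_eq_norm_sq,
    real_inner_comm a b]
  have h2 : 0 ≤ ‖a‖ ^ (r - 1) * ‖a - b‖ ^ 2 := by positivity
  rw [h1] at h2 ⊢
  nlinarith

end Pointwise

end SCBF


namespace SCBF

variable {d : ℕ} {O : Set (Ed d)} {r : ℝ}

/-! ### Hölder bounds for the trilinear form. -/

section Holder

variable {α : Type*} {m : MeasurableSpace α} {ν : Measure α} {p s : ℝ≥0∞}

instance holderTriple_four : ENNReal.HolderTriple 4 4 2 := ⟨by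
  have : (4 : ℝ≥0∞) = 2 * 2 := by norm_num
  rw [this, ENNReal.mul_inv (by norm_num) (by norm_num), ← two_mul, ← mul_assoc,
    ENNReal.mul_inv_cancel (by norm_num) (by norm_num), one_mul]⟩

theorem aestronglyMeasurable_contract {G : α → GradVal d} {w : α → Ed d}
    (hG : AEStronglyMeasurable G ν) (hw : AEStronglyMeasurable w ν) :
    AEStronglyMeasurable (fun x => contract (G x) (w x)) ν :=
  Continuous.comp_aestronglyMeasurable (g := fun y : GradVal d × Ed d => contract y.1 y.2)
    (f := fun x => (G x, w x)) continuous_contract (hG.prodMk hw)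

theorem aestronglyMeasurable_triVal {u : α → Ed d} {G : α → GradVal d} {w : α → Ed d}
    (hu : AEStronglyMeasurable u ν) (hG : AEStronglyMeasurable G ν)
    (hw : AEStronglyMeasurable w ν) :
    AEStronglyMeasurable (fun x => triVal (u x) (G x) (w x)) ν := by
  simp only [triVal_eq]
  exact hu.inner (aestronglyMeasurable_contract hG hw)

theorem lintegral_triVal_le [ENNReal.HolderTriple p s 2] {u : α → Ed d} {G : α → GradVal d}
    {w : α → Ed d} (hu : AEStronglyMeasurable u ν) (hG : AEStronglyMeasurable G ν)
    (hw : AEStronglyMeasurable w ν) : ∫⁻ x, ‖triVal (u x) (G x) (w x)‖ₑ ∂ν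
      ≤ eLpNorm G 2 ν * (eLpNorm u p ν * eLpNorm w s ν) := by
  have h1 : eLpNorm (fun x => ‖u x‖ * ‖w x‖) 2 ν ≤ eLpNorm u p ν * eLpNorm w s ν := by
    have := eLpNorm_le_eLpNorm_mul_eLpNorm_of_nnnorm (p := p) (q := s) (r := 2) hu hw
      (fun (a b : Ed d) => ‖a‖ * ‖b‖) 1 (ae_of_all _ fun x => by
        rw [one_mul, nnnorm_mul, nnnorm_norm, nnnorm_norm])
    simpa using this
  have h2 := lintegral_mul_norm_le (p' := 2) (p := 2) (ν := ν) hG.norm (hu.norm.mul hw.norm)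
  rw [eLpNorm_norm] at h2
  refine (lintegral_mono fun x => ?_).trans (h2.trans (mul_le_mul_right h1 _))
  rw [enorm_le_iff_norm_le, Real.norm_eq_abs, Real.norm_eq_abs]
  refine (abs_triVal_le _ _ _).trans (le_of_eq ?_)
  rw [Pi.mul_apply, Real.norm_of_nonneg (by positivity), abs_of_nonneg (by positivity)]
  ring

theorem integrable_triVal [ENNReal.HolderTriple p s 2] {u : α → Ed d} {G : α → GradVal d}
    {w : α → Ed d} (hu : MemLp u p ν) (hG : MemLp G 2 ν) (hw : MemLp w s ν) :
    Integrable (fun x => triVal (u x) (G x) (w x)) ν :=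
  ⟨aestronglyMeasurable_triVal hu.1 hG.1 hw.1, (lintegral_triVal_le (p := p) (s := s)
    hu.1 hG.1 hw.1).trans_lt (ENNReal.mul_lt_top hG.2 (ENNReal.mul_lt_top hu.2 hw.2))⟩

theorem abs_integral_triVal_le [ENNReal.HolderTriple p s 2] {u : α → Ed d} {G : α → GradVal d}
    {w : α → Ed d} (hu : MemLp u p ν) (hG : MemLp G 2 ν) (hw : MemLp w s ν) :
    |∫ x, triVal (u x) (G x) (w x) ∂ν| ≤ (eLpNorm G 2 ν).toReal
      * ((eLpNorm u p ν).toReal * (eLpNorm w s ν).toReal) := by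
  rw [← ENNReal.toReal_mul, ← ENNReal.toReal_mul, ← Real.norm_eq_abs]
  refine (norm_integral_le_lintegral_norm _).trans (ENNReal.toReal_mono
    (ENNReal.mul_ne_top hG.2.ne (ENNReal.mul_ne_top hu.2.ne hw.2.ne)) ?_)
  simp only [ofReal_norm]
  exact lintegral_triVal_le hu.1 hG.1 hw.1

end Holder

/-! ### The cancellation `b(u, w, w) = 0`. -/

section Antisymmetry

/-- The integrand is `½ φ · ∇|ψ|²`; integration by parts moves the derivative to `div φ = 0`. -/
theorem integral_inner_contract_gradField {φ ψ : Ed d → Ed d} (hφ : IsTestField O φ)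
    (hψ : IsSmoothCompact O ψ) : ∫ x, triVal (φ x) (gradField ψ x) (ψ x) = 0 := by
  have hφd : Differentiable ℝ φ := hφ.toIsSmoothCompact.differentiable
  have hψd : Differentiable ℝ ψ := hψ.differentiable
  let g : Ed d → ℝ := fun x => ‖ψ x‖ ^ 2
  have hgc : ContDiff ℝ 1 g := (hψ.smooth.of_le (by exact_mod_cast le_top)).norm_sq ℝ
  have hgd : Differentiable ℝ g := hgc.differentiable one_ne_zero
  have hgs : HasCompactSupport g := hψ.compact.comp_left (g := fun y : Ed d => ‖y‖ ^ 2) (by simp)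
  have hφi : ∀ i, ContDiff ℝ 1 fun x => φ x i := fun i =>
    (contDiff_euclidean.1 (hφ.smooth.of_le (by exact_mod_cast le_top))) i
  have hφis : ∀ i, HasCompactSupport fun x => φ x i := fun i =>
    hφ.compact.comp_left (g := fun y : Ed d => y i) rfl
  have hfd : ∀ (i : Fin d) x, fderiv ℝ (fun x => φ x i) x (EuclideanSpace.single i 1)
      = gradField φ x i i := by
    intro i x
    have h1 : HasFDerivAt (fun x => φ x i) ((EuclideanSpace.proj (𝕜 := ℝ) i).comp (fderiv ℝ φ x)) x :=
      (EuclideanSpace.proj (𝕜 := ℝ) i).hasFDerivAt.comp x (hφd x).hasFDerivAt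
    rw [h1.fderiv]
    rfl
  have hgf : ∀ (i : Fin d) x, fderiv ℝ g x (EuclideanSpace.single i 1)
      = 2 * inner ℝ (gradField ψ x i) (ψ x) := by
    intro i x
    have h1 := ((hψd x).hasFDerivAt.norm_sq)
    rw [h1.fderiv]
    simp [gradField, real_inner_comm]
  have hcont : ∀ i, Continuous fun x => fderiv ℝ g x (EuclideanSpace.single i 1) := fun i =>
    (hgc.continuous_fderiv one_ne_zero).clm_apply continuous_const
  have hcont' : ∀ i, Continuous fun x => fderiv ℝ (fun x => φ x i) x (EuclideanSpace.single i 1) :=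
    fun i => ((hφi i).continuous_fderiv one_ne_zero).clm_apply continuous_const
  have i1 : ∀ i, Integrable fun x => fderiv ℝ (fun x => φ x i) x (EuclideanSpace.single i 1) * g x :=
    fun i => ((hcont' i).mul hgc.continuous).integrable_of_hasCompactSupport hgs.mul_left
  have i2 : ∀ i, Integrable fun x => φ x i * fderiv ℝ g x (EuclideanSpace.single i 1) :=
    fun i => ((hφi i).continuous.mul (hcont i)).integrable_of_hasCompactSupport (hφis i).mul_right
  have i3 : ∀ i, Integrable fun x => φ x i * g x :=
    fun i => ((hφi i).continuous.mul hgc.continuous).integrable_of_hasCompactSupport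
      (hφis i).mul_right
  have key : ∀ i, ∫ x, φ x i * fderiv ℝ g x (EuclideanSpace.single i 1)
      = -∫ x, fderiv ℝ (fun x => φ x i) x (EuclideanSpace.single i 1) * g x := fun i =>
    integral_mul_fderiv_eq_neg_fderiv_mul_of_integrable (i1 i) (i2 i) (i3 i)
      (fun x _ => (hφi i).differentiable one_ne_zero x) fun x _ => hgd x
  have e1 : ∀ x, triVal (φ x) (gradField ψ x) (ψ x)
      = 1 / 2 * ∑ i, φ x i * fderiv ℝ g x (EuclideanSpace.single i 1) := by
    intro x
    rw [triVal_eq, Finset.mul_sum]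
    simp only [contract, PiLp.inner_apply, RCLike.inner_apply, conj_trivial, hgf]
    exact Finset.sum_congr rfl fun i _ => by ring
  simp only [e1]
  rw [integral_const_mul, integral_finsetSum _ fun i _ => i2 i]
  simp only [key]
  rw [Finset.sum_neg_distrib, ← integral_finsetSum _ fun i _ => i1 i]
  have e2 : ∀ x, ∑ i, fderiv ℝ (fun x => φ x i) x (EuclideanSpace.single i 1) * g x = 0 := by
    intro x
    simp only [hfd]
    rw [← Finset.sum_mul]
    have : ∑ i, gradField φ x i i = 0 := hφ.div_free x
    rw [this, zero_mul]
  simp [e2]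

theorem setIntegral_triVal_gradField {φ ψ : Ed d → Ed d} (hφ : IsTestField O φ)
    (hψ : IsSmoothCompact O ψ) : ∫ x in O, triVal (φ x) (gradField ψ x) (ψ x) = 0 := by
  rw [setIntegral_eq_integral_of_forall_compl_eq_zero, integral_inner_contract_gradField hφ hψ]
  intro x hx
  have : φ x = 0 := image_eq_zero_of_notMem_tsupport fun h => hx (hφ.support h)
  rw [this, triVal_eq, inner_zero_left]



instance holderTriple_top_two : ENNReal.HolderTriple ∞ 2 2 := ⟨by simp⟩

theorem continuous_integral_triVal {φ : Ed d → Ed d} (hφ : MemLp φ ∞ (volume.restrict O)) :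
    Continuous fun w : LpField O 2 × L2Grad O => ∫ x in O, triVal (φ x) (w.2 x) (w.1 x) := by
  rw [continuous_iff_continuousAt]
  intro w₀
  rw [ContinuousAt, tendsto_iff_norm_sub_tendsto_zero]
  set M := (eLpNorm φ ∞ (volume.restrict O)).toReal
  have hb : ∀ w : LpField O 2 × L2Grad O,
      ‖(∫ x in O, triVal (φ x) (w.2 x) (w.1 x)) - ∫ x in O, triVal (φ x) (w₀.2 x) (w₀.1 x)‖
      ≤ ‖w.2 - w₀.2‖ * (M * ‖w.1‖) + ‖w₀.2‖ * (M * ‖w.1 - w₀.1‖) := by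
    intro w
    have i1 := integrable_triVal hφ (Lp.memLp w.2) (Lp.memLp w.1)
    have i0 := integrable_triVal hφ (Lp.memLp w₀.2) (Lp.memLp w₀.1)
    have i2 := integrable_triVal hφ (Lp.memLp (w.2 - w₀.2)) (Lp.memLp w.1)
    have i3 := integrable_triVal hφ (Lp.memLp w₀.2) (Lp.memLp (w.1 - w₀.1))
    have e : (∫ x in O, triVal (φ x) (w.2 x) (w.1 x)) - ∫ x in O, triVal (φ x) (w₀.2 x) (w₀.1 x)
        = (∫ x in O, triVal (φ x) ((w.2 - w₀.2 : L2Grad O) x) (w.1 x))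
          + ∫ x in O, triVal (φ x) (w₀.2 x) ((w.1 - w₀.1 : LpField O 2) x) := by
      rw [← integral_sub i1 i0, ← integral_add i2 i3]
      refine integral_congr_ae ?_
      filter_upwards [Lp.coeFn_sub w.2 w₀.2, Lp.coeFn_sub w.1 w₀.1] with x h1 h2
      have h3 : w.2 x = (w.2 - w₀.2 : L2Grad O) x + w₀.2 x := by rw [h1]; simp
      have h4 : w.1 x = (w.1 - w₀.1 : LpField O 2) x + w₀.1 x := by rw [h2]; simp
      have h5 := triVal_add_mid (φ x) ((w.2 - w₀.2 : L2Grad O) x) (w₀.2 x) (w.1 x)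
      have h6 := triVal_add_right (φ x) (w₀.2 x) ((w.1 - w₀.1 : LpField O 2) x) (w₀.1 x)
      rw [← h3] at h5
      rw [← h4] at h6
      rw [h5, h6]
      ring
    rw [e]
    refine (norm_add_le _ _).trans (add_le_add ?_ ?_)
    · simpa only [Real.norm_eq_abs, Lp.norm_def] using
        abs_integral_triVal_le hφ (Lp.memLp (w.2 - w₀.2)) (Lp.memLp w.1)
    · simpa only [Real.norm_eq_abs, Lp.norm_def] using
        abs_integral_triVal_le hφ (Lp.memLp w₀.2) (Lp.memLp (w.1 - w₀.1))
  refine squeeze_zero (fun _ => norm_nonneg _) hb ?_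
  have : Continuous fun w : LpField O 2 × L2Grad O =>
    ‖w.2 - w₀.2‖ * (M * ‖w.1‖) + ‖w₀.2‖ * (M * ‖w.1 - w₀.1‖) := by fun_prop
  simpa using this.tendsto w₀

/-- `b(φ, w, w) = 0` for test fields `φ` and `w ∈ 𝕍`. -/
theorem integral_triVal_testField {φ : Ed d → Ed d} (hφ : IsTestField O φ) (w : VSpace O) :
    ∫ x in O, triVal (φ x) (vGrad w x) (vField w x) = 0 := by
  refine vSpace_induction (P := fun w => ∫ x in O, triVal (φ x) (w.2 x) (w.1 x) = 0)
    (isClosed_eq (continuous_integral_triVal (hφ.memLp ∞)) continuous_const) ?_ w.2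
  intro w ψ hψ hw
  rw [← setIntegral_triVal_gradField hφ hψ.toIsSmoothCompact]
  refine integral_congr_ae ?_
  filter_upwards [hw.1, hw.2] with x h1 h2
  rw [h1, h2]

/-- `b(u, w, w) = 0` for `u ∈ L̃ᵖ` and `w ∈ 𝕍`, if the product of `w` and `∇w` is in the dual
Lebesgue space. -/
theorem integral_triVal_self {p p' : ℝ≥0∞} [Fact (1 ≤ p)] [Fact (1 ≤ p')]
    [ENNReal.HolderConjugate p' p] (w : VSpace O)
    (hF : MemLp (fun x => contract (vGrad w x) (vField w x)) p' (volume.restrict O))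
    {u : LpField O p} (hu : u ∈ Ltilde O p) :
    ∫ x in O, triVal (u x) (vGrad w x) (vField w x) = 0 := by
  let Λ : LpField O p →L[ℝ] ℝ := (innerSL ℝ (E := Ed d)).lpPairing (volume.restrict O) p' p
    (hF.toLp _)
  have hΛ : ∀ u : LpField O p, Λ u = ∫ x in O, triVal (u x) (vGrad w x) (vField w x) := by
    intro u
    rw [ContinuousLinearMap.lpPairing_eq_integral]
    refine integral_congr_ae ?_
    filter_upwards [hF.coeFn_toLp] with x hx
    rw [triVal_eq, real_inner_comm, hx]
    rfl
  have hle : Ltilde O p ≤ LinearMap.ker Λ.toLinearMap := by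
    refine ltilde_le (ContinuousLinearMap.isClosed_ker Λ) fun u φ hφ hu => ?_
    show Λ u = 0
    rw [hΛ, ← integral_triVal_testField hφ w]
    refine integral_congr_ae ?_
    filter_upwards [hu] with x hx
    rw [hx]
  rw [← hΛ]
  exact hle hu

end Antisymmetry

end SCBF


namespace SCBF

variable {d : ℕ} {O : Set (Ed d)} {r : ℝ}

/-! ### Moments and intermediate Lebesgue exponents. -/

section Moments

variable {α E : Type*} {m : MeasurableSpace α} {ν : Measure α} [NormedAddCommGroup E]

theorem eLpNorm_rpow_toReal {p : ℝ≥0∞} (hp0 : p ≠ 0) (hp : p ≠ ∞) (u : α → E) :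
    eLpNorm u p ν ^ p.toReal = ∫⁻ x, ‖u x‖ₑ ^ p.toReal ∂ν := by
  rw [eLpNorm_eq_lintegral_rpow_enorm_toReal hp0 hp, ← ENNReal.rpow_mul,
    one_div, inv_mul_cancel₀ (ENNReal.toReal_pos hp0 hp).ne', ENNReal.rpow_one]

theorem rpow_le_add_rpow {a b c : ℝ} (hab : a ≤ b) (hbc : b ≤ c) (y : ℝ≥0∞) :
    y ^ b ≤ y ^ a + y ^ c := by
  rcases le_total y 1 with h | h
  · exact (ENNReal.rpow_le_rpow_of_exponent_ge h hab).trans le_self_add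
  · exact (ENNReal.rpow_le_rpow_of_exponent_le h hbc).trans le_add_self

theorem lintegral_rpow_le_add {a b c : ℝ} (hab : a ≤ b) (hbc : b ≤ c) {u : α → E}
    (hu : AEStronglyMeasurable u ν) :
    ∫⁻ x, ‖u x‖ₑ ^ b ∂ν ≤ (∫⁻ x, ‖u x‖ₑ ^ a ∂ν) + ∫⁻ x, ‖u x‖ₑ ^ c ∂ν := by
  rw [← lintegral_add_left' (hu.enorm.pow_const _)]
  exact lintegral_mono fun x => rpow_le_add_rpow hab hbc _

theorem memLp_of_lintegral_rpow_lt_top {p : ℝ≥0∞} (hp0 : p ≠ 0) (hp : p ≠ ∞) {u : α → E}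
    (hu : AEStronglyMeasurable u ν) (h : ∫⁻ x, ‖u x‖ₑ ^ p.toReal ∂ν < ∞) : MemLp u p ν :=
  ⟨hu, (eLpNorm_lt_top_iff_lintegral_rpow_enorm_lt_top hp0 hp).2 h⟩

/-- `L² ∩ L⁴ ⊆ L^p` for `2 ≤ p ≤ 4`, and more generally for intermediate exponents. -/
theorem memLp_of_memLp_of_memLp {a b c : ℝ≥0∞} (ha : a ≠ 0) (hc : c ≠ ∞) (hab : a ≤ b)
    (hbc : b ≤ c) {u : α → E} (h1 : MemLp u a ν) (h2 : MemLp u c ν) : MemLp u b ν := by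
  have hb0 : b ≠ 0 := (lt_of_lt_of_le (pos_iff_ne_zero.2 ha) hab).ne'
  have hb : b ≠ ∞ := (lt_of_le_of_lt hbc hc.lt_top).ne
  have hc0 : c ≠ 0 := (lt_of_lt_of_le (pos_iff_ne_zero.2 hb0) hbc).ne'
  have ha' : a ≠ ∞ := (lt_of_le_of_lt hab hb.lt_top).ne
  refine memLp_of_lintegral_rpow_lt_top hb0 hb h1.1 ((lintegral_rpow_le_add
    (ENNReal.toReal_mono hb hab) (ENNReal.toReal_mono hc hbc) h1.1).trans_lt
      (ENNReal.add_lt_top.2 ⟨?_, ?_⟩))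
  · exact (eLpNorm_lt_top_iff_lintegral_rpow_enorm_lt_top ha ha').1 h1.2
  · exact (eLpNorm_lt_top_iff_lintegral_rpow_enorm_lt_top hc0 hc).1 h2.2

end Moments

/-! ### Ladyzhenskaya's inequality in the plane. -/

section Ladyzhenskaya

theorem norm_fderiv_le_norm_gradField (φ : Ed d → Ed d) (x : Ed d) :
    ‖fderiv ℝ φ x‖ ≤ ‖gradField φ x‖ := by
  refine ContinuousLinearMap.opNorm_le_bound _ (norm_nonneg _) fun v => ?_
  set L := fderiv ℝ φ x with hL
  have hv : v = ∑ i, v i • EuclideanSpace.single i (1 : ℝ) := by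
    ext j
    simp [Finset.sum_apply, Pi.single_apply]
  have h1 : inner ℝ (L v) (L v) = triVal v (gradField φ x) (L v) := by
    have hLv : L v = ∑ i, v i • L (EuclideanSpace.single i 1) := by
      conv_lhs => rw [hv]
      rw [map_sum]
      simp only [map_smul]
    have e : inner ℝ (L v) (L v) = inner ℝ (∑ i, v i • L (EuclideanSpace.single i 1)) (L v) := by
      rw [← hLv]
    rw [e, sum_inner, triVal_eq, PiLp.inner_apply]
    refine Finset.sum_congr rfl fun i _ => ?_
    rw [real_inner_smul_left, RCLike.inner_apply, conj_trivial, mul_comm]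
    rfl
  have h2 := abs_triVal_le v (gradField φ x) (L v)
  rw [← h1, real_inner_self_eq_norm_sq, abs_of_nonneg (by positivity)] at h2
  rcases eq_or_lt_of_le (norm_nonneg (L v)) with h | h
  · rw [← h]; positivity
  · nlinarith [norm_nonneg v, norm_nonneg (gradField φ x)]

/-- Ladyzhenskaya's inequality in two dimensions, for smooth fields. -/
theorem exists_eLpNorm_four_le : ∃ C : ℝ≥0, ∀ φ : Ed 2 → Ed 2, ContDiff ℝ 1 φ →
    HasCompactSupport φ → eLpNorm φ 4 volume ^ (2 : ℝ)
      ≤ C * (eLpNorm φ 2 volume * eLpNorm (gradField φ) 2 volume) := by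
  have hconj : NNReal.HolderConjugate (Module.finrank ℝ (Ed 2) : ℝ≥0) 2 := by
    rw [finrank_euclideanSpace_fin]
    exact NNReal.HolderConjugate.two_two
  refine ⟨eLpNormLESNormFDerivOneConst (volume : Measure (Ed 2)) ((2 : ℝ≥0) : ℝ) * 2,
    fun φ hφ hs => ?_⟩
  have hd : Differentiable ℝ φ := hφ.differentiable one_ne_zero
  have hg : ContDiff ℝ 1 fun x => ‖φ x‖ ^ 2 := hφ.norm_sq ℝ
  have hgs : HasCompactSupport fun x => ‖φ x‖ ^ 2 :=
    hs.comp_left (g := fun y : Ed 2 => ‖y‖ ^ 2) (by simp)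
  have hgr : Continuous (gradField φ) :=
    (gradCLM 2).continuous.comp (hφ.continuous_fderiv one_ne_zero)
  -- The Gagliardo-Nirenberg-Sobolev inequality from `W^{1,1}` to `L²` is applied to `|φ|²`, whose
  -- gradient is at most `2 |φ| |∇φ|`.
  have h1 := eLpNorm_le_eLpNorm_fderiv_one (volume : Measure (Ed 2)) hg hgs hconj
  have h2 : eLpNorm (fun x => ‖φ x‖ ^ 2) ((2 : ℝ≥0) : ℝ≥0∞) volume
      = eLpNorm φ 4 volume ^ (2 : ℝ) := by
    have := eLpNorm_norm_rpow (p := 2) (μ := volume) φ (q := 2) (by norm_num)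
    rw [show (2 : ℝ≥0∞) * ENNReal.ofReal 2 = 4 by norm_num] at this
    rw [← this]
    simp
  have h3 : eLpNorm (fderiv ℝ fun x => ‖φ x‖ ^ 2) 1 volume
      ≤ 2 * (eLpNorm φ 2 volume * eLpNorm (gradField φ) 2 volume) := by
    have h4 := lintegral_mul_norm_le (p' := 2) (p := 2) (ν := (volume : Measure (Ed 2)))
      hφ.continuous.aestronglyMeasurable.norm hgr.aestronglyMeasurable
    rw [eLpNorm_norm] at h4
    refine le_trans ?_ (mul_le_mul_right h4 2)
    rw [eLpNorm_one_eq_lintegral_enorm, ← lintegral_const_mul' _ _ (by norm_num)]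
    refine lintegral_mono fun x => ?_
    have h5 : ‖fderiv ℝ (fun x => ‖φ x‖ ^ 2) x‖ ≤ ‖2 * (‖φ x‖ * ‖gradField φ x‖)‖ := by
      rw [((hd x).hasFDerivAt.norm_sq).fderiv, ← Nat.cast_smul_eq_nsmul ℝ, norm_smul, norm_mul,
        Nat.cast_two]
      refine mul_le_mul_of_nonneg_left ?_ (norm_nonneg _)
      rw [norm_mul, norm_norm, norm_norm]
      refine (ContinuousLinearMap.opNorm_comp_le _ _).trans ?_
      rw [innerSL_apply_norm]
      exact mul_le_mul_of_nonneg_left (norm_fderiv_le_norm_gradField φ x) (norm_nonneg _)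
    rw [← enorm_le_iff_norm_le, enorm_mul] at h5
    refine h5.trans (le_of_eq ?_)
    congr 1
    simp [enorm_eq_nnnorm]
  rw [← h2, ENNReal.coe_mul, mul_assoc]
  exact h1.trans (mul_le_mul_right h3 _)

theorem IsSmoothCompact.eLpNorm_restrict {φ : Ed d → Ed d} (h : IsSmoothCompact O φ) (p : ℝ≥0∞) :
    eLpNorm φ p (volume.restrict O) = eLpNorm φ p volume :=
  eLpNorm_restrict_eq_of_support_subset ((subset_tsupport φ).trans h.support)

theorem IsSmoothCompact.eLpNorm_gradField_restrict {φ : Ed d → Ed d} (h : IsSmoothCompact O φ)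
    (p : ℝ≥0∞) : eLpNorm (gradField φ) p (volume.restrict O) = eLpNorm (gradField φ) p volume := by
  refine eLpNorm_restrict_eq_of_support_subset fun x hx => h.support ?_
  by_contra hn
  refine hx ?_
  rw [gradField_eq, image_eq_zero_of_notMem_tsupport (f := fderiv ℝ φ)
    fun h' => hn (tsupport_fderiv_subset ℝ h'), map_zero]

/-- Ladyzhenskaya's inequality in two dimensions, on `𝕍`. -/
theorem exists_lintegral_four_le : ∃ C : ℝ≥0, ∀ {O : Set (Ed 2)} (w : VSpace O),
    ∫⁻ x in O, ‖vField w x‖ₑ ^ (4 : ℝ)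
      ≤ ENNReal.ofReal (C * (‖vField w‖ ^ 2 * ‖vGrad w‖ ^ 2)) := by
  obtain ⟨C, hC⟩ := exists_eLpNorm_four_le
  refine ⟨C ^ 2, fun {O} w => ?_⟩
  obtain ⟨W, φ, hW, hlim⟩ := exists_seq_tendsto w.2
  have hle : ∀ n, ∫⁻ x in O, ‖(W n).1 x‖ₑ ^ (4 : ℝ)
      ≤ ENNReal.ofReal (((C ^ 2 : ℝ≥0) : ℝ) * (‖(W n).1‖ ^ 2 * ‖(W n).2‖ ^ 2)) := by
    intro n
    obtain ⟨hφ, h1, h2⟩ := hW n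
    have hφ := hφ.toIsSmoothCompact
    have h3 := hC (φ n) (hφ.smooth.of_le (by exact_mod_cast le_top)) hφ.compact
    rw [← hφ.eLpNorm_restrict, ← hφ.eLpNorm_restrict, ← hφ.eLpNorm_gradField_restrict,
      ← eLpNorm_congr_ae h1, ← eLpNorm_congr_ae h1, ← eLpNorm_congr_ae h2, ← Lp.enorm_def,
      ← Lp.enorm_def] at h3
    have h4 := eLpNorm_rpow_toReal (p := 4) (ν := volume.restrict O) (by norm_num) (by norm_num)
      ((W n).1 : Ed 2 → Ed 2)
    rw [show (4 : ℝ≥0∞).toReal = 4 by norm_num] at h4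
    rw [← h4, show (4 : ℝ) = 2 * 2 by norm_num, ENNReal.rpow_mul]
    refine (ENNReal.rpow_le_rpow h3 (by norm_num)).trans (le_of_eq ?_)
    rw [← ofReal_norm, ← ofReal_norm, ← ENNReal.ofReal_mul (norm_nonneg _),
      ← ENNReal.ofReal_coe_nnreal, ← ENNReal.ofReal_mul (by positivity),
      ENNReal.ofReal_rpow_of_nonneg (by positivity) (by norm_num)]
    congr 1
    rw [Real.rpow_two, NNReal.coe_pow]
    ring
  have hlsc := lowerSemicontinuous_lintegral (ν := (volume : Measure (Ed 2)).restrict O)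
    (E := Ed 2) (F := GradVal 2) (p := 2) (q := 2)
    (h := fun y => ‖y.1‖ₑ ^ (4 : ℝ)) (by fun_prop)
  have h5 : ∫⁻ x in O, ‖vField w x‖ₑ ^ (4 : ℝ)
      ≤ liminf (fun n => ∫⁻ x in O, ‖(W n).1 x‖ₑ ^ (4 : ℝ)) atTop :=
    ((lowerSemicontinuousAt_iff_le_liminf.1 (hlsc w.1)).trans
      (liminf_le_liminf_of_le hlim))
  have hcont : Continuous fun W : LpField O 2 × L2Grad O =>
      ENNReal.ofReal (((C ^ 2 : ℝ≥0) : ℝ) * (‖W.1‖ ^ 2 * ‖W.2‖ ^ 2)) :=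
    ENNReal.continuous_ofReal.comp (by fun_prop)
  refine h5.trans ((liminf_le_liminf (Eventually.of_forall hle)).trans
    (((hcont.tendsto _).comp hlim).liminf_eq.le))

end Ladyzhenskaya

end SCBF


namespace SCBF

variable {d : ℕ} {O : Set (Ed d)} {r : ℝ}

/-! ### Embedding of `𝕍` into `L̃^q` in two dimensions. -/

section Embedding

theorem norm_vField_le (w : VSpace O) : ‖vField w‖ ≤ ‖w‖ := norm_fst_le _

theorem norm_vGrad_le (w : VSpace O) : ‖vGrad w‖ ≤ ‖w‖ := norm_snd_le _

theorem lintegral_sq_eq {E : Type*} [NormedAddCommGroup E] (u : Lp E 2 (volume.restrict O)) :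
    ∫⁻ x in O, ‖u x‖ₑ ^ (2 : ℝ) = ENNReal.ofReal (‖u‖ ^ 2) := by
  have h := eLpNorm_rpow_toReal (p := 2) (ν := volume.restrict O) (by norm_num) (by norm_num)
    (u : Ed d → E)
  rw [ENNReal.toReal_ofNat] at h
  rw [← h, ← Lp.enorm_def, ← ofReal_norm, ENNReal.ofReal_rpow_of_nonneg (norm_nonneg _)
    (by norm_num), Real.rpow_two]

theorem memLp_four_vField {O : Set (Ed 2)} (w : VSpace O) :
    MemLp (vField w) 4 (volume.restrict O) := by
  obtain ⟨C, hC⟩ := exists_lintegral_four_le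
  refine memLp_of_lintegral_rpow_lt_top (by norm_num) (by norm_num) (Lp.aestronglyMeasurable _) ?_
  rw [ENNReal.toReal_ofNat]
  exact (hC w).trans_lt ENNReal.ofReal_lt_top

theorem coeFn_vField_smul (c : ℝ) (w : VSpace O) :
    (vField (c • w) : Ed d → Ed d) =ᵐ[volume.restrict O] c • (vField w : Ed d → Ed d) := by
  rw [vField_smul]
  exact Lp.coeFn_smul c (vField w)

set_option maxHeartbeats 1000000 in
theorem exists_vToLp {O : Set (Ed 2)} {q : ℝ≥0∞} [Fact (1 ≤ q)] (hq2 : 2 ≤ q) (hq4 : q ≤ 4) :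
    ∃ E : VSpace O →L[ℝ] LpField O q, ∀ w : VSpace O,
      (E w : Ed 2 → Ed 2) =ᵐ[volume.restrict O] vField w := by
  obtain ⟨C, hC⟩ := exists_lintegral_four_le
  have hmem : ∀ w : VSpace O, MemLp (vField w) q (volume.restrict O) := fun w =>
    memLp_of_memLp_of_memLp (by norm_num) (by norm_num) hq2 hq4 (Lp.memLp _) (memLp_four_vField w)
  have hqt : q ≠ ∞ := (hq4.trans_lt (by norm_num)).ne
  have hq0 : q ≠ 0 := (lt_of_lt_of_le (by norm_num) hq2).ne'
  have hqr2 : (2 : ℝ) ≤ q.toReal := by simpa using ENNReal.toReal_mono hqt hq2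
  have hqr4 : q.toReal ≤ 4 := by simpa using ENNReal.toReal_mono (by norm_num) hq4
  let E₀ : VSpace O →ₗ[ℝ] LpField O q :=
    { toFun := fun w => (hmem w).toLp _
      map_add' := fun w w' => by
        rw [← MemLp.toLp_add]
        exact MemLp.toLp_congr _ _ (Lp.coeFn_add (vField w) (vField w'))
      map_smul' := fun c w => by
        refine Lp.ext (((hmem (c • w)).coeFn_toLp.trans (coeFn_vField_smul c w)).trans ?_)
        exact ((hmem w).coeFn_toLp.const_smul c).symm.trans (Lp.coeFn_smul c _).symm }
  have hE₀ : ∀ w, (E₀ w : Ed 2 → Ed 2) =ᵐ[volume.restrict O] vField w :=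
    fun w => (hmem w).coeFn_toLp
  -- On the unit ball the `q`-th moment is at most the sum of the second and fourth moments, hence
  -- at most `1 + C`. For a linear map a bound on the ball suffices, so no sharp interpolation is
  -- needed.
  obtain ⟨K, hK⟩ := LinearMap.bound_of_ball_bound (r := 1) one_pos (1 + (C : ℝ)) E₀ (by
    intro w hw
    have hw1 : ‖w‖ ≤ 1 := by simpa using (mem_ball_zero_iff.1 hw).le
    have h1 : ‖vField w‖ ^ 2 ≤ 1 := pow_le_one₀ (norm_nonneg _) ((norm_vField_le w).trans hw1)
    have h2 : ‖vGrad w‖ ^ 2 ≤ 1 := pow_le_one₀ (norm_nonneg _) ((norm_vGrad_le w).trans hw1)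
    have h3 := lintegral_rpow_le_add hqr2 hqr4 (Lp.aestronglyMeasurable (vField w))
    rw [lintegral_sq_eq, ← eLpNorm_rpow_toReal hq0 hqt, ← eLpNorm_congr_ae (hE₀ w),
      ← Lp.enorm_def, ← ofReal_norm, ENNReal.ofReal_rpow_of_nonneg (norm_nonneg _)
      ENNReal.toReal_nonneg] at h3
    have h4 := h3.trans (add_le_add le_rfl (hC w))
    rw [← ENNReal.ofReal_add (by positivity) (by positivity),
      ENNReal.ofReal_le_ofReal_iff (by positivity)] at h4
    have h5 : ‖E₀ w‖ ^ q.toReal ≤ 1 + C := by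
      refine h4.trans (add_le_add h1 ?_)
      exact mul_le_of_le_one_right C.2 (mul_le_one₀ h1 (by positivity) h2)
    by_contra hlt
    push Not at hlt
    have hge : 1 ≤ ‖E₀ w‖ := le_trans (by linarith [C.2]) hlt.le
    have := Real.rpow_le_rpow_of_exponent_le hge (by linarith : (1 : ℝ) ≤ q.toReal)
    rw [Real.rpow_one] at this
    linarith)
  exact ⟨E₀.mkContinuous K hK, hE₀⟩

/-- In two dimensions `𝕍` is continuously embedded in `L̃^q` for `2 ≤ q ≤ 4`. -/
theorem exists_vToLtilde {O : Set (Ed 2)} {q : ℝ≥0∞} [Fact (1 ≤ q)] (hq2 : 2 ≤ q) (hq4 : q ≤ 4) :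
    ∃ E : VSpace O →L[ℝ] Ltilde O q, ∀ w : VSpace O,
      ((E w : LpField O q) : Ed 2 → Ed 2) =ᵐ[volume.restrict O] vField w := by
  obtain ⟨E₁, hE₁⟩ := exists_vToLp (O := O) hq2 hq4
  refine ⟨E₁.codRestrict (Ltilde O q) fun w => ?_, hE₁⟩
  obtain ⟨W, φ, hW, hlim⟩ := exists_seq_tendsto w.2
  have hlim' : Tendsto (fun n => (⟨W n, mem_vSpace (hW n).1 (hW n).2⟩ : VSpace O)) atTop (𝓝 w) :=
    tendsto_subtype_rng.2 hlim
  refine (Submodule.isClosed_topologicalClosure _).mem_of_tendsto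
    ((E₁.continuous.tendsto w).comp hlim') (Eventually.of_forall fun n => ?_)
  exact mem_ltilde (hW n).1 ((hE₁ _).trans (hW n).2.1)

end Embedding

/-! ### Integrability in space and time. -/

section SpaceTime

variable {u v : ℝ → HSpace O} {p : ℝ}

/-- `u ∈ L^p_loc([0, ∞); L^p)`, in terms of the integral of the `p`-th power. -/
def HasMoment (p : ℝ) (u : ℝ → HSpace O) : Prop :=
  ∀ T : ℝ, 0 < T → ∫⁻ s in Icc 0 T, ∫⁻ x in O, ‖(u s : LpField O 2) x‖ₑ ^ p < ∞

/-- Strong measurability on bounded intervals. -/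
def LocMeas {Y : Type*} [TopologicalSpace Y] (u : ℝ → Y) : Prop :=
  ∀ T : ℝ, 0 < T → AEStronglyMeasurable u (volume.restrict (Icc 0 T))

theorem MemLocLp.locMeas {Y : Type*} [NormedAddCommGroup Y] {q : ℝ≥0∞} {g : ℝ → Y}
    (h : MemLocLp q g) : LocMeas g := fun T hT => (h T hT).1

theorem locMeas_of_continuousOn {Y : Type*} [NormedAddCommGroup Y] {g : ℝ → Y}
    (h : ContinuousOn g (Ici 0)) : LocMeas g := fun _ _ =>
  (h.mono fun _ hx => hx.1).aestronglyMeasurable_of_isCompact isCompact_Icc measurableSet_Icc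

theorem LocMeas.coe (hu : LocMeas u) : LocMeas fun s => (u s : LpField O 2) := fun T hT =>
  continuous_subtype_val.comp_aestronglyMeasurable (hu T hT)

theorem ae_Icc_of_ae_Ici {P : ℝ → Prop} (h : ∀ᵐ t ∂volume.restrict (Ici (0 : ℝ)), P t) (T : ℝ) :
    ∀ᵐ t ∂volume.restrict (Icc 0 T), P t :=
  ae_restrict_of_ae_restrict_of_subset (fun _ hx => hx.1) h

theorem ae_Ici_of_ae_Icc {P : ℝ → Prop}
    (h : ∀ T : ℝ, 0 < T → ∀ᵐ t ∂volume.restrict (Icc 0 T), P t) :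
    ∀ᵐ t ∂volume.restrict (Ici (0 : ℝ)), P t := by
  have : Ici (0 : ℝ) = ⋃ n : ℕ, Icc 0 ((n : ℝ) + 1) := by
    ext x
    simp only [mem_Ici, mem_iUnion, mem_Icc]
    refine ⟨fun hx => ?_, fun ⟨_, h, _⟩ => h⟩
    obtain ⟨n, hn⟩ := exists_nat_ge x
    exact ⟨n, hx, by linarith⟩
  rw [this, ae_restrict_iUnion_iff]
  exact fun n => h _ (by positivity)

theorem LocMeas.aemeasurable_moment (hu : LocMeas u) (p : ℝ) {T : ℝ} (hT : 0 < T) :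
    AEMeasurable (fun s => ∫⁻ x in O, ‖(u s : LpField O 2) x‖ₑ ^ p)
      (volume.restrict (Icc 0 T)) :=
  aemeasurable_lintegral (h := fun y : Ed d × Ed d => ‖y.1‖ₑ ^ p) (by fun_prop)
    (hu.coe T hT) (hu.coe T hT)

theorem HasMoment.ae_lt_top (h : HasMoment p u) (hu : LocMeas u) :
    ∀ᵐ s ∂volume.restrict (Ici (0 : ℝ)), ∫⁻ x in O, ‖(u s : LpField O 2) x‖ₑ ^ p < ∞ :=
  ae_Ici_of_ae_Icc fun T hT => ae_lt_top' (hu.aemeasurable_moment p hT) (h T hT).ne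

theorem InLpLtilde.hasMoment {q : ℝ≥0∞} [Fact (1 ≤ q)] (hq : q ≠ ∞) (h : InLpLtilde q u) :
    HasMoment q.toReal u := by
  obtain ⟨uL, hL, hae⟩ := h
  have hq0 : q ≠ 0 := (zero_lt_one.trans_le (Fact.out : 1 ≤ q)).ne'
  intro T hT
  have h1 := (eLpNorm_lt_top_iff_lintegral_rpow_enorm_lt_top hq0 hq).1 (hL T hT).2
  refine lt_of_eq_of_lt (lintegral_congr_ae ?_) h1
  filter_upwards [ae_Icc_of_ae_Ici hae T] with s hs
  rw [← eLpNorm_rpow_toReal hq0 hq, ← eLpNorm_congr_ae hs, ← Lp.enorm_def]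
  rfl

theorem MemLocLp.hasMoment_two (h : MemLocLp 2 u) : HasMoment 2 u := by
  intro T hT
  have h1 := (eLpNorm_lt_top_iff_lintegral_rpow_enorm_lt_top (by norm_num) (by norm_num)).1
    (h T hT).2
  rw [ENNReal.toReal_ofNat] at h1
  refine lt_of_eq_of_lt (lintegral_congr fun s => ?_) h1
  rw [lintegral_sq_eq, ← ofReal_norm, ENNReal.ofReal_rpow_of_nonneg (norm_nonneg _) (by norm_num),
    Real.rpow_two]
  rfl

theorem memLocLp_of_continuousOn {Y : Type*} [NormedAddCommGroup Y] {g : ℝ → Y}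
    (h : ContinuousOn g (Ici 0)) (q : ℝ≥0∞) : MemLocLp q g := by
  intro T hT
  obtain ⟨M, hM⟩ := (isCompact_Icc (a := (0 : ℝ)) (b := T)).exists_bound_of_continuousOn
    (h.mono fun _ hx => hx.1)
  exact MemLp.of_bound (locMeas_of_continuousOn h T hT) M
    ((ae_restrict_iff' measurableSet_Icc).2 (ae_of_all _ hM))

theorem HasMoment.add (hp : 1 ≤ p) (hu : HasMoment p u) (hv : HasMoment p v) (hum : LocMeas u) :
    HasMoment p fun s => u s + v s := by
  intro T hT
  have hle : ∀ s, ∫⁻ x in O, ‖((u s + v s : HSpace O) : LpField O 2) x‖ₑ ^ p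
      ≤ 2 ^ (p - 1) * ((∫⁻ x in O, ‖(u s : LpField O 2) x‖ₑ ^ p)
        + ∫⁻ x in O, ‖(v s : LpField O 2) x‖ₑ ^ p) := by
    intro s
    have hm : AEMeasurable (fun x => ‖(u s : LpField O 2) x‖ₑ ^ p) (volume.restrict O) :=
      (Lp.aestronglyMeasurable _).enorm.pow_const _
    rw [← lintegral_add_left' hm, ← lintegral_const_mul' _ _ (by
      exact ENNReal.rpow_ne_top_of_nonneg (by linarith) (by norm_num))]
    refine lintegral_mono_ae ?_
    filter_upwards [Lp.coeFn_add (u s : LpField O 2) (v s : LpField O 2)] with x hx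
    rw [Submodule.coe_add, hx, Pi.add_apply]
    exact (ENNReal.rpow_le_rpow (enorm_add_le _ _) (by linarith)).trans
      (ENNReal.rpow_add_le_mul_rpow_add_rpow _ _ hp)
  refine (lintegral_mono hle).trans_lt ?_
  have hc : (2 : ℝ≥0∞) ^ (p - 1) ≠ ∞ :=
    ENNReal.rpow_ne_top_of_nonneg (by linarith) (by norm_num)
  rw [lintegral_const_mul' _ _ hc, lintegral_add_left' (hum.aemeasurable_moment p hT)]
  exact ENNReal.mul_lt_top hc.lt_top (ENNReal.add_lt_top.2 ⟨hu T hT, hv T hT⟩)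

theorem HasMoment.of_le_of_le {a b c : ℝ} (hab : a ≤ b) (hbc : b ≤ c) (ha : HasMoment a u)
    (hc : HasMoment c u) (hum : LocMeas u) : HasMoment b u := by
  intro T hT
  refine (lintegral_mono fun s => lintegral_rpow_le_add hab hbc
    (Lp.aestronglyMeasurable (u s : LpField O 2))).trans_lt ?_
  rw [lintegral_add_left' (hum.aemeasurable_moment a hT)]
  exact ENNReal.add_lt_top.2 ⟨ha T hT, hc T hT⟩

/-- In two dimensions `C(ℍ) ∩ L²(𝕍) ⊆ L⁴(L⁴)`. -/
theorem hasMoment_four {O : Set (Ed 2)} {u : ℝ → HSpace O} {uV : ℝ → VSpace O}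
    (hu : ContinuousOn u (Ici 0)) (hV : InL2V u uV) : HasMoment 4 u := by
  obtain ⟨C, hC⟩ := exists_lintegral_four_le
  intro T hT
  obtain ⟨M, hM⟩ := (isCompact_Icc (a := (0 : ℝ)) (b := T)).exists_bound_of_continuousOn
    (hu.mono fun _ hx => hx.1)
  have hle : ∀ᵐ s ∂volume.restrict (Icc 0 T), ∫⁻ x in O, ‖(u s : LpField O 2) x‖ₑ ^ (4 : ℝ)
      ≤ ENNReal.ofReal (C * M ^ 2) * ‖uV s‖ₑ ^ (2 : ℝ) := by
    filter_upwards [ae_Icc_of_ae_Ici hV.2 T, ae_restrict_mem measurableSet_Icc] with s hs hsT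
    rw [← hs]
    refine (hC (uV s)).trans ?_
    rw [← ofReal_norm, ENNReal.ofReal_rpow_of_nonneg (norm_nonneg _) (by norm_num), Real.rpow_two,
      ← ENNReal.ofReal_mul (by positivity), mul_assoc]
    have h1 : ‖vField (uV s)‖ ≤ M := by
      rw [hs]
      exact hM s hsT
    have h2 := norm_vGrad_le (uV s)
    gcongr
  refine (lintegral_mono_ae hle).trans_lt ?_
  rw [lintegral_const_mul' _ _ ENNReal.ofReal_ne_top]
  refine ENNReal.mul_lt_top ENNReal.ofReal_lt_top ?_
  have h1 := (eLpNorm_lt_top_iff_lintegral_rpow_enorm_lt_top (by norm_num) (by norm_num)).1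
    (hV.1 T hT).2
  rwa [ENNReal.toReal_ofNat] at h1

end SpaceTime

end SCBF


namespace SCBF

variable {d : ℕ} {O : Set (Ed d)} {r : ℝ}

section Exponents

/-- The exponent `(r + 1) / r`, dual to `r + 1`. -/
noncomputable def dualExp (r : ℝ) : ℝ≥0∞ := ENNReal.ofReal ((r + 1) / r)

theorem dampExp_eq (hr : 1 ≤ r) : dampExp r = ENNReal.ofReal (r + 1) := by
  rw [dampExp, ENNReal.ofReal_add (by linarith) one_pos.le, ENNReal.ofReal_one, add_comm]

theorem toReal_dampExp (hr : 1 ≤ r) : (dampExp r).toReal = r + 1 := by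
  rw [dampExp_eq hr, ENNReal.toReal_ofReal (by linarith)]

theorem holderConjugate_dualExp (hr : 1 ≤ r) :
    ENNReal.HolderConjugate (dualExp r) (dampExp r) := by
  rw [dampExp_eq hr]
  refine Real.HolderConjugate.ennrealOfReal ⟨?_, by positivity, by linarith⟩
  have : r ≠ 0 := by linarith
  have : r + 1 ≠ 0 := by linarith
  field_simp

theorem one_le_dualExp (hr : 1 ≤ r) : 1 ≤ dualExp r := by
  rw [dualExp, ENNReal.one_le_ofReal, le_div_iff₀ (by linarith)]
  linarith

theorem memLp_rpow_toReal {α : Type*} {m : MeasurableSpace α} {ν : Measure α} {M : α → ℝ≥0∞}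
    (hM : AEMeasurable M ν) (hfin : ∫⁻ s, M s ∂ν < ∞) {θ : ℝ} (hθ : 0 < θ) :
    MemLp (fun s => (M s).toReal ^ θ) (ENNReal.ofReal θ⁻¹) ν := by
  have h1 : MemLp (fun s => (M s).toReal) 1 ν :=
    memLp_one_iff_integrable.2 (integrable_toReal_of_lintegral_ne_top hM hfin.ne)
  have h2 := h1.norm_rpow_div (ENNReal.ofReal θ)
  rw [ENNReal.toReal_ofReal hθ.le, one_div, ← ENNReal.ofReal_inv_of_pos hθ] at h2
  simpa using h2

end Exponents

/-! ### Convection and damping as bounded functionals. -/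

section Forms

/-- The tensor `u ⊗ u`. -/
noncomputable def tensorSq (u : Ed d) : GradVal d := WithLp.toLp 2 fun i => u i • u

theorem continuous_tensorSq : Continuous (tensorSq (d := d)) := by
  unfold tensorSq
  fun_prop

theorem norm_tensorSq (u : Ed d) : ‖tensorSq u‖ = ‖u‖ ^ 2 := by
  have h : ‖tensorSq u‖ ^ 2 = (‖u‖ ^ 2) ^ 2 := by
    rw [PiLp.norm_sq_eq_of_L2, sq (‖u‖ ^ 2)]
    conv_rhs => enter [1]; rw [PiLp.norm_sq_eq_of_L2]
    rw [Finset.sum_mul]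
    refine Finset.sum_congr rfl fun i _ => ?_
    rw [tensorSq, norm_smul, mul_pow]
  exact (pow_left_inj₀ (norm_nonneg _) (by positivity) two_ne_zero).1 h

theorem inner_tensorSq (u : Ed d) (G : GradVal d) : inner ℝ (tensorSq u) G = triVal u G u := by
  rw [triVal_eq, PiLp.inner_apply, PiLp.inner_apply]
  refine Finset.sum_congr rfl fun i _ => ?_
  rw [tensorSq, contract, real_inner_smul_left, RCLike.inner_apply, conj_trivial, mul_comm,
    real_inner_comm]

/-- The functional `G ↦ ∫ u_i G_ij u_j` on `L²`, for `u ∈ L⁴`. -/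
theorem exists_tensor {u : Ed d → Ed d} (hu : AEStronglyMeasurable u (volume.restrict O))
    (h : ∫⁻ x in O, ‖u x‖ₑ ^ (4 : ℝ) < ∞) : ∃ T : L2Grad O,
      ‖T‖ = (∫⁻ x in O, ‖u x‖ₑ ^ (4 : ℝ)).toReal ^ (1 / 2 : ℝ) ∧
      ∀ G : L2Grad O, triForm O u G u = inner ℝ T G := by
  have hpow : ∀ x, ‖tensorSq (u x)‖ₑ ^ (2 : ℝ≥0∞).toReal = ‖u x‖ₑ ^ (4 : ℝ) := fun x => by
    rw [ENNReal.toReal_ofNat, ← ofReal_norm, norm_tensorSq, ENNReal.ofReal_pow (norm_nonneg _),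
      ofReal_norm, ← ENNReal.rpow_natCast, ← ENNReal.rpow_mul]
    norm_num
  have hm : MemLp (fun x => tensorSq (u x)) 2 (volume.restrict O) := by
    refine memLp_of_lintegral_rpow_lt_top (by norm_num) (by norm_num)
      (continuous_tensorSq.comp_aestronglyMeasurable hu) ?_
    simpa only [hpow] using h
  refine ⟨hm.toLp _, ?_, fun G => ?_⟩
  · rw [Lp.norm_toLp, eLpNorm_eq_lintegral_rpow_enorm_toReal (by norm_num) (by norm_num),
      ← ENNReal.toReal_rpow, ENNReal.toReal_ofNat]
    simp only [ENNReal.toReal_ofNat] at hpow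
    simp only [hpow]
  · rw [L2.inner_def]
    refine integral_congr_ae ?_
    filter_upwards [hm.coeFn_toLp] with x hx
    rw [hx, inner_tensorSq]
    rfl

theorem norm_rpow_sub_one_mul (hr : 1 ≤ r) (y : ℝ) (hy : 0 ≤ y) : y ^ (r - 1) * y = y ^ r := by
  rcases eq_or_lt_of_le hy with h | h
  · rw [← h, mul_zero, Real.zero_rpow (by linarith)]
  · rw [Real.rpow_sub_one h.ne', div_mul_cancel₀ _ h.ne']

/-- The functional `ψ ↦ ⟨C(u), ψ⟩`, for `u ∈ L^{r+1}`. -/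
theorem exists_damping (hr : 1 ≤ r) {u : HSpace O}
    (h : ∫⁻ x in O, ‖(u : LpField O 2) x‖ₑ ^ (r + 1) < ∞) :
    ∃ Λ : StrongDual ℝ (LpField O (dampExp r)),
      (∀ ψ, |Λ ψ| ≤ (∫⁻ x in O, ‖(u : LpField O 2) x‖ₑ ^ (r + 1)).toReal ^ (r / (r + 1)) * ‖ψ‖) ∧
      ∀ (ψ : LpField O (dampExp r)) (ψ' : LpField O 2),
        (ψ' : Ed d → Ed d) =ᵐ[volume.restrict O] ψ →
        dampForm O r u ψ' = Λ ψ ∧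
        Integrable (fun x => ‖(u : LpField O 2) x‖ ^ (r - 1) * inner ℝ ((u : LpField O 2) x) (ψ' x))
          (volume.restrict O) := by
  have := holderConjugate_dualExp hr
  have : Fact (1 ≤ dualExp r) := ⟨one_le_dualExp hr⟩
  have hr0 : 0 < r := by linarith
  set U : Ed d → Ed d := ((u : LpField O 2) : Ed d → Ed d) with hU
  have hUm : AEStronglyMeasurable U (volume.restrict O) := Lp.aestronglyMeasurable _
  have hd0 : dualExp r ≠ 0 := (zero_lt_one.trans_le (one_le_dualExp hr)).ne'
  have hdt : dualExp r ≠ ∞ := ENNReal.ofReal_ne_top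
  have hdr : (dualExp r).toReal = (r + 1) / r := ENNReal.toReal_ofReal (by positivity)
  have hFc : Continuous fun y : Ed d => ‖y‖ ^ (r - 1) • y :=
    (continuous_norm.rpow_const fun _ => Or.inr (by linarith)).smul continuous_id
  have hpow : ∀ x, ‖‖U x‖ ^ (r - 1) • U x‖ₑ ^ (dualExp r).toReal = ‖U x‖ₑ ^ (r + 1) := fun x => by
    rw [← ofReal_norm, norm_smul, Real.norm_of_nonneg (by positivity),
      norm_rpow_sub_one_mul hr _ (norm_nonneg _), ← ENNReal.ofReal_rpow_of_nonneg (norm_nonneg _)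
      hr0.le, ← ENNReal.rpow_mul, hdr, ofReal_norm]
    congr 1
    field_simp
  have hm : MemLp (fun x => ‖U x‖ ^ (r - 1) • U x) (dualExp r) (volume.restrict O) := by
    refine memLp_of_lintegral_rpow_lt_top hd0 hdt (hFc.comp_aestronglyMeasurable hUm) ?_
    simpa only [hpow] using h
  refine ⟨(innerSL ℝ (E := Ed d)).lpPairing (volume.restrict O) (dualExp r) (dampExp r)
    (hm.toLp _), fun ψ => ?_, fun ψ ψ' hψ => ?_⟩
  · have h1 : ‖hm.toLp _‖ = (∫⁻ x in O, ‖U x‖ₑ ^ (r + 1)).toReal ^ (r / (r + 1)) := by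
      rw [Lp.norm_toLp, eLpNorm_eq_lintegral_rpow_enorm_toReal hd0 hdt,
        ← ENNReal.toReal_rpow, lintegral_congr hpow, hdr, one_div, inv_div]
    rw [← h1, ContinuousLinearMap.lpPairing_eq_integral, ← Real.norm_eq_abs]
    have h2 := lintegral_mul_norm_le (p' := dualExp r) (p := dampExp r)
      (ν := volume.restrict O) (Lp.aestronglyMeasurable (hm.toLp _)).norm
      (Lp.aestronglyMeasurable ψ)
    rw [eLpNorm_norm] at h2
    refine (norm_integral_le_lintegral_norm _).trans ?_
    rw [Lp.norm_def, Lp.norm_def, ← ENNReal.toReal_mul]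
    refine ENNReal.toReal_mono (ENNReal.mul_ne_top (Lp.eLpNorm_ne_top _) (Lp.eLpNorm_ne_top _))
      ((lintegral_mono fun x => ?_).trans h2)
    rw [ofReal_norm, enorm_le_iff_norm_le, norm_mul, norm_norm, norm_norm]
    exact norm_inner_le_norm (𝕜 := ℝ) ((hm.toLp _ : LpField O (dualExp r)) x) (ψ x)
  · have h1 : ∀ᵐ x ∂volume.restrict O, ‖U x‖ ^ (r - 1) * inner ℝ (U x) (ψ' x)
        = innerSL ℝ (hm.toLp _ x) (ψ x) := by
      filter_upwards [hm.coeFn_toLp, hψ] with x h1 h2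
      rw [h1, h2, innerSL_apply_apply, real_inner_smul_left]
    refine ⟨?_, ?_⟩
    · rw [ContinuousLinearMap.lpPairing_eq_integral]
      exact integral_congr_ae h1
    · exact (memLp_one_iff_integrable.1 ((innerSL ℝ (E := Ed d)).memLp_of_bilin 1
        (Lp.memLp (hm.toLp _)) (Lp.memLp ψ))).congr (h1.mono fun _ h => h.symm)

end Forms

end SCBF


namespace SCBF

variable {d : ℕ} {O : Set (Ed d)} {μ α β r χ : ℝ} {f : StrongDual ℝ (VSpace O)}

section Maps

/-- The inclusion `𝕍 ∩ L̃^{r+1} → 𝕍` as a continuous linear map. -/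
noncomputable def wToVL (O : Set (Ed d)) (r : ℝ) : WSpace O r →L[ℝ] VSpace O :=
  ((ContinuousLinearMap.fst ℝ (LpField O 2 × L2Grad O) (LpField O (dampExp r))).comp
    (WSpace O r).subtypeL).codRestrict (VSpace O) fun w => w.2.1

/-- The inclusion `𝕍 ∩ L̃^{r+1} → L^{r+1}`. -/
noncomputable def wToLp (O : Set (Ed d)) (r : ℝ) : WSpace O r →L[ℝ] LpField O (dampExp r) :=
  (ContinuousLinearMap.snd ℝ (LpField O 2 × L2Grad O) (LpField O (dampExp r))).comp
    (WSpace O r).subtypeL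

theorem coeFn_wToLp (ψ : WSpace O r) :
    (vField (wToV ψ) : Ed d → Ed d) =ᵐ[volume.restrict O] wToLp O r ψ := ψ.2.2.2

/-- The gradient as a continuous linear map. -/
noncomputable def vGradL (O : Set (Ed d)) : VSpace O →L[ℝ] L2Grad O :=
  (ContinuousLinearMap.snd ℝ (LpField O 2) (L2Grad O)).comp (VSpace O).subtypeL

/-- The underlying field as a continuous linear map. -/
noncomputable def vFieldL (O : Set (Ed d)) : VSpace O →L[ℝ] LpField O 2 :=
  (ContinuousLinearMap.fst ℝ (LpField O 2) (L2Grad O)).comp (VSpace O).subtypeL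

end Maps

/-! ### The right-hand side as a functional on `𝕍 ∩ L̃^{r+1}`. -/

section RightHandSide

/-- The right-hand side of the transformed equation, tested with `ψ`. -/
noncomputable def rhsForm (μ α β r χ : ℝ) (f : StrongDual ℝ (VSpace O)) (V : VSpace O)
    (v Υ : HSpace O) (ψ : WSpace O r) : ℝ :=
  -μ * inner ℝ (vGrad V) (vGrad (wToV ψ)) - α * inner ℝ (v : LpField O 2) (vField (wToV ψ))
    - convForm O (v + Υ) (wToV ψ) - β * dampForm O r (v + Υ) (vField (wToV ψ))
    + (χ - α) * inner ℝ (Υ : LpField O 2) (vField (wToV ψ)) + f (wToV ψ)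

/-- The `p`-th moment of a field. -/
noncomputable def moment (p : ℝ) (u : HSpace O) : ℝ≥0∞ :=
  ∫⁻ x in O, ‖(u : LpField O 2) x‖ₑ ^ p

theorem exists_convForm {u : HSpace O} (h : moment 4 u < ∞) : ∃ T : L2Grad O,
    ‖T‖ = (moment 4 u).toReal ^ (1 / 2 : ℝ) ∧ ∀ ψ, convForm O u ψ = -inner ℝ T (vGrad ψ) := by
  obtain ⟨T, hT, hT'⟩ := exists_tensor (Lp.aestronglyMeasurable (u : LpField O 2)) h
  exact ⟨T, hT, fun ψ => by rw [convForm, hT']⟩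

theorem abs_mul_inner_le {E : Type*} [NormedAddCommGroup E] [InnerProductSpace ℝ E] (a : ℝ) {b : ℝ}
    (x : E) {y : E} (hy : ‖y‖ ≤ b) : |a * inner ℝ x y| ≤ |a| * ‖x‖ * b := by
  rw [abs_mul, mul_assoc]
  refine mul_le_mul_of_nonneg_left ((abs_real_inner_le_norm _ _).trans ?_) (abs_nonneg _)
  exact mul_le_mul_of_nonneg_left hy (norm_nonneg _)

/-- All terms except the damping factor through `V`; the damping factors through `L`. The variables
`κ` and `ρ` stand for the values of the two nonlinear forms, which are tied to the functionals only
by equations. -/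
theorem exists_dual_of_forms {X Y V W L : Type*} [NormedAddCommGroup X] [InnerProductSpace ℝ X]
    [NormedAddCommGroup Y] [InnerProductSpace ℝ Y] [NormedAddCommGroup V] [NormedSpace ℝ V]
    [NormedAddCommGroup W] [NormedSpace ℝ W] [NormedAddCommGroup L] [NormedSpace ℝ L]
    {P : V →L[ℝ] X} {Q : V →L[ℝ] Y} (hP : ∀ ψ, ‖P ψ‖ ≤ ‖ψ‖) (hQ : ∀ ψ, ‖Q ψ‖ ≤ ‖ψ‖)
    (J : W →L[ℝ] V) (I : W →L[ℝ] L) (f : StrongDual ℝ V) {Δ : StrongDual ℝ L} {m : ℝ}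
    (hΔ : ∀ ψ, |Δ ψ| ≤ m * ‖ψ‖) (G : Y) {T : Y} {τ : ℝ} (hT : ‖T‖ = τ) (v Υ : X)
    (μ α β c : ℝ) : ∃ Λ : StrongDual ℝ W,
      (∀ ψ κ ρ, κ = -inner ℝ T (Q (J ψ)) → ρ = Δ (I ψ) →
        Λ ψ = -μ * inner ℝ G (Q (J ψ)) - α * inner ℝ v (P (J ψ)) - κ - β * ρ
          + c * inner ℝ Υ (P (J ψ)) + f (J ψ)) ∧
      ∀ ψ, |Λ ψ| ≤ (|μ| * ‖G‖ + |α| * ‖v‖ + τ + |c| * ‖Υ‖ + ‖f‖) * ‖J ψ‖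
        + (|β| * m) * ‖I ψ‖ := by
  let Λ₁ : StrongDual ℝ V := -(μ • (innerSL ℝ G).comp Q) - α • (innerSL ℝ v).comp P
    + (innerSL ℝ T).comp Q + c • (innerSL ℝ Υ).comp P + f
  have e₁ : ∀ ψ, Λ₁ ψ = -(μ * inner ℝ G (Q ψ)) - α * inner ℝ v (P ψ) + inner ℝ T (Q ψ)
    + c * inner ℝ Υ (P ψ) + f ψ := fun ψ => rfl
  refine ⟨Λ₁.comp J - β • Δ.comp I, fun ψ κ ρ hκ hρ => ?_, fun ψ => ?_⟩
  · subst hκ hρ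
    show Λ₁ (J ψ) - β * Δ (I ψ) = _
    rw [e₁]
    ring
  · show |Λ₁ (J ψ) - β * Δ (I ψ)| ≤ _
    rw [e₁]
    have h1 := abs_le.1 (abs_mul_inner_le μ G (hQ (J ψ)))
    have h2 := abs_le.1 (abs_mul_inner_le α v (hP (J ψ)))
    have h3 := abs_le.1 (abs_mul_inner_le 1 T (hQ (J ψ)))
    have h4 := abs_le.1 (abs_mul_inner_le c Υ (hP (J ψ)))
    have h5 : |f (J ψ)| ≤ ‖f‖ * ‖J ψ‖ := f.le_opNorm _
    have h5 := abs_le.1 h5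
    have h6 : |β * Δ (I ψ)| ≤ |β| * (m * ‖I ψ‖) := by
      rw [abs_mul]
      exact mul_le_mul_of_nonneg_left (hΔ _) (abs_nonneg _)
    have h6 := abs_le.1 h6
    rw [abs_one, one_mul, one_mul, hT] at h3
    rw [abs_le]
    constructor <;> linarith [h1.1, h1.2, h2.1, h2.2, h3.1, h3.2, h4.1, h4.2, h5.1, h5.2, h6.1, h6.2]

set_option maxHeartbeats 1000000 in
theorem exists_rhsForm (hr : 1 ≤ r) (V : VSpace O) (v Υ : HSpace O) (h4 : moment 4 (v + Υ) < ∞)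
    (h : moment (r + 1) (v + Υ) < ∞) : ∃ Λ : StrongDual ℝ (WSpace O r),
      (∀ ψ, Λ ψ = rhsForm μ α β r χ f V v Υ ψ) ∧
      ∀ ψ, |Λ ψ| ≤ (|μ| * ‖vGradL O V‖ + |α| * ‖v‖ + (moment 4 (v + Υ)).toReal ^ (1 / 2 : ℝ)
        + |χ - α| * ‖Υ‖ + ‖f‖) * ‖wToVL O r ψ‖
        + (|β| * (moment (r + 1) (v + Υ)).toReal ^ (r / (r + 1))) * ‖wToLp O r ψ‖ := by
  have h₁ := exists_convForm h4
  obtain ⟨T, hT, hT'⟩ := h₁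
  have h₂ := exists_damping hr h
  obtain ⟨Δ, hΔ, hΔ'⟩ := h₂
  have h₃ := exists_dual_of_forms (X := LpField O 2) (Y := L2Grad O)
    (V := VSpace O) (W := WSpace O r) (L := LpField O (dampExp r)) (P := vFieldL O)
    (Q := vGradL O) (fun ψ => norm_vField_le ψ) (fun ψ => norm_vGrad_le ψ) (wToVL O r) (wToLp O r)
    f hΔ (vGrad V) hT (v : LpField O 2) (Υ : LpField O 2) μ α β (χ - α)
  obtain ⟨Λ, hΛ, hb⟩ := h₃
  exact ⟨Λ, fun ψ => hΛ ψ _ _ (hT' (wToV ψ)) (hΔ' _ _ (coeFn_wToLp ψ)).1, hb⟩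

end RightHandSide

/-! ### Solutions of the equation without the energy equality. -/

section PreSolution

/-- `v` solves the transformed system, with `g` its time derivative. -/
structure IsPreSolution (O : Set (Ed d)) (μ α β r χ : ℝ) (f : StrongDual ℝ (VSpace O))
    (Υ v : ℝ → HSpace O) (vV : ℝ → VSpace O) (g : ℝ → StrongDual ℝ (WSpace O r)) : Prop where
  driving : IsDrivingPath r Υ
  continuousOn : ContinuousOn v (Ici 0)
  memLp : InLpLtilde (dampExp r) v
  memL2V : InL2V v vV
  memDual : MemLocLp (ENNReal.ofReal ((r + 1) / r)) g
  timeDeriv : IsTimeDeriv v g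
  equation : ∀ ψ : WSpace O r, ∀ᵐ t ∂volume.restrict (Ici (0 : ℝ)),
    g t ψ = rhsForm μ α β r χ f (vV t) (v t) (Υ t) ψ

variable {Υ v : ℝ → HSpace O} {vV : ℝ → VSpace O} {g : ℝ → StrongDual ℝ (WSpace O r)}

theorem toReal_noiseExp_of_le (hr : 3 ≤ r) : (noiseExp r).toReal = r + 1 := by
  rw [noiseExp, if_neg (not_lt.2 hr), toReal_dampExp (by linarith)]

theorem noiseExp_ne_top : noiseExp r ≠ ∞ := by
  rw [noiseExp]
  split_ifs
  · norm_num
  · exact dampExp_ne_top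

theorem IsPreSolution.locMeas (h : IsPreSolution O μ α β r χ f Υ v vV g) :
    LocMeas fun s => v s + Υ s := fun T hT =>
  (locMeas_of_continuousOn h.continuousOn T hT).add (h.driving.1.locMeas T hT)

/-- If `r < 3`, then `d = 2` and the fourth moment of `v` comes from Ladyzhenskaya's inequality; the
exponent `r + 1` then lies between `2` and `4`. If `r ≥ 3`, the moment of order `r + 1` is given,
and `4` lies between `2` and `r + 1`. -/
theorem IsPreSolution.hasMoment (h : IsPreSolution O μ α β r χ f Υ v vV g) (hr : 1 ≤ r)
    (hdr : d = 2 ∨ 3 ≤ r) :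
    HasMoment 4 (fun s => v s + Υ s) ∧ HasMoment (r + 1) fun s => v s + Υ s := by
  have hvm := locMeas_of_continuousOn h.continuousOn
  have h2 := (memLocLp_of_continuousOn h.continuousOn 2).hasMoment_two.add (by norm_num)
    h.driving.1.hasMoment_two hvm
  have hΥ := h.driving.2.hasMoment noiseExp_ne_top
  rcases lt_or_ge r 3 with h3 | h3
  · obtain rfl : d = 2 := hdr.resolve_right (by linarith)
    have h4 : HasMoment 4 Υ := by
      rw [noiseExp, if_pos h3, ENNReal.toReal_ofNat] at hΥ
      exact hΥ
    have h4' := (hasMoment_four h.continuousOn h.memL2V).add (by norm_num) h4 hvm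
    exact ⟨h4', h2.of_le_of_le (by linarith) (by linarith) h4' h.locMeas⟩
  · rw [toReal_noiseExp_of_le h3] at hΥ
    have hv := h.memLp.hasMoment dampExp_ne_top
    rw [toReal_dampExp hr] at hv
    have h4 := hv.add (by linarith) hΥ hvm
    exact ⟨h2.of_le_of_le (by norm_num) (by linarith) h4 h.locMeas, h4⟩

theorem memLocLp_moment {u : ℝ → HSpace O} (hu : LocMeas u) {p θ : ℝ} (h : HasMoment p u)
    (hθ : 0 < θ) : MemLocLp (ENNReal.ofReal θ⁻¹) fun s => (moment p (u s)).toReal ^ θ :=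
  fun T hT => memLp_rpow_toReal (hu.aemeasurable_moment p hT) (h T hT) hθ

-- The exceptional null set of times may depend on the test function. Separability of `𝕍 ∩ L̃^{r+1}`
-- reduces to countably many of them, and continuity of both sides then gives one null set for all.
-- The damping contributes the coefficient in `L^{(r+1)/r}`; every other term has a coefficient in
-- `L²`.
set_option maxHeartbeats 1000000 in
theorem IsPreSolution.exists_bound (h : IsPreSolution O μ α β r χ f Υ v vV g) (hr : 1 ≤ r)
    (hdr : d = 2 ∨ 3 ≤ r) : ∃ a b : ℝ → ℝ, MemLocLp 2 a ∧ MemLocLp (dualExp r) b ∧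
      ∀ᵐ s ∂volume.restrict (Ici (0 : ℝ)),
        (∀ ψ, g s ψ = rhsForm μ α β r χ f (vV s) (v s) (Υ s) ψ) ∧
        ∀ ψ, |g s ψ| ≤ a s * ‖wToVL O r ψ‖ + b s * ‖wToLp O r ψ‖ := by
  have hm := h.hasMoment hr hdr
  obtain ⟨h4, hp⟩ := hm
  refine ⟨fun s => |μ| * ‖vGradL O (vV s)‖ + |α| * ‖v s‖ + (moment 4 (v s + Υ s)).toReal ^ (1 / 2 : ℝ)
    + |χ - α| * ‖Υ s‖ + ‖f‖, fun s => |β| * (moment (r + 1) (v s + Υ s)).toReal ^ (r / (r + 1)),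
    fun T hT => ?_, fun T hT => ?_, ?_⟩
  · have m4 := memLocLp_moment h.locMeas h4 (θ := 1 / 2) (by norm_num) T hT
    rw [show ENNReal.ofReal (1 / 2 : ℝ)⁻¹ = 2 by norm_num] at m4
    have m1 : MemLp (fun s => |μ| * ‖vGradL O (vV s)‖) 2 (volume.restrict (Icc 0 T)) :=
      ((vGradL O).comp_memLp' (h.memL2V.1 T hT)).norm.const_mul _
    have m2 : MemLp (fun s => |α| * ‖v s‖) 2 (volume.restrict (Icc 0 T)) :=
      (memLocLp_of_continuousOn h.continuousOn 2 T hT).norm.const_mul _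
    have m3 : MemLp (fun s => |χ - α| * ‖Υ s‖) 2 (volume.restrict (Icc 0 T)) :=
      (h.driving.1 T hT).norm.const_mul _
    exact (((m1.add m2).add m4).add m3).add (memLp_const _)
  · have m := memLocLp_moment h.locMeas hp (θ := r / (r + 1)) (by positivity) T hT
    rw [inv_div] at m
    exact m.const_mul _
  · obtain ⟨D, hDc, hDd⟩ := TopologicalSpace.exists_countable_dense (WSpace O r)
    have := hDc.to_subtype
    have heq : ∀ᵐ s ∂volume.restrict (Ici (0 : ℝ)), ∀ ψ : D,
        g s ψ = rhsForm μ α β r χ f (vV s) (v s) (Υ s) ψ := ae_all_iff.2 fun ψ => h.equation ψ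
    filter_upwards [heq, h4.ae_lt_top h.locMeas, hp.ae_lt_top h.locMeas] with s hs h4s hps
    have hΛ₀ := exists_rhsForm (μ := μ) (α := α) (β := β) (χ := χ) (f := f) hr
      (vV s) (v s) (Υ s) h4s hps
    obtain ⟨Λ, hΛ, hΛ'⟩ := hΛ₀
    have hgΛ : ∀ ψ, g s ψ = Λ ψ := fun ψ =>
      congrFun (Continuous.ext_on hDd (g s).continuous Λ.continuous fun ψ hψ =>
        (hs ⟨ψ, hψ⟩).trans (hΛ ψ).symm) ψ
    exact ⟨fun ψ => (hgΛ ψ).trans (hΛ ψ), fun ψ => (congrArg abs (hgΛ ψ)).trans_le (hΛ' ψ)⟩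

/-- Makes the solution itself a measurable path of admissible test functions. Its two
representatives agree as fields for almost every time, and elsewhere the lift is `0`. -/
theorem exists_lift {w : ℝ → HSpace O} {wV : ℝ → VSpace O} (hV : InL2V w wV)
    (hL : InLpLtilde (dampExp r) w) : ∃ z : ℝ → WSpace O r, LocMeas z ∧
      MemLocLp 2 (fun s => wToVL O r (z s)) ∧ MemLocLp (dampExp r) (fun s => wToLp O r (z s)) ∧
      ∀ᵐ s ∂volume.restrict (Ici (0 : ℝ)), wToV (z s) = wV s ∧ vToH O (wV s) = w s := by
  classical
  obtain ⟨wL, hL, hae⟩ := hL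
  let y : ℝ → (LpField O 2 × L2Grad O) × LpField O (dampExp r) := fun s => ((wV s).1, (wL s).1)
  let z : ℝ → WSpace O r := fun s => if h : y s ∈ WSpace O r then ⟨y s, h⟩ else 0
  have hz : ∀ᵐ s ∂volume.restrict (Ici (0 : ℝ)), (z s : (LpField O 2 × L2Grad O) × _) = y s := by
    filter_upwards [hV.2, hae] with s h1 h2
    have hm : y s ∈ WSpace O r := by
      refine ⟨(wV s).2, (wL s).2, ?_⟩
      show (vField (wV s) : Ed d → Ed d) =ᵐ[volume.restrict O] _
      rw [h1]
      exact h2.symm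
    simp only [z, dif_pos hm]
  refine ⟨z, fun T hT => ?_, fun T hT => ?_, fun T hT => ?_, ?_⟩
  · refine (Topology.IsEmbedding.subtypeVal.aestronglyMeasurable_comp_iff).1 ?_
    refine AEStronglyMeasurable.congr (f := y) ?_ ((ae_Icc_of_ae_Ici hz T).mono fun s hs => hs.symm)
    exact (continuous_subtype_val.comp_aestronglyMeasurable (hV.1 T hT).1).prodMk
      (continuous_subtype_val.comp_aestronglyMeasurable (hL T hT).1)
  · refine (hV.1 T hT).ae_eq ((ae_Icc_of_ae_Ici hz T).mono fun s hs => ?_)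
    exact Subtype.ext (congrArg Prod.fst hs).symm
  · have h1 : MemLp (fun s => (wL s : LpField O (dampExp r))) (dampExp r)
        (volume.restrict (Icc 0 T)) := (Ltilde O (dampExp r)).subtypeL.comp_memLp' (hL T hT)
    refine h1.ae_eq ((ae_Icc_of_ae_Ici hz T).mono fun s hs => ?_)
    exact (congrArg Prod.snd hs).symm
  · filter_upwards [hz, hV.2] with s hs h1
    exact ⟨Subtype.ext (congrArg Prod.fst hs), Subtype.ext h1⟩

end PreSolution

end SCBF


namespace SCBF

/-! ### Integration of the energy balance. -/

section LocalIntegrability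

variable {Y : Type*} [NormedAddCommGroup Y]

theorem MemLocLp.intervalIntegrable {g : ℝ → Y} (h : MemLocLp 1 g) {T : ℝ} (hT : 0 ≤ T) :
    IntervalIntegrable g volume 0 T := by
  rw [intervalIntegrable_iff_integrableOn_Ioc_of_le hT]
  have h1 : IntegrableOn g (Icc 0 (T + 1)) := memLp_one_iff_integrable.1 (h (T + 1) (by linarith))
  exact h1.mono_set fun x hx => ⟨hx.1.le, by linarith [hx.2]⟩

theorem MemLocLp.mono_exponent {g : ℝ → Y} {p q : ℝ≥0∞} (h : MemLocLp q g) (hpq : p ≤ q) :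
    MemLocLp p g := fun T hT => (h T hT).mono_exponent hpq

theorem memLocLp_one_of_abs_le {g a b : ℝ → ℝ} (hg : LocMeas g) (ha : MemLocLp 2 a)
    (hb : MemLocLp 2 b) (h : ∀ᵐ s ∂volume.restrict (Ici (0 : ℝ)), |g s| ≤ a s * b s) :
    MemLocLp 1 g := by
  intro T hT
  have h1 : MemLp (fun s => a s * b s) 1 (volume.restrict (Icc 0 T)) := (hb T hT).mul (ha T hT)
  refine h1.mono (hg T hT) ((ae_Icc_of_ae_Ici h T).mono fun s hs => ?_)
  rw [Real.norm_eq_abs]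
  exact hs.trans (le_abs_self _)

/-- Integrability of `E₄`, the damping term, is not assumed: since `β ≠ 0`, the identity expresses
it by the other terms. -/
theorem integral_eq_of_ae_eq_sum {F E₁ E₂ E₃ E₄ E₅ E₆ : ℝ → ℝ} {μ α β c t : ℝ} (hβ : β ≠ 0)
    (h : ∀ᵐ s ∂volume.restrict (Ici (0 : ℝ)),
      F s = -μ * E₁ s - α * E₂ s - E₃ s - β * E₄ s + c * E₅ s + E₆ s) (ht : 0 ≤ t)
    (hF : IntervalIntegrable F volume 0 t) (h₁ : IntervalIntegrable E₁ volume 0 t)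
    (h₂ : IntervalIntegrable E₂ volume 0 t) (h₃ : IntervalIntegrable E₃ volume 0 t)
    (h₅ : IntervalIntegrable E₅ volume 0 t) (h₆ : IntervalIntegrable E₆ volume 0 t) :
    ∫ s in (0 : ℝ)..t, F s = -μ * (∫ s in (0 : ℝ)..t, E₁ s) - α * (∫ s in (0 : ℝ)..t, E₂ s)
      - (∫ s in (0 : ℝ)..t, E₃ s) - β * (∫ s in (0 : ℝ)..t, E₄ s)
      + c * (∫ s in (0 : ℝ)..t, E₅ s) + ∫ s in (0 : ℝ)..t, E₆ s := by
  have hae : ∀ᵐ s, s ∈ uIoc 0 t →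
      E₄ s = β⁻¹ * (-μ * E₁ s - α * E₂ s - E₃ s + c * E₅ s + E₆ s - F s) := by
    filter_upwards [(ae_restrict_iff' measurableSet_Ici).1 h] with s hs hst
    rw [uIoc_of_le ht] at hst
    rw [hs hst.1.le]
    field_simp
    ring
  rw [intervalIntegral.integral_congr_ae hae, intervalIntegral.integral_const_mul,
    intervalIntegral.integral_sub (((((h₁.const_mul _).sub (h₂.const_mul _)).sub h₃).add
      (h₅.const_mul _)).add h₆) hF,
    intervalIntegral.integral_add ((((h₁.const_mul _).sub (h₂.const_mul _)).sub h₃).add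
      (h₅.const_mul _)) h₆,
    intervalIntegral.integral_add (((h₁.const_mul _).sub (h₂.const_mul _)).sub h₃)
      (h₅.const_mul _),
    intervalIntegral.integral_sub ((h₁.const_mul _).sub (h₂.const_mul _)) h₃,
    intervalIntegral.integral_sub (h₁.const_mul _) (h₂.const_mul _),
    intervalIntegral.integral_const_mul, intervalIntegral.integral_const_mul,
    intervalIntegral.integral_const_mul]
  field_simp
  ring

end LocalIntegrability

variable {d : ℕ} {O : Set (Ed d)} {μ α β r χ : ℝ} {f : StrongDual ℝ (VSpace O)}
  {Υ v : ℝ → HSpace O} {vV : ℝ → VSpace O} {g : ℝ → StrongDual ℝ (WSpace O r)}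

/-! ### The energy equality. -/

section Energy

set_option maxHeartbeats 1000000 in
theorem IsTimeDeriv.exists_energy (hr : 1 ≤ r) (hd : IsTimeDeriv v g)
    (hv : ContinuousOn v (Ici 0)) (hV : InL2V v vV) (hL : InLpLtilde (dampExp r) v)
    (hg : LocMeas g) {a b : ℝ → ℝ} (ha : MemLocLp 2 a) (hb : MemLocLp (dualExp r) b)
    (hN : ∀ᵐ s ∂volume.restrict (Ici (0 : ℝ)),
      ∀ ψ, |g s ψ| ≤ a s * ‖wToVL O r ψ‖ + b s * ‖wToLp O r ψ‖) :
    ∃ z : ℝ → WSpace O r,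
      (∀ᵐ s ∂volume.restrict (Ici (0 : ℝ)), wToV (z s) = vV s ∧ vToH O (vV s) = v s) ∧
      ∀ T, 0 ≤ T → IntervalIntegrable (fun s => g s (z s)) volume 0 T ∧
        ‖v T‖ ^ 2 = ‖v 0‖ ^ 2 + 2 * ∫ s in (0 : ℝ)..T, g s (z s) := by
  have hlift := exists_lift hV hL
  obtain ⟨z, hz, hzV, hzL, hzv⟩ := hlift
  have hconj := holderConjugate_dualExp hr
  refine ⟨z, hzv, fun T hT => ?_⟩
  exact energy_identity (H := HSpace O) (W := WSpace O r) (V := VSpace O)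
    (L := LpField O (dampExp r)) (iH := (vToH O).comp (wToVL O r)) (q := dampExp r)
    (q' := dualExp r) dampExp_ne_top hg ha hb hN hz hzV hzL hv
    (hzv.mono fun s hs => (congrArg (vToH O) hs.1).trans hs.2) hd hT

theorem IsPreSolution.locMeas_gradient (h : IsPreSolution O μ α β r χ f Υ v vV g) :
    MemLocLp 2 fun s => vGrad (vV s) := fun T hT =>
  (vGradL O).comp_memLp' (h.memL2V.1 T hT)

theorem abs_convForm_le {u : HSpace O} (h : moment 4 u < ∞) (ψ : VSpace O) :
    |convForm O u ψ| ≤ (moment 4 u).toReal ^ (1 / 2 : ℝ) * ‖vGrad ψ‖ := by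
  have h₁ := exists_convForm h
  obtain ⟨T, hT, hT'⟩ := h₁
  rw [hT', abs_neg, ← hT]
  exact abs_real_inner_le_norm _ _

theorem IsPreSolution.memLocLp_convForm (h : IsPreSolution O μ α β r χ f Υ v vV g) (hr : 1 ≤ r)
    (hdr : d = 2 ∨ 3 ≤ r) : MemLocLp 1 fun s => convForm O (v s + Υ s) (vV s) := by
  have hm := (h.hasMoment hr hdr).1
  have h2 := memLocLp_moment h.locMeas hm (θ := 1 / 2) (by norm_num)
  rw [show ENNReal.ofReal (1 / 2 : ℝ)⁻¹ = 2 by norm_num] at h2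
  have hae := hm.ae_lt_top h.locMeas
  refine memLocLp_one_of_abs_le (fun T hT => ?_) h2 (fun T hT => (h.locMeas_gradient T hT).norm)
    (hae.mono fun s hs => abs_convForm_le hs _)
  refine (aestronglyMeasurable_integral (p := 2) (q := 2) (ν := volume.restrict O)
    (h := fun y : Ed d × GradVal d => triVal y.1 y.2 y.1)
    (continuous_triVal.comp (by fun_prop : Continuous fun y : Ed d × GradVal d => ((y.1, y.2), y.1)))
    (h.locMeas.coe T hT) (h.locMeas_gradient T hT).1 ?_).neg
  filter_upwards [ae_Icc_of_ae_Ici hae T] with s hs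
  have h4 : MemLp ((v s + Υ s : HSpace O) : LpField O 2) 4 (volume.restrict O) :=
    memLp_of_lintegral_rpow_lt_top (by norm_num) (by norm_num) (Lp.aestronglyMeasurable _) (by
      rw [ENNReal.toReal_ofNat]; exact hs)
  exact integrable_triVal h4 (Lp.memLp _) h4

theorem rhsForm_self {V : VSpace O} {v Υ : HSpace O} {ψ : WSpace O r} (hψ : wToV ψ = V)
    (hv : vToH O V = v) : rhsForm μ α β r χ f V v Υ ψ = -μ * ‖vGrad V‖ ^ 2 - α * ‖v‖ ^ 2
      - convForm O (v + Υ) V - β * dampForm O r (v + Υ) (v : LpField O 2)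
      + (χ - α) * inner ℝ Υ v + f V := by
  subst hψ hv
  have e₁ : inner ℝ (vGrad (wToV ψ)) (vGrad (wToV ψ)) = ‖vGrad (wToV ψ)‖ ^ 2 :=
    real_inner_self_eq_norm_sq _
  have e₂ : inner ℝ (vToH O (wToV ψ) : LpField O 2) (vField (wToV ψ)) = ‖vToH O (wToV ψ)‖ ^ 2 :=
    real_inner_self_eq_norm_sq (vToH O (wToV ψ))
  have key : ∀ {a a' b b' : ℝ} (c k l m : ℝ), a = a' → b = b' →
      -μ * a - α * b - c - k + l + m = -μ * a' - α * b' - c - k + l + m := by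
    rintro a _ b _ c k l m rfl rfl
    rfl
  exact key _ _ _ _ e₁ e₂

-- The energy equality carries no information beyond the equation, since `v` is regular enough to be
-- tested with itself. This is what lets the transformed path qualify as a weak solution.
set_option maxHeartbeats 1000000 in
theorem IsPreSolution.energy (h : IsPreSolution O μ α β r χ f Υ v vV g) (hr : 1 ≤ r)
    (hdr : d = 2 ∨ 3 ≤ r) (hβ : β ≠ 0) {t : ℝ} (ht : 0 ≤ t) :
    ‖v t‖ ^ 2 + 2 * μ * (∫ s in (0 : ℝ)..t, ‖vGrad (vV s)‖ ^ 2)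
          + 2 * α * (∫ s in (0 : ℝ)..t, ‖v s‖ ^ 2)
        = ‖v 0‖ ^ 2 - 2 * (∫ s in (0 : ℝ)..t, convForm O (v s + Υ s) (vV s))
          - 2 * β * (∫ s in (0 : ℝ)..t, dampForm O r (v s + Υ s) (v s : LpField O 2))
          + 2 * (∫ s in (0 : ℝ)..t, f (vV s))
          + 2 * (χ - α) * (∫ s in (0 : ℝ)..t, inner ℝ (Υ s) (v s)) := by
  have hb := h.exists_bound hr hdr
  obtain ⟨a, b, ha, hb, hab⟩ := hb
  have he := h.timeDeriv.exists_energy hr h.continuousOn h.memL2V h.memLp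
    (fun T hT => (h.memDual T hT).1) ha hb (hab.mono fun s hs => hs.2)
  obtain ⟨z, hz, he⟩ := he
  have hv2 := memLocLp_of_continuousOn h.continuousOn 2
  have i₁ : MemLocLp 1 fun s => ‖vGrad (vV s)‖ ^ 2 := fun T hT =>
    memLp_one_iff_integrable.2 (h.locMeas_gradient T hT).norm.integrable_sq
  have i₂ : MemLocLp 1 fun s => ‖v s‖ ^ 2 := fun T hT =>
    memLp_one_iff_integrable.2 (hv2 T hT).norm.integrable_sq
  have i₅ : MemLocLp 1 fun s => inner ℝ (Υ s) (v s) :=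
    memLocLp_one_of_abs_le (fun T hT => (h.driving.1 T hT).1.inner (hv2 T hT).1)
      (fun T hT => (h.driving.1 T hT).norm) (fun T hT => (hv2 T hT).norm)
      (ae_of_all _ fun s => abs_real_inner_le_norm _ _)
  have i₆ : MemLocLp 1 fun s => f (vV s) := fun T hT =>
    (f.comp_memLp' (h.memL2V.1 T hT)).mono_exponent (by norm_num)
  have hsum : ∀ᵐ s ∂volume.restrict (Ici (0 : ℝ)), g s (z s) = -μ * ‖vGrad (vV s)‖ ^ 2
      - α * ‖v s‖ ^ 2 - convForm O (v s + Υ s) (vV s)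
      - β * dampForm O r (v s + Υ s) (v s : LpField O 2)
      + (χ - α) * inner ℝ (Υ s) (v s) + f (vV s) := by
    filter_upwards [hz, hab] with s hs hs'
    exact (hs'.1 (z s)).trans (rhsForm_self hs.1 hs.2)
  have e := integral_eq_of_ae_eq_sum hβ hsum ht (he t ht).1 (i₁.intervalIntegrable ht)
    (i₂.intervalIntegrable ht) ((h.memLocLp_convForm hr hdr).intervalIntegrable ht)
    (i₅.intervalIntegrable ht) (i₆.intervalIntegrable ht)
  linarith [(he t ht).2]

end Energy

/-! ### Change of the driving path. -/

section Shift

theorem InLpLtilde.add {p : ℝ≥0∞} [Fact (1 ≤ p)] {u w : ℝ → HSpace O} (hu : InLpLtilde p u)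
    (hw : InLpLtilde p w) : InLpLtilde p fun s => u s + w s := by
  obtain ⟨uL, hu, hu'⟩ := hu
  obtain ⟨wL, hw, hw'⟩ := hw
  refine ⟨fun s => uL s + wL s, fun T hT => (hu T hT).add (hw T hT), ?_⟩
  filter_upwards [hu', hw'] with s hs hs'
  exact (Lp.coeFn_add (uL s : LpField O p) (wL s)).trans
    ((hs.add hs').trans (Lp.coeFn_add (u s : LpField O 2) (w s)).symm)

theorem InLpLtilde.neg {p : ℝ≥0∞} [Fact (1 ≤ p)] {u : ℝ → HSpace O} (hu : InLpLtilde p u) :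
    InLpLtilde p fun s => -u s := by
  obtain ⟨uL, hu, hu'⟩ := hu
  refine ⟨fun s => -uL s, fun T hT => (hu T hT).neg, ?_⟩
  filter_upwards [hu'] with s hs
  exact (Lp.coeFn_neg (uL s : LpField O p)).trans
    (hs.neg.trans (Lp.coeFn_neg (u s : LpField O 2)).symm)

theorem InLpLtilde.of_eq {p q : ℝ≥0∞} [Fact (1 ≤ p)] [Fact (1 ≤ q)] {u : ℝ → HSpace O}
    (hu : InLpLtilde p u) (h : p = q) : InLpLtilde q u := by
  subst h
  exact hu

theorem inLpLtilde_vToH {O : Set (Ed 2)} {p : ℝ≥0∞} [Fact (1 ≤ p)] (hp2 : 2 ≤ p) (hp4 : p ≤ 4)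
    {D : ℝ → VSpace O} (hD : Continuous D) : InLpLtilde p fun s => vToH O (D s) := by
  have hE := exists_vToLtilde (O := O) hp2 hp4
  obtain ⟨E, hE⟩ := hE
  exact ⟨fun s => E (D s), memLocLp_of_continuousOn (E.continuous.comp hD).continuousOn p,
    ae_of_all _ fun s => hE (D s)⟩

section Abstract

variable {H W : Type*} [NormedAddCommGroup H] [InnerProductSpace ℝ H] [NormedAddCommGroup W]
  [NormedSpace ℝ W]

theorem MemLocLp.intervalIntegrable_apply {N : ℝ → StrongDual ℝ W} (hN : MemLocLp 1 N) (ψ : W)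
    {t : ℝ} (ht : 0 ≤ t) : IntervalIntegrable (fun s => N s ψ) volume 0 t :=
  MemLocLp.intervalIntegrable (fun T hT => memLp_one_iff_integrable.2
    ((memLp_one_iff_integrable.1 (hN T hT)).apply_continuousLinearMap ψ)) ht

/-- The functional `ψ ↦ (h, J ψ)`. -/
noncomputable def innerDual (J : W →L[ℝ] H) : H →L[ℝ] StrongDual ℝ W :=
  ((ContinuousLinearMap.compL ℝ W H ℝ).flip J).comp (innerSL ℝ)

theorem inner_sub_eq_add_integral {J : W →L[ℝ] H} {N₁ N₂ : ℝ → StrongDual ℝ W} {w₁ w₂ : ℝ → H}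
    {ψ : W} {t : ℝ} (ht : 0 ≤ t)
    (h₁ : inner ℝ (w₁ t) (J ψ) = inner ℝ (w₁ 0) (J ψ) + ∫ s in (0 : ℝ)..t, N₁ s ψ)
    (h₂ : inner ℝ (w₂ t) (J ψ) = inner ℝ (w₂ 0) (J ψ) + ∫ s in (0 : ℝ)..t, N₂ s ψ)
    (hN₁ : MemLocLp 1 N₁) (hN₂ : MemLocLp 1 N₂) :
    inner ℝ (w₁ t - w₂ t) (J ψ) = inner ℝ (w₁ 0 - w₂ 0) (J ψ)
      + ∫ s in (0 : ℝ)..t, (N₁ s - N₂ s) ψ := by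
  have h3 : ∫ s in (0 : ℝ)..t, (N₁ s - N₂ s) ψ
      = (∫ s in (0 : ℝ)..t, N₁ s ψ) - ∫ s in (0 : ℝ)..t, N₂ s ψ :=
    intervalIntegral.integral_sub (hN₁.intervalIntegrable_apply ψ ht)
      (hN₂.intervalIntegrable_apply ψ ht)
  rw [h3, inner_sub_left, inner_sub_left, h₁, h₂]
  ring

theorem inner_add_eq_add_integral [CompleteSpace H] {J : W →L[ℝ] H} {N : ℝ → StrongDual ℝ W}
    {w y c : ℝ → H} (hw : ∀ ψ t, 0 ≤ t →
      inner ℝ (w t) (J ψ) = inner ℝ (w 0) (J ψ) + ∫ s in (0 : ℝ)..t, N s ψ)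
    (hN : MemLocLp 1 N) (hc : Continuous c)
    (hy : ∀ t, 0 ≤ t → y t = y 0 + ∫ s in (0 : ℝ)..t, c s) (ψ : W) (t : ℝ) (ht : 0 ≤ t) :
    inner ℝ (w t + y t) (J ψ) = inner ℝ (w 0 + y 0) (J ψ)
      + ∫ s in (0 : ℝ)..t, (N s + innerDual J (c s)) ψ := by
  have h1 : IntervalIntegrable (fun s => N s ψ) volume 0 t := hN.intervalIntegrable_apply ψ ht
  have h2 : ∫ s in (0 : ℝ)..t, inner ℝ (c s) (J ψ) = inner ℝ (∫ s in (0 : ℝ)..t, c s) (J ψ) :=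
    ((innerSL ℝ).flip (J ψ)).intervalIntegral_comp_comm (hc.intervalIntegrable 0 t)
  have h3 : Continuous fun s => inner ℝ (c s) (J ψ) := hc.inner continuous_const
  have h4 : ∫ s in (0 : ℝ)..t, (N s + innerDual J (c s)) ψ
      = (∫ s in (0 : ℝ)..t, N s ψ) + ∫ s in (0 : ℝ)..t, inner ℝ (c s) (J ψ) :=
    intervalIntegral.integral_add h1 (h3.intervalIntegrable 0 t)
  rw [h4, h2, inner_add_left, inner_add_left, hw ψ t ht, hy t ht, inner_add_left]
  ring

end Abstract

/-- A field `h ∈ ℍ` as a functional on `𝕍 ∩ L̃^{r+1}`. -/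
noncomputable def hToDual (O : Set (Ed d)) (r : ℝ) : HSpace O →L[ℝ] StrongDual ℝ (WSpace O r) :=
  innerDual (W := WSpace O r) (H := HSpace O) ((vToH O).comp (wToVL O r))

theorem two_le_dampExp (hr : 1 ≤ r) : 2 ≤ dampExp r := by
  rw [dampExp_eq hr, ← ENNReal.ofReal_ofNat]
  exact ENNReal.ofReal_le_ofReal (by linarith)

theorem dampExp_le_four (hr : 1 ≤ r) (hr3 : r ≤ 3) : dampExp r ≤ 4 := by
  rw [dampExp_eq hr, ← ENNReal.ofReal_ofNat]
  exact ENNReal.ofReal_le_ofReal (by linarith)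

/-- The sum `u = v + Υ` is the same on both sides, so the nonlinear terms agree, and `-αv + (χ-α)Υ =
-αu + χΥ`. What remains is `χ'Υ' - χΥ` and `-μ(∇D, ∇ψ) = -μ(G, ψ)`. -/
theorem rhsForm_add_eq {χ' : ℝ} {Υ Υ' G : HSpace O} {D : VSpace O} (hsub : Υ - Υ' = vToH O D)
    (hGD : ∀ ψ, inner ℝ (vGrad D) (vGrad ψ) = inner ℝ (G : LpField O 2) (vField ψ))
    (V : VSpace O) (v : HSpace O) (ψ : WSpace O r) :
    rhsForm μ α β r χ f V v Υ ψ + inner ℝ (χ' • Υ' - χ • Υ - μ • G) (vToH O (wToV ψ))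
      = rhsForm μ α β r χ' f (V + D) (v + vToH O D) Υ' ψ := by
  have e0 : v + vToH O D + Υ' = v + Υ := by rw [← hsub]; abel
  have e2 : inner ℝ ((v + vToH O D : HSpace O) : LpField O 2) (vField (wToV ψ))
      = inner ℝ (v : LpField O 2) (vField (wToV ψ)) + inner ℝ (Υ : LpField O 2) (vField (wToV ψ))
        - inner ℝ (Υ' : LpField O 2) (vField (wToV ψ)) := by
    rw [← hsub, Submodule.coe_add, Submodule.coe_sub, inner_add_left, inner_sub_left, add_sub_assoc]
  have e4 : inner ℝ (vGrad (V + D)) (vGrad (wToV ψ))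
      = inner ℝ (vGrad V) (vGrad (wToV ψ)) + inner ℝ (G : LpField O 2) (vField (wToV ψ)) := by
    rw [vGrad_add, inner_add_left, hGD]
  have e5 : inner ℝ (χ' • Υ' - χ • Υ - μ • G) (vToH O (wToV ψ))
      = χ' * inner ℝ (Υ' : LpField O 2) (vField (wToV ψ))
        - χ * inner ℝ (Υ : LpField O 2) (vField (wToV ψ))
        - μ * inner ℝ (G : LpField O 2) (vField (wToV ψ)) := by
    rw [Submodule.coe_inner, coe_vToH, Submodule.coe_sub, Submodule.coe_sub, Submodule.coe_smul,
      Submodule.coe_smul, Submodule.coe_smul, inner_sub_left, inner_sub_left, real_inner_smul_left,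
      real_inner_smul_left, real_inner_smul_left]
  simp only [rhsForm, e0, e2, e4, e5]
  ring

set_option maxHeartbeats 1000000 in
/-- Passing from the driving path `Υ + D` to the driving path `Υ`. -/
theorem IsPreSolution.shift {χ' : ℝ} {Υ' : ℝ → HSpace O}
    (h : IsPreSolution O μ α β r χ f Υ v vV g) (hr : 1 ≤ r) (hdr : d = 2 ∨ 3 ≤ r)
    (hΥ : Continuous Υ) (hΥ' : Continuous Υ') (hdΥ' : IsDrivingPath r Υ') {G : ℝ → HSpace O}
    {D : ℝ → VSpace O} (hG : Continuous G) (hD : Continuous D)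
    (hsub : ∀ t, Υ t - Υ' t = vToH O (D t))
    (hGD : ∀ t (ψ : VSpace O), inner ℝ (vGrad (D t)) (vGrad ψ)
      = inner ℝ (G t : LpField O 2) (vField ψ))
    (hDt : ∀ t, 0 ≤ t → vToH O (D t) = vToH O (D 0)
      + ∫ s in (0 : ℝ)..t, (χ' • Υ' s - χ • Υ s - μ • G s)) :
    IsPreSolution O μ α β r χ' f Υ' (fun s => v s + vToH O (D s)) (fun s => vV s + D s)
      (fun s => g s + hToDual O r (χ' • Υ' s - χ • Υ s - μ • G s)) := by
  have hc : Continuous fun s => χ' • Υ' s - χ • Υ s - μ • G s := by fun_prop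
  have hDc : Continuous fun s => vToH O (D s) := (vToH O).continuous.comp hD
  have hNc : Continuous fun s => hToDual O r (χ' • Υ' s - χ • Υ s - μ • G s) :=
    (hToDual O r).continuous.comp hc
  refine ⟨hdΥ', h.continuousOn.add hDc.continuousOn, ?_, ⟨fun T hT => (h.memL2V.1 T hT).add
    (memLocLp_of_continuousOn hD.continuousOn 2 T hT), ?_⟩, fun T hT => (h.memDual T hT).add
    (memLocLp_of_continuousOn hNc.continuousOn _ T hT), ?_, ?_⟩
  -- For `r < 3` the integrability of `D` comes from the planar embedding of `𝕍`. For `r ≥ 3` it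
  -- comes from `D = Υ - Υ'`, both being driving paths with exponent `r + 1`.
  · rcases lt_or_ge r 3 with h3 | h3
    · obtain rfl : d = 2 := hdr.resolve_right (by linarith)
      exact h.memLp.add (inLpLtilde_vToH (two_le_dampExp hr) (dampExp_le_four hr h3.le) hD)
    · have e : noiseExp r = dampExp r := if_neg (not_lt.2 h3)
      have := (h.memLp.add (h.driving.2.of_eq e)).add (hdΥ'.2.of_eq e).neg
      refine (congrArg (InLpLtilde (dampExp r)) (funext fun s => ?_)).mp this
      rw [← hsub]
      abel
  · filter_upwards [h.memL2V.2] with s hs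
    rw [vField_add, hs]
    rfl
  · exact inner_add_eq_add_integral (H := HSpace O) (W := WSpace O r)
      (J := (vToH O).comp (wToVL O r)) (y := fun s => vToH O (D s)) h.timeDeriv
      (h.memDual.mono_exponent (one_le_dualExp hr)) hc hDt
  · intro ψ
    filter_upwards [h.equation ψ] with s hs
    exact (congrArg (· + inner ℝ (χ' • Υ' s - χ • Υ s - μ • G s) (vToH O (wToV ψ))) hs).trans
      (rhsForm_add_eq (hsub s) (hGD s) (vV s) (v s) ψ)

end Shift

end SCBF


namespace SCBF

variable {d : ℕ} {O : Set (Ed d)} {μ α β r χ : ℝ} {f : StrongDual ℝ (VSpace O)}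

/-! ### Differences of the nonlinear terms. -/

section Trilinear

/-- The cancellation `b(u, w, w) = 0` for `u ∈ L̃^p` with `p ≥ 4`. -/
theorem integral_triVal_self_of_memLp_four {p : ℝ≥0∞} [Fact (1 ≤ p)] (hp : 4 ≤ p) (w : VSpace O)
    (hw : MemLp (vField w) 4 (volume.restrict O)) {u : LpField O p} (hu : u ∈ Ltilde O p) :
    ∫ x in O, triVal (u x) (vGrad w x) (vField w x) = 0 := by
  have h2 : (4 : ℝ≥0∞)⁻¹ + 4⁻¹ = 2⁻¹ := holderTriple_four.inv_add_inv_eq_inv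
  have h4 : p⁻¹ ≤ 4⁻¹ := ENNReal.inv_le_inv.2 hp
  have hp2 : p⁻¹ ≤ 2⁻¹ := h4.trans (h2 ▸ le_self_add)
  have hp1 : p⁻¹ ≤ 1 := ENNReal.inv_le_one.2 Fact.out
  have hpt : p⁻¹ ≠ ∞ := (hp1.trans_lt ENNReal.one_lt_top).ne
  have : ENNReal.HolderConjugate (1 - p⁻¹)⁻¹ p := ⟨by
    rw [inv_inv, tsub_add_cancel_of_le hp1, inv_one]⟩
  have : Fact (1 ≤ (1 - p⁻¹)⁻¹) := ⟨by
    rw [ENNReal.one_le_inv]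
    exact tsub_le_self⟩
  -- The exponent `σ` with `1/σ = 1/2 - 1/p` satisfies `2 ≤ σ ≤ 4` as `p ≥ 4`, so `w ∈ L² ∩ L⁴` is
  -- in `L^σ`, and `|∇w| |w|` is in the space dual to `Lᵖ`.
  have : ENNReal.HolderTriple 2 (2⁻¹ - p⁻¹)⁻¹ (1 - p⁻¹)⁻¹ := ⟨by
    rw [inv_inv, inv_inv]
    refine ENNReal.eq_sub_of_add_eq hpt ?_
    rw [add_assoc, tsub_add_cancel_of_le hp2, ENNReal.inv_two_add_inv_two]⟩
  have hσ : MemLp (vField w) (2⁻¹ - p⁻¹)⁻¹ (volume.restrict O) := by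
    refine memLp_of_memLp_of_memLp (by norm_num) (by norm_num) ?_ ?_ (Lp.memLp (vField w)) hw
    · rw [ENNReal.le_inv_iff_le_inv]
      exact tsub_le_self
    · rw [ENNReal.inv_le_iff_inv_le]
      refine ENNReal.le_sub_of_add_le_right hpt ?_
      rw [← h2]
      exact add_le_add_right h4 _
  refine integral_triVal_self (p' := (1 - p⁻¹)⁻¹) w ?_ hu
  have h := hσ.norm.mul (r := (1 - p⁻¹)⁻¹) (Lp.memLp (vGrad w)).norm
  exact h.mono (aestronglyMeasurable_contract (Lp.aestronglyMeasurable _)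
    (Lp.aestronglyMeasurable _)) (ae_of_all _ fun x => (norm_contract_le _ _).trans
      (le_abs_self _))

variable {u₁ u₂ : HSpace O} {w : VSpace O}

theorem coeFn_vField_of_eq_sub (hw : vToH O w = u₁ - u₂) :
    (vField w : Ed d → Ed d) =ᵐ[volume.restrict O]
      fun x => (u₁ : LpField O 2) x - (u₂ : LpField O 2) x := by
  rw [← coe_vToH, hw]
  exact Lp.coeFn_sub _ _

/-- Inserting `u₁ = u₂ + w` gives `b(u₁,w,u₁) = b(u₂,w,u₂) + b(u₁,w,w) + b(w,w,u₂)`, and the middle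
term cancels. -/
theorem convForm_sub_convForm (hw : vToH O w = u₁ - u₂)
    (h₁ : MemLp (u₁ : LpField O 2) 4 (volume.restrict O))
    (h₂ : MemLp (u₂ : LpField O 2) 4 (volume.restrict O))
    (h₀ : ∫ x in O, triVal ((u₁ : LpField O 2) x) (vGrad w x) (vField w x) = 0) :
    convForm O u₁ w - convForm O u₂ w
      = -∫ x in O, triVal (vField w x) (vGrad w x) ((u₂ : LpField O 2) x) := by
  have hae := coeFn_vField_of_eq_sub hw
  have h₃ : MemLp (vField w) 4 (volume.restrict O) := (h₁.sub h₂).ae_eq hae.symm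
  have hG := Lp.memLp (vGrad w)
  have e : triForm O (u₁ : LpField O 2) (vGrad w) (u₁ : LpField O 2)
      = ∫ x in O, ((triVal ((u₂ : LpField O 2) x) (vGrad w x) ((u₂ : LpField O 2) x)
        + triVal ((u₁ : LpField O 2) x) (vGrad w x) (vField w x))
        + triVal (vField w x) (vGrad w x) ((u₂ : LpField O 2) x)) := by
    refine integral_congr_ae (hae.mono fun x hx => ?_)
    have h : (u₁ : LpField O 2) x = (u₂ : LpField O 2) x + vField w x :=
      sub_eq_iff_eq_add'.1 hx.symm
    change triVal _ _ _ = _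
    beta_reduce
    rw [h]
    simp only [triVal_add_left, triVal_add_right]
    ring
  have h22 := integrable_triVal h₂ hG h₂
  have h13 := integrable_triVal h₁ hG h₃
  have hs : Integrable (fun x => triVal ((u₂ : LpField O 2) x) (vGrad w x) ((u₂ : LpField O 2) x)
      + triVal ((u₁ : LpField O 2) x) (vGrad w x) (vField w x)) (volume.restrict O) := h22.add h13
  rw [integral_add hs (integrable_triVal h₃ hG h₂), integral_add h22 h13, h₀] at e
  have e' : triForm O (u₂ : LpField O 2) (vGrad w) (u₂ : LpField O 2)
    = ∫ x in O, triVal ((u₂ : LpField O 2) x) (vGrad w x) ((u₂ : LpField O 2) x) := rfl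
  rw [convForm, convForm, e, e']
  ring

/-- The weighted `L²` norm controlled by the damping. -/
theorem damping_lower_bound (hr : 1 ≤ r) (hw : vToH O w = u₁ - u₂)
    (h₁ : Integrable (fun x => ‖(u₁ : LpField O 2) x‖ ^ (r - 1)
      * inner ℝ ((u₁ : LpField O 2) x) (vField w x)) (volume.restrict O))
    (h₂ : Integrable (fun x => ‖(u₂ : LpField O 2) x‖ ^ (r - 1)
      * inner ℝ ((u₂ : LpField O 2) x) (vField w x)) (volume.restrict O)) :
    Integrable (fun x => ‖(u₂ : LpField O 2) x‖ ^ (r - 1) * ‖vField w x‖ ^ 2)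
      (volume.restrict O) ∧
    1 / 2 * (∫ x in O, ‖(u₂ : LpField O 2) x‖ ^ (r - 1) * ‖vField w x‖ ^ 2)
      ≤ dampForm O r u₁ (vField w) - dampForm O r u₂ (vField w) := by
  have hle : ∀ᵐ x ∂volume.restrict O,
      1 / 2 * (‖(u₂ : LpField O 2) x‖ ^ (r - 1) * ‖vField w x‖ ^ 2)
      ≤ ‖(u₁ : LpField O 2) x‖ ^ (r - 1) * inner ℝ ((u₁ : LpField O 2) x) (vField w x)
        - ‖(u₂ : LpField O 2) x‖ ^ (r - 1) * inner ℝ ((u₂ : LpField O 2) x) (vField w x) := by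
    filter_upwards [coeFn_vField_of_eq_sub hw] with x hx
    rw [hx, ← mul_assoc]
    exact damping_monotone hr _ _
  have hm : AEStronglyMeasurable (fun x => 1 / 2 * (‖(u₂ : LpField O 2) x‖ ^ (r - 1)
      * ‖vField w x‖ ^ 2)) (volume.restrict O) := by
    have hc : Continuous fun y : ℝ => y ^ (r - 1) := Real.continuous_rpow_const (by linarith)
    exact ((hc.comp_aestronglyMeasurable (Lp.aestronglyMeasurable _).norm).mul
      ((Lp.aestronglyMeasurable _).norm.pow 2)).const_mul _
  have hi : Integrable (fun x => 1 / 2 * (‖(u₂ : LpField O 2) x‖ ^ (r - 1)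
      * ‖vField w x‖ ^ 2)) (volume.restrict O) := by
    refine (h₁.sub h₂).mono hm (hle.mono fun x hx => ?_)
    rw [Real.norm_eq_abs, abs_of_nonneg (by positivity)]
    exact hx.trans (le_abs_self _)
  refine ⟨(hi.const_mul 2).congr (ae_of_all _ fun x => ?_), ?_⟩
  · ring
  · rw [dampForm, dampForm, ← integral_const_mul, ← integral_sub h₁ h₂]
    exact integral_mono_ae hi (h₁.sub h₂) hle

end Trilinear

/-! ### Absorption of the trilinear term. -/

section Absorption

/-- Young's inequality twice: it first separates `a` from `qp`, then bounds `q²p²` through `q⁴ ≤ C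
b² a²`. Each use costs half of `μ a²`. -/
theorem mul_le_of_pow_four_le {a b q p C : ℝ} (hμ : 0 < μ) (hC : 0 ≤ C)
    (hq : q ^ 4 ≤ C * (b ^ 2 * a ^ 2)) :
    a * (q * p) ≤ μ * a ^ 2 + C / (8 * μ ^ 3) * p ^ 4 * b ^ 2 := by
  have h1 : a * (q * p) ≤ μ / 2 * a ^ 2 + 1 / (2 * μ) * (q ^ 2 * p ^ 2) := by
    have e : μ / 2 * a ^ 2 + 1 / (2 * μ) * (q ^ 2 * p ^ 2) - a * (q * p)
        = 1 / (2 * μ) * (μ * a - q * p) ^ 2 := by field_simp; ring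
    have : 0 ≤ 1 / (2 * μ) * (μ * a - q * p) ^ 2 := by positivity
    linarith
  have h2 : q ^ 2 * p ^ 2 ≤ μ ^ 2 * a ^ 2 + C / (4 * μ ^ 2) * p ^ 4 * b ^ 2 := by
    refine le_of_sq_le_sq ?_ (by positivity)
    have h3 : (q ^ 2 * p ^ 2) ^ 2 ≤ C * (b ^ 2 * a ^ 2) * p ^ 4 := by
      calc (q ^ 2 * p ^ 2) ^ 2 = q ^ 4 * p ^ 4 := by ring
        _ ≤ _ := mul_le_mul_of_nonneg_right hq (by positivity)
    have e : (μ ^ 2 * a ^ 2 + C / (4 * μ ^ 2) * p ^ 4 * b ^ 2) ^ 2 - C * (b ^ 2 * a ^ 2) * p ^ 4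
        = (μ ^ 2 * a ^ 2 - C / (4 * μ ^ 2) * p ^ 4 * b ^ 2) ^ 2 := by field_simp; ring
    linarith [sq_nonneg (μ ^ 2 * a ^ 2 - C / (4 * μ ^ 2) * p ^ 4 * b ^ 2)]
  have h4 : 1 / (2 * μ) * (q ^ 2 * p ^ 2)
      ≤ 1 / (2 * μ) * (μ ^ 2 * a ^ 2 + C / (4 * μ ^ 2) * p ^ 4 * b ^ 2) :=
    mul_le_mul_of_nonneg_left h2 (by positivity)
  have e : 1 / (2 * μ) * (μ ^ 2 * a ^ 2 + C / (4 * μ ^ 2) * p ^ 4 * b ^ 2)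
      = μ / 2 * a ^ 2 + C / (8 * μ ^ 3) * p ^ 4 * b ^ 2 := by field_simp; ring
  linarith

theorem toReal_eLpNorm_four_pow {E : Type*} [NormedAddCommGroup E] {X : Type*} [MeasurableSpace X] {ν : Measure X} (u : X → E) :
    (eLpNorm u 4 ν).toReal ^ 4 = (∫⁻ x, ‖u x‖ₑ ^ (4 : ℝ) ∂ν).toReal := by
  have h := eLpNorm_rpow_toReal (p := 4) (ν := ν) (by norm_num) (by norm_num) u
  rw [ENNReal.toReal_ofNat] at h
  rw [← h, ← ENNReal.toReal_rpow]
  norm_cast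

theorem memLp_four_of_moment {u : HSpace O} (h : moment 4 u < ∞) :
    MemLp (u : LpField O 2) 4 (volume.restrict O) :=
  memLp_of_lintegral_rpow_lt_top (by norm_num) (by norm_num) (Lp.aestronglyMeasurable _) (by
    rw [ENNReal.toReal_ofNat]; exact h)

theorem exists_integral_triVal_le_two (hμ : 0 < μ) : ∃ K : ℝ, 0 ≤ K ∧
    ∀ {O : Set (Ed 2)} (w : VSpace O) (u : HSpace O), moment 4 u < ∞ →
      ∫ x in O, triVal (vField w x) (vGrad w x) ((u : LpField O 2) x)
        ≤ μ * ‖vGrad w‖ ^ 2 + K * (moment 4 u).toReal * ‖vField w‖ ^ 2 := by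
  obtain ⟨C, hC⟩ := exists_lintegral_four_le
  refine ⟨C / (8 * μ ^ 3), by positivity, fun {O} w u hu => ?_⟩
  have h1 := abs_integral_triVal_le (memLp_four_vField w) (Lp.memLp (vGrad w))
    (memLp_four_of_moment hu)
  rw [← Lp.norm_def] at h1
  have hq : (eLpNorm (vField w) 4 (volume.restrict O)).toReal ^ 4
      ≤ C * (‖vField w‖ ^ 2 * ‖vGrad w‖ ^ 2) := by
    rw [toReal_eLpNorm_four_pow]
    exact ENNReal.toReal_le_of_le_ofReal (by positivity) (hC w)
  have h2 := mul_le_of_pow_four_le (p := (eLpNorm (u : LpField O 2) 4 (volume.restrict O)).toReal)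
    hμ C.2 hq
  rw [toReal_eLpNorm_four_pow] at h2
  exact (le_abs_self _).trans (h1.trans h2)

/-- For `r > 3` the power `y^{r-1}` dominates `y²` for large `y`, and `K` covers bounded `y`. For `r
= 3` the powers coincide and `1/(4μ) ≤ β/2` is exactly the condition `2βμ ≥ 1`. -/
theorem exists_sq_le_rpow (hμ : 0 < μ) (hβ : 0 < β) (hr : 3 < r ∨ r = 3 ∧ 1 ≤ 2 * β * μ) :
    ∃ K : ℝ, 0 ≤ K ∧ ∀ y : ℝ, 0 ≤ y → 1 / (4 * μ) * y ^ 2 ≤ β / 2 * y ^ (r - 1) + K := by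
  rcases hr with hr | ⟨rfl, h⟩
  · have hlim : Tendsto (fun y : ℝ => y ^ (r - 3)) atTop atTop := tendsto_rpow_atTop (by linarith)
    obtain ⟨M, hM⟩ := eventually_atTop.1 (hlim.eventually_ge_atTop (2 / β * (1 / (4 * μ))))
    refine ⟨1 / (4 * μ) * (max M 1) ^ 2, by positivity, fun y hy => ?_⟩
    rcases le_total y (max M 1) with hyM | hyM
    · have : 1 / (4 * μ) * y ^ 2 ≤ 1 / (4 * μ) * (max M 1) ^ 2 := by gcongr
      have : 0 ≤ β / 2 * y ^ (r - 1) := by positivity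
      linarith
    · have hy0 : 0 < y := zero_lt_one.trans_le ((le_max_right _ _).trans hyM)
      have h1 := hM y ((le_max_left _ _).trans hyM)
      have e : y ^ (r - 1) = y ^ (r - 3) * y ^ 2 := by
        rw [← Real.rpow_natCast, ← Real.rpow_add hy0]
        congr 1
        push_cast
        ring
      have h2 : 2 / β * (1 / (4 * μ)) * y ^ 2 ≤ y ^ (r - 1) := by rw [e]; gcongr
      have h3 : β / 2 * (2 / β * (1 / (4 * μ)) * y ^ 2) ≤ β / 2 * y ^ (r - 1) := by gcongr
      have e' : β / 2 * (2 / β * (1 / (4 * μ)) * y ^ 2) = 1 / (4 * μ) * y ^ 2 := by field_simp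
      have : 0 ≤ 1 / (4 * μ) * (max M 1) ^ 2 := by positivity
      linarith
  · refine ⟨0, le_rfl, fun y hy => ?_⟩
    have e : y ^ ((3 : ℝ) - 1) = y ^ 2 := by
      rw [← Real.rpow_natCast]
      norm_num
    rw [e, add_zero]
    refine mul_le_mul_of_nonneg_right ?_ (sq_nonneg y)
    rw [div_le_div_iff₀ (by positivity) (by norm_num)]
    linarith

/-- Pointwise `|w| |∇w| |u| ≤ μ|∇w|² + |u|²|w|²/(4μ)`, and the weight `|u|²` is traded for the
damping weight `|u|^{r-1}` and a constant. -/
theorem integral_triVal_le_of_sq_le_rpow (hμ : 0 < μ) {K : ℝ}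
    (hK : ∀ y : ℝ, 0 ≤ y → 1 / (4 * μ) * y ^ 2 ≤ β / 2 * y ^ (r - 1) + K) {w : VSpace O}
    {u : HSpace O} (hu : MemLp (u : LpField O 2) 4 (volume.restrict O))
    (hw : MemLp (vField w) 4 (volume.restrict O))
    (hi : Integrable (fun x => ‖(u : LpField O 2) x‖ ^ (r - 1) * ‖vField w x‖ ^ 2)
      (volume.restrict O)) :
    ∫ x in O, triVal (vField w x) (vGrad w x) ((u : LpField O 2) x)
      ≤ μ * ‖vGrad w‖ ^ 2 + β / 2 * (∫ x in O, ‖(u : LpField O 2) x‖ ^ (r - 1) * ‖vField w x‖ ^ 2)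
        + K * ‖vField w‖ ^ 2 := by
  have hG : Integrable (fun x => ‖vGrad w x‖ ^ 2) (volume.restrict O) :=
    (Lp.memLp (vGrad w)).norm.integrable_sq
  have hF : Integrable (fun x => ‖vField w x‖ ^ 2) (volume.restrict O) :=
    (Lp.memLp (vField w)).norm.integrable_sq
  have hs : Integrable (fun x => μ * ‖vGrad w x‖ ^ 2
      + β / 2 * (‖(u : LpField O 2) x‖ ^ (r - 1) * ‖vField w x‖ ^ 2)) (volume.restrict O) :=
    (hG.const_mul _).add (hi.const_mul _)
  rw [norm_sq_eq_integral (vGrad w), norm_sq_eq_integral (vField w), ← integral_const_mul,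
    ← integral_const_mul, ← integral_const_mul, ← integral_add (hG.const_mul _) (hi.const_mul _),
    ← integral_add hs (hF.const_mul _)]
  refine integral_mono (integrable_triVal hw (Lp.memLp _) hu) (hs.add (hF.const_mul _))
    fun x => ?_
  set a := ‖vField w x‖
  set b := ‖vGrad w x‖
  set y := ‖(u : LpField O 2) x‖
  have h1 : triVal (vField w x) (vGrad w x) ((u : LpField O 2) x) ≤ a * (b * y) :=
    (le_abs_self _).trans (abs_triVal_le _ _ _)
  have h2 : a * (b * y) ≤ μ * b ^ 2 + 1 / (4 * μ) * y ^ 2 * a ^ 2 := by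
    have e : μ * b ^ 2 + 1 / (4 * μ) * y ^ 2 * a ^ 2 - a * (b * y)
        = 1 / (4 * μ) * (2 * μ * b - a * y) ^ 2 := by field_simp; ring
    have : 0 ≤ 1 / (4 * μ) * (2 * μ * b - a * y) ^ 2 := by positivity
    linarith
  have h3 := mul_le_mul_of_nonneg_right (hK y (norm_nonneg _)) (sq_nonneg a)
  change _ ≤ μ * b ^ 2 + β / 2 * (y ^ (r - 1) * a ^ 2) + K * a ^ 2
  linarith

/-- The trilinear term is absorbed by the viscosity and the damping. -/
theorem exists_integral_triVal_le (hμ : 0 < μ) (hβ : 0 < β)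
    (hdr : d = 2 ∨ 3 < r ∨ r = 3 ∧ 1 ≤ 2 * β * μ) : ∃ K : ℝ, 0 ≤ K ∧
    ∀ {O : Set (Ed d)} (w : VSpace O) (u : HSpace O), moment 4 u < ∞ →
      MemLp (vField w) 4 (volume.restrict O) →
      Integrable (fun x => ‖(u : LpField O 2) x‖ ^ (r - 1) * ‖vField w x‖ ^ 2)
        (volume.restrict O) →
      ∫ x in O, triVal (vField w x) (vGrad w x) ((u : LpField O 2) x)
        ≤ μ * ‖vGrad w‖ ^ 2
          + β / 2 * (∫ x in O, ‖(u : LpField O 2) x‖ ^ (r - 1) * ‖vField w x‖ ^ 2)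
          + K * (1 + (moment 4 u).toReal) * ‖vField w‖ ^ 2 := by
  rcases hdr with rfl | hr
  · obtain ⟨K, hK0, hK⟩ := exists_integral_triVal_le_two hμ
    refine ⟨K, hK0, fun {O} w u hu _ _ => (hK w u hu).trans ?_⟩
    have h1 : 0 ≤ β / 2 * (∫ x in O, ‖(u : LpField O 2) x‖ ^ (r - 1) * ‖vField w x‖ ^ 2) :=
      mul_nonneg (by positivity) (integral_nonneg fun x => by positivity)
    have h2 : 0 ≤ K * ‖vField w‖ ^ 2 := by positivity
    linarith
  · obtain ⟨K, hK0, hK⟩ := exists_sq_le_rpow hμ hβ hr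
    refine ⟨K, hK0, fun {O} w u hu hw hi =>
      (integral_triVal_le_of_sq_le_rpow hμ hK (memLp_four_of_moment hu) hw hi).trans ?_⟩
    have : 0 ≤ K * (moment 4 u).toReal * ‖vField w‖ ^ 2 := by positivity
    linarith

end Absorption

end SCBF


namespace SCBF

variable {d : ℕ} {O : Set (Ed d)} {μ α β r χ : ℝ} {f : StrongDual ℝ (VSpace O)}

/-! ### The one-sided Lipschitz estimate. -/

section Difference

theorem norm_vToH (w : VSpace O) : ‖vToH O w‖ = ‖vField w‖ := rfl

theorem memLocLp_one_moment {u : ℝ → HSpace O} (hu : LocMeas u) {p : ℝ} (h : HasMoment p u) :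
    MemLocLp 1 fun s => (moment p (u s)).toReal := by
  have h1 := memLocLp_moment hu h zero_lt_one
  rw [inv_one, ENNReal.ofReal_one] at h1
  simpa only [Real.rpow_one] using h1

theorem MemLocLp.affine {m : ℝ → ℝ} (hm : MemLocLp 1 m) (K : ℝ) :
    MemLocLp 1 fun s => 2 * (K * (1 + m s)) := fun T hT =>
  (((memLp_const (1 : ℝ)).add (hm T hT)).const_mul K).const_mul 2

theorem four_le_noiseExp : 4 ≤ noiseExp r := by
  rw [noiseExp]
  split_ifs with h
  · exact le_rfl
  · rw [dampExp_eq (by linarith), ← ENNReal.ofReal_ofNat]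
    exact ENNReal.ofReal_le_ofReal (by linarith)

theorem rhsForm_sub_rhsForm {V₁ V₂ : VSpace O} {v₁ v₂ : HSpace O} (Υ : HSpace O)
    {ψ : WSpace O r} (hψ : wToV ψ = V₁ - V₂) (hv : vToH O (wToV ψ) = v₁ - v₂) :
    rhsForm μ α β r χ f V₁ v₁ Υ ψ - rhsForm μ α β r χ f V₂ v₂ Υ ψ
      = -μ * ‖vGrad (wToV ψ)‖ ^ 2 - α * ‖vField (wToV ψ)‖ ^ 2
        - (convForm O (v₁ + Υ) (wToV ψ) - convForm O (v₂ + Υ) (wToV ψ))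
        - β * (dampForm O r (v₁ + Υ) (vField (wToV ψ))
          - dampForm O r (v₂ + Υ) (vField (wToV ψ))) := by
  have e1 : inner ℝ (vGrad V₁) (vGrad (wToV ψ)) - inner ℝ (vGrad V₂) (vGrad (wToV ψ))
      = ‖vGrad (wToV ψ)‖ ^ 2 := by
    rw [← inner_sub_left, ← vGrad_sub, ← hψ, real_inner_self_eq_norm_sq]
  have e2 : inner ℝ (v₁ : LpField O 2) (vField (wToV ψ))
      - inner ℝ (v₂ : LpField O 2) (vField (wToV ψ)) = ‖vField (wToV ψ)‖ ^ 2 := by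
    rw [← inner_sub_left, ← Submodule.coe_sub, ← hv, coe_vToH, real_inner_self_eq_norm_sq]
  rw [← e1, ← e2, rhsForm, rhsForm]
  ring

theorem neg_convForm_sub_dampForm_le {p : ℝ≥0∞} [Fact (1 ≤ p)] (hp : 4 ≤ p) (hr : 1 ≤ r)
    (hβ : 0 ≤ β) {u₁ u₂ : HSpace O} {w : VSpace O} {W : LpField O (dampExp r)} {c : ℝ}
    (hw : (vField w : Ed d → Ed d) =ᵐ[volume.restrict O] W)
    (hsub : vToH O w = u₁ - u₂) (h₁ : moment 4 u₁ < ∞) (h₂ : moment 4 u₂ < ∞)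
    (k₁ : moment (r + 1) u₁ < ∞) (k₂ : moment (r + 1) u₂ < ∞) {y : LpField O p}
    (hy : y ∈ Ltilde O p) (hyu : (y : Ed d → Ed d) =ᵐ[volume.restrict O] (u₁ : LpField O 2))
    (hc : MemLp (vField w) 4 (volume.restrict O) →
      Integrable (fun x => ‖(u₂ : LpField O 2) x‖ ^ (r - 1) * ‖vField w x‖ ^ 2)
        (volume.restrict O) →
      ∫ x in O, triVal (vField w x) (vGrad w x) ((u₂ : LpField O 2) x)
        ≤ μ * ‖vGrad w‖ ^ 2
          + β / 2 * (∫ x in O, ‖(u₂ : LpField O 2) x‖ ^ (r - 1) * ‖vField w x‖ ^ 2) + c) :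
    -(convForm O u₁ w - convForm O u₂ w)
        - β * (dampForm O r u₁ (vField w) - dampForm O r u₂ (vField w))
      ≤ μ * ‖vGrad w‖ ^ 2 + c := by
  have m₁ := memLp_four_of_moment h₁
  have m₂ := memLp_four_of_moment h₂
  have m₃ : MemLp (vField w) 4 (volume.restrict O) :=
    (m₁.sub m₂).ae_eq (coeFn_vField_of_eq_sub hsub).symm
  have h₀ : ∫ x in O, triVal ((u₁ : LpField O 2) x) (vGrad w x) (vField w x) = 0 := by
    refine Eq.trans (integral_congr_ae (hyu.mono fun x hx => ?_))
      (integral_triVal_self_of_memLp_four hp w m₃ hy)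
    exact congrArg (fun a => triVal a (vGrad w x) (vField w x)) hx.symm
  obtain ⟨Δ₁, -, hΔ₁⟩ := exists_damping hr k₁
  obtain ⟨Δ₂, -, hΔ₂⟩ := exists_damping hr k₂
  have hD := damping_lower_bound hr hsub (hΔ₁ _ _ hw).2 (hΔ₂ _ _ hw).2
  have hT := hc m₃ hD.1
  have h6 := mul_le_mul_of_nonneg_left hD.2 hβ
  rw [convForm_sub_convForm hsub m₁ m₂ h₀]
  linarith

/-- The one-sided Lipschitz estimate behind uniqueness. -/
theorem rhsForm_sub_le (hα : 0 ≤ α) (hβ : 0 ≤ β) (hr : 1 ≤ r) {K : ℝ}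
    (hK : ∀ {O : Set (Ed d)} (w : VSpace O) (u : HSpace O), moment 4 u < ∞ →
      MemLp (vField w) 4 (volume.restrict O) →
      Integrable (fun x => ‖(u : LpField O 2) x‖ ^ (r - 1) * ‖vField w x‖ ^ 2)
        (volume.restrict O) →
      ∫ x in O, triVal (vField w x) (vGrad w x) ((u : LpField O 2) x)
        ≤ μ * ‖vGrad w‖ ^ 2
          + β / 2 * (∫ x in O, ‖(u : LpField O 2) x‖ ^ (r - 1) * ‖vField w x‖ ^ 2)
          + K * (1 + (moment 4 u).toReal) * ‖vField w‖ ^ 2)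
    {V₁ V₂ : VSpace O} {v₁ v₂ Υ : HSpace O} {ψ : WSpace O r} (hψ : wToV ψ = V₁ - V₂)
    (hv : vToH O (wToV ψ) = v₁ - v₂) (h₁ : moment 4 (v₁ + Υ) < ∞) (h₂ : moment 4 (v₂ + Υ) < ∞)
    (k₁ : moment (r + 1) (v₁ + Υ) < ∞) (k₂ : moment (r + 1) (v₂ + Υ) < ∞)
    (hy : ∃ y : LpField O (noiseExp r), y ∈ Ltilde O (noiseExp r) ∧
      (y : Ed d → Ed d) =ᵐ[volume.restrict O] ((v₁ + Υ : HSpace O) : LpField O 2)) :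
    rhsForm μ α β r χ f V₁ v₁ Υ ψ - rhsForm μ α β r χ f V₂ v₂ Υ ψ
      ≤ K * (1 + (moment 4 (v₂ + Υ)).toReal) * ‖v₁ - v₂‖ ^ 2 := by
  have hsub : vToH O (wToV ψ) = (v₁ + Υ) - (v₂ + Υ) := by rw [hv]; abel
  have hn : ‖v₁ - v₂‖ = ‖vField (wToV ψ)‖ := by rw [← hv, norm_vToH]
  have e := rhsForm_sub_rhsForm (μ := μ) (α := α) (β := β) (χ := χ) (f := f) Υ hψ hv
  have h5 : 0 ≤ α * ‖vField (wToV ψ)‖ ^ 2 := mul_nonneg hα (sq_nonneg _)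
  have h := neg_convForm_sub_dampForm_le (μ := μ) four_le_noiseExp hr hβ (coeFn_wToLp ψ) hsub
    h₁ h₂ k₁ k₂ hy.choose_spec.1 hy.choose_spec.2 (hK (wToV ψ) (v₂ + Υ) h₂)
  rw [hn]
  linarith

end Difference

/-! ### Uniqueness of solutions. -/

section Uniqueness

variable {Υ v v₁ v₂ : ℝ → HSpace O} {vV V₁ V₂ : ℝ → VSpace O}
  {g g₁ g₂ : ℝ → StrongDual ℝ (WSpace O r)}

/-- The cancellation `b(u, w, w) = 0` requires `u` to be a limit of test fields in some `Lᵖ` with `p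
≥ 4`; integrability alone would not suffice for the density argument. -/
theorem IsPreSolution.ae_exists_ltilde (h : IsPreSolution O μ α β r χ f Υ v vV g)
    (hdr : d = 2 ∨ 3 ≤ r) : ∀ᵐ s ∂volume.restrict (Ici (0 : ℝ)),
      ∃ y : LpField O (noiseExp r), y ∈ Ltilde O (noiseExp r) ∧
        (y : Ed d → Ed d) =ᵐ[volume.restrict O] ((v s + Υ s : HSpace O) : LpField O 2) := by
  have hΥ := h.driving.2
  have hv : ∀ᵐ s ∂volume.restrict (Ici (0 : ℝ)),
      ∃ y : LpField O (noiseExp r), y ∈ Ltilde O (noiseExp r) ∧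
        (y : Ed d → Ed d) =ᵐ[volume.restrict O] (v s : LpField O 2) := by
    rcases lt_or_ge r 3 with h3 | h3
    · obtain rfl : d = 2 := hdr.resolve_right (by linarith)
      have e4 : noiseExp r = 4 := if_pos h3
      have hE := exists_vToLtilde (O := O) (q := noiseExp r) (by rw [e4]; norm_num) e4.le
      obtain ⟨E, hE⟩ := hE
      refine h.memL2V.2.mono fun s hs => ⟨E (vV s), (E (vV s)).2, (hE (vV s)).trans ?_⟩
      rw [hs]
    · have e : dampExp r = noiseExp r := (if_neg (not_lt.2 h3)).symm
      obtain ⟨vL, -, hL⟩ := h.memLp.of_eq e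
      exact hL.mono fun s hs => ⟨vL s, (vL s).2, hs⟩
  obtain ⟨ΥL, -, hL⟩ := hΥ
  filter_upwards [hv, hL] with s hs hs'
  obtain ⟨y, hy, hyv⟩ := hs
  exact ⟨y + ΥL s, add_mem hy (ΥL s).2, (Lp.coeFn_add _ _).trans ((hyv.add hs').trans
    (Lp.coeFn_add (v s : LpField O 2) (Υ s)).symm)⟩

set_option maxHeartbeats 1000000 in
theorem IsPreSolution.sub_timeDeriv (h₁ : IsPreSolution O μ α β r χ f Υ v₁ V₁ g₁)
    (h₂ : IsPreSolution O μ α β r χ f Υ v₂ V₂ g₂) (hr : 1 ≤ r) :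
    IsTimeDeriv (fun s => v₁ s - v₂ s) fun s => g₁ s - g₂ s :=
  fun ψ t ht => inner_sub_eq_add_integral (H := HSpace O) (W := WSpace O r)
    (J := (vToH O).comp (wToVL O r)) ht (h₁.timeDeriv ψ t ht) (h₂.timeDeriv ψ t ht)
    (h₁.memDual.mono_exponent (one_le_dualExp hr)) (h₂.memDual.mono_exponent (one_le_dualExp hr))

-- The energy identity for the difference and the one-sided Lipschitz estimate give an integral
-- inequality for `‖v₁ - v₂‖²`. Its coefficient is `1 + ‖v₂ + Υ‖⁴` with the `L⁴` norm, up to a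
-- constant, and is locally integrable in time.
set_option maxHeartbeats 1000000 in
theorem IsPreSolution.eq_of_eq_zero (h₁ : IsPreSolution O μ α β r χ f Υ v₁ V₁ g₁)
    (h₂ : IsPreSolution O μ α β r χ f Υ v₂ V₂ g₂) (hμ : 0 < μ) (hα : 0 ≤ α) (hβ : 0 < β)
    (hr : 1 ≤ r) (hdr : d = 2 ∨ 3 < r ∨ r = 3 ∧ 1 ≤ 2 * β * μ) (h0 : v₁ 0 = v₂ 0) {t : ℝ}
    (ht : 0 ≤ t) : v₁ t = v₂ t := by
  have hdr' : d = 2 ∨ 3 ≤ r := hdr.imp_right fun h => h.elim le_of_lt fun h => h.1.ge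
  obtain ⟨K, hK0, hK⟩ := exists_integral_triVal_le hμ hβ hdr
  have hb₁ := h₁.exists_bound hr hdr'
  obtain ⟨a₁, b₁, ha₁, hb₁, hg₁⟩ := hb₁
  have hb₂ := h₂.exists_bound hr hdr'
  obtain ⟨a₂, b₂, ha₂, hb₂, hg₂⟩ := hb₂
  have hw : ContinuousOn (fun s => v₁ s - v₂ s) (Ici 0) := h₁.continuousOn.sub h₂.continuousOn
  have hwV : InL2V (fun s => v₁ s - v₂ s) fun s => V₁ s - V₂ s := by
    refine ⟨fun T hT => (h₁.memL2V.1 T hT).sub (h₂.memL2V.1 T hT), ?_⟩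
    filter_upwards [h₁.memL2V.2, h₂.memL2V.2] with s hs hs'
    rw [vField_sub, hs, hs']
    rfl
  have hwL : InLpLtilde (dampExp r) fun s => v₁ s - v₂ s :=
    (congrArg (InLpLtilde (dampExp r)) (funext fun s => (sub_eq_add_neg _ _).symm)).mp
      (h₁.memLp.add h₂.memLp.neg)
  have he := (h₁.sub_timeDeriv h₂ hr).exists_energy hr hw hwV hwL
    (fun T hT => (h₁.memDual T hT).1.sub (h₂.memDual T hT).1) (a := fun s => a₁ s + a₂ s)
    (b := fun s => b₁ s + b₂ s) (fun T hT => (ha₁ T hT).add (ha₂ T hT))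
    (fun T hT => (hb₁ T hT).add (hb₂ T hT)) (by
      filter_upwards [hg₁, hg₂] with s hs hs' ψ
      have e : |(g₁ s - g₂ s) ψ| ≤ |g₁ s ψ| + |g₂ s ψ| := abs_sub (g₁ s ψ) (g₂ s ψ)
      linarith [hs.2 ψ, hs'.2 ψ])
  obtain ⟨z, hz, he⟩ := he
  have hm₁ := h₁.hasMoment hr hdr'
  have hm₂ := h₂.hasMoment hr hdr'
  have hle : ∀ᵐ s ∂volume.restrict (Ici (0 : ℝ)), (g₁ s - g₂ s) (z s)
      ≤ K * (1 + (moment 4 (v₂ s + Υ s)).toReal) * ‖v₁ s - v₂ s‖ ^ 2 := by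
    filter_upwards [hz, hg₁, hg₂, hm₁.1.ae_lt_top h₁.locMeas, hm₁.2.ae_lt_top h₁.locMeas,
      hm₂.1.ae_lt_top h₂.locMeas, hm₂.2.ae_lt_top h₂.locMeas, h₁.ae_exists_ltilde hdr']
      with s hs hs₁ hs₂ m₁ n₁ m₂ n₂ hy
    have e : (g₁ s - g₂ s) (z s) = rhsForm μ α β r χ f (V₁ s) (v₁ s) (Υ s) (z s)
        - rhsForm μ α β r χ f (V₂ s) (v₂ s) (Υ s) (z s) :=
      congrArg₂ (· - ·) (hs₁.1 (z s)) (hs₂.1 (z s))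
    exact e.trans_le (rhsForm_sub_le hα hβ.le hr hK hs.1 ((congrArg (vToH O) hs.1).trans hs.2)
      m₁ m₂ n₁ n₂ hy)
  have hk : MemLocLp 1 fun s => 2 * (K * (1 + (moment 4 (v₂ s + Υ s)).toReal)) :=
    (memLocLp_one_moment h₂.locMeas hm₂.1).affine K
  have hzero : ‖v₁ t - v₂ t‖ ^ 2 = 0 := by
    refine eq_zero_of_le_integral (y := fun s => ‖v₁ s - v₂ s‖ ^ 2) (hw.norm.pow 2)
      (fun s => by positivity) (fun s => by positivity) (fun T hT => hk.intervalIntegrable hT)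
      (fun T hT => ?_) ht
    have h0' : ‖v₁ 0 - v₂ 0‖ ^ 2 = 0 := by
      rw [h0, sub_self, norm_zero, zero_pow two_ne_zero]
    refine ((he T hT).2.trans ((congrArg (· + _) h0').trans (zero_add _))).trans_le
      ((intervalIntegral.integral_const_mul _ _).symm.trans_le ?_)
    refine intervalIntegral.integral_mono_ae_restrict hT ((he T hT).1.const_mul 2)
      ((hk.intervalIntegrable hT).mul_continuousOn ?_) ?_
    · rw [uIcc_of_le hT]
      exact (hw.norm.pow 2).mono fun s hs => hs.1
    · refine (ae_Icc_of_ae_Ici hle T).mono fun s hs => ?_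
      have := mul_le_mul_of_nonneg_left hs zero_le_two
      linarith
  exact sub_eq_zero.1 (norm_eq_zero.1 (pow_eq_zero_iff two_ne_zero |>.1 hzero))

end Uniqueness

section WeakSolution

variable {x : HSpace O} {Υ v : ℝ → HSpace O}

theorem IsWeakSolution.exists_isPreSolution (h : IsWeakSolution O μ α β r χ f x Υ v) :
    v 0 = x - Υ 0 ∧ ∃ vV g, IsPreSolution O μ α β r χ f Υ v vV g := by
  obtain ⟨hd, hc, hL, vV, g, hV, hg, ht, he, h0, -⟩ := h
  exact ⟨h0, vV, g, hd, hc, hL, hV, hg, ht, he⟩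

theorem IsPreSolution.isWeakSolution {vV : ℝ → VSpace O} {g : ℝ → StrongDual ℝ (WSpace O r)}
    (h : IsPreSolution O μ α β r χ f Υ v vV g) (h0 : v 0 = x - Υ 0) (hr : 1 ≤ r)
    (hdr : d = 2 ∨ 3 ≤ r) (hβ : β ≠ 0) : IsWeakSolution O μ α β r χ f x Υ v :=
  ⟨h.driving, h.continuousOn, h.memLp, vV, g, h.memL2V, h.memDual, h.timeDeriv, h.equation, h0,
    fun t ht => by rw [← h0]; exact h.energy hr hdr hβ ht⟩

end WeakSolution

end SCBF

/-! ### Independence of the trajectories from `χ`. -/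

theorem mainTheorem4 {d : ℕ} (O : Set (SCBF.Ed d)) (hO : IsOpen O) (hP : SCBF.PoincareDomain O)
    (μ α β r : ℝ) (hμ : 0 < μ) (hα : 0 < α) (hβ : 0 < β)
    (hdr : (d = 2 ∧ 1 ≤ r) ∨ (d = 3 ∧ 3 < r) ∨ (d = 3 ∧ r = 3 ∧ 1 ≤ 2 * β * μ))
    (δ ξ : ℝ) (hδ : 0 < δ) (hδξ : δ < ξ) (hξ : ξ < 1 / 2)
    (f : StrongDual ℝ (SCBF.VSpace O))
    (ω : ℝ → SCBF.NoiseSpace O (SCBF.noiseExp r) δ) (hω : SCBF.IsHolderPath ξ ω)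
    (x : SCBF.HSpace O) (χ₁ χ₂ : ℝ) (hχ₁ : 0 ≤ χ₁) (hχ₂ : 0 ≤ χ₂) :
    (∀ u₁ u₂ : ℝ → SCBF.HSpace O,
      SCBF.IsPhiTrajectory O μ α β r δ χ₁ f ω x u₁ →
      SCBF.IsPhiTrajectory O μ α β r δ χ₂ f ω x u₂ →
      ∀ t : ℝ, 0 ≤ t → u₁ t = u₂ t) ∧
    (SCBF.IsDrivingPath r (SCBF.ouPath O (SCBF.noiseExp r) μ χ₂ δ ω) →
      ∀ u : ℝ → SCBF.HSpace O,
        SCBF.IsPhiTrajectory O μ α β r δ χ₁ f ω x u →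
        SCBF.IsPhiTrajectory O μ α β r δ χ₂ f ω x u) := by
  have hr : 1 ≤ r := by
    rcases hdr with h | h | h <;> linarith [h.2]
  have hdr₁ : d = 2 ∨ 3 < r ∨ r = 3 ∧ 1 ≤ 2 * β * μ :=
    hdr.imp (fun h => h.1) fun h => h.imp (fun h => h.2) fun h => h.2
  have hdr₂ : d = 2 ∨ 3 ≤ r := hdr₁.imp_right fun h => h.elim le_of_lt fun h => h.1.ge
  obtain ⟨hc₁, hc₂, G, D, hG, hD, hsub, hGD, hDt⟩ :=
    SCBF.exists_ouPath_sub hP hμ hχ₁ hχ₂ hδ hδξ hξ hω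
  refine ⟨fun u₁ u₂ h₁ h₂ t ht => ?_, fun hd u h₁ => ?_⟩
  · obtain ⟨v₁, h₁, hu₁⟩ := h₁
    obtain ⟨v₂, h₂, hu₂⟩ := h₂
    obtain ⟨i₁, V₁, g₁, h₁⟩ := h₁.exists_isPreSolution
    obtain ⟨i₂, V₂, g₂, h₂⟩ := h₂.exists_isPreSolution
    -- The shifted path `v₁ + D` and `v₂` solve the same system with the same initial value. That
    -- the second path is a driving path is here part of `v₂` being a solution; in the second claim
    -- it is a hypothesis.
    have hs := h₁.shift hr hdr₂ hc₁ hc₂ h₂.driving hG hD hsub hGD hDt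
    have h := hs.eq_of_eq_zero h₂ hμ hα.le hβ hr hdr₁ (by rw [i₁, i₂, ← hsub]; abel) ht
    rw [hu₁ t ht, hu₂ t ht, ← h, ← hsub]
    abel
  · obtain ⟨v₁, h₁, hu₁⟩ := h₁
    obtain ⟨i₁, V₁, g₁, h₁⟩ := h₁.exists_isPreSolution
    have hs := h₁.shift hr hdr₂ hc₁ hc₂ hd hG hD hsub hGD hDt
    refine ⟨_, hs.isWeakSolution (by rw [i₁, ← hsub]; abel) hr hdr₂ hβ.ne', fun t ht => ?_⟩
    rw [hu₁ t ht, ← hsub]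
    abel
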